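/- Let $p,q,r$ be pairwise relatively prime positive integers, let $a,c$ be integers with $ar(p+q)+cpq=1$, and let $\Sigma=\Sigma(p,q,r)$ be the Brieskorn homology sphere, with fundamental group $$\pi_1\Sigma=\langle x,y,z,h\mid x^p=y^q=h^a,\ z^r=h^c,\ xyz=1,\ h\text{ central}\rangle .$$ A representation $\alpha\colon\pi_1\Sigma\to SU(3)$ is irreducible if no linear subspace of $\mathbb C^3$ other than $0$ and $\mathbb C^3$ is invariant under its image, and reducible otherwise. Give $\operatorname{Hom}(\pi_1\Sigma,SU(3))$ the topology of pointwise convergence, and let $R(\Sigma,SU(3))$ be its quotient by conjugation by $SU(3)$. Call $[\alpha]\in R(\Sigma,SU(3))$ a smooth point if it has an open neighbourhood homeomorphic to the real vector space $H^1(\Sigma;su(3)_\alpha)=H^1(\pi_1\Sigma;su(3)_\alpha)$, with coefficients twisted by the adjoint action. A pointed 2-sphere in $R(\Sigma,SU(3))$ is a path component that is homeomorphic to $S^2$, contains exactly one conjugacy class $[\beta]$ of reducible representations, and has $[\beta]$ as its only non-smooth point. **Proposition.** Let $\alpha\colon\pi_1\Sigma\to SU(3)$ be a nontrivial reducible representation.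 Then $\alpha$ is conjugate in $SU(3)$ to a representation with image in $SU(2)\times\{1\}$. Moreover, for every $\beta\colon\pi_1\Sigma\to SU(2)$ such that $\alpha$ is conjugate in $SU(3)$ to $\beta\oplus 1$, with $\mathbb C^2_\alpha$ denoting $\mathbb C^2$ with $\pi_1\Sigma$ acting through $\beta$ and the defining representation of $SU(2)$, the following are equivalent: 1. $\alpha(h)=I$; 2. $H^1(\Sigma;\mathbb C^2_\alpha)=H^1(\pi_1\Sigma;\mathbb C^2_\alpha)\neq 0$; 3. $\alpha$ is a limit of irreducible representations, i.e. it lies in the closure of the set of irreducible representations in $\operatorname{Hom}(\pi_1\Sigma,SU(3))$. Sending a conjugacy class to the path component of $R(\Sigma,SU(3))$ containing it is a bijection from the set of conjugacy classes of nontrivial reducible representations $\alpha\colon\pi_1\Sigma\to SU(3)$ with $\alpha(h)=I$ onto the set of pointed 2-spheres in $R(\Sigma,SU(3))$. Further, $\operatorname{tr}\alpha(z)$ is constant along each pointed 2-sphere: if $[\alpha]$ and $[\alpha']$ lie on the same pointed 2-sphere, then $\operatorname{tr}\alpha(z)=\operatorname{tr}\alpha'(z)$. -/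

import Mathlib

namespace BrieskornSU3

noncomputable section

/-- The group `SU(2)`. -/
abbrev SU2 : Type := Matrix.specialUnitaryGroup (Fin 2) ℂ

/-- The group `SU(3)`, with its topology as a space of matrices. -/
abbrev SU3 : Type := Matrix.specialUnitaryGroup (Fin 3) ℂ

/-! ### The fundamental group of a Brieskorn sphere -/

/-- The generators of the fundamental group of the Brieskorn sphere `Σ(p,q,r)`. -/
inductive Gen : Type
  | x | y | z | h

/-- The relators of the presentation
`⟨x, y, z, h ∣ x ^ p = y ^ q = h ^ a, z ^ r = h ^ c, x y z = 1, h central⟩`. -/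
def relators (p q r : ℕ) (a c : ℤ) : Set (FreeGroup Gen) :=
  let x := FreeGroup.of Gen.x
  let y := FreeGroup.of Gen.y
  let z := FreeGroup.of Gen.z
  let h := FreeGroup.of Gen.h
  {x ^ p * (h ^ a)⁻¹, y ^ q * (h ^ a)⁻¹, z ^ r * (h ^ c)⁻¹, x * y * z,
    h * x * (x * h)⁻¹, h * y * (y * h)⁻¹, h * z * (z * h)⁻¹}

/-- The fundamental group of the Brieskorn sphere `Σ(p,q,r)`, where `a r (p + q) + c p q = 1`,
given by its standard presentation as a Seifert fibration; `h` is the regular fibre. -/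
abbrev Pi1 (p q r : ℕ) (a c : ℤ) : Type := PresentedGroup (relators p q r a c)

/-- A generator, as an element of the fundamental group. -/
def gen (p q r : ℕ) (a c : ℤ) (s : Gen) : Pi1 p q r a c := PresentedGroup.of s

variable {p q r : ℕ} {a c : ℤ}

/-! ### `SU(3)` representations and the representation variety -/

/-- The set `Hom(π₁ Σ, SU(3))` of representations. -/
abbrev Reps (p q r : ℕ) (a c : ℤ) : Type := Pi1 p q r a c →* SU3

/-- `Hom(π₁ Σ, SU(3))` has the topology of pointwise convergence, which is also its topology as
the space of tuples of images of the generators in `SU(3)`. -/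
instance : TopologicalSpace (Reps p q r a c) :=
  TopologicalSpace.induced (fun α : Reps p q r a c => (α : Pi1 p q r a c → SU3)) inferInstance

/-- Conjugation of representations by elements of `SU(3)`. -/
instance conjSetoid : Setoid (Reps p q r a c) where
  r α β := ∃ g : SU3, ∀ γ, β γ = g * α γ * g⁻¹
  iseqv :=
    { refl := fun α => ⟨1, fun γ => by simp⟩
      symm := by
        rintro α β ⟨g, hg⟩
        exact ⟨g⁻¹, fun γ => by rw [hg]; group⟩
      trans := by
        rintro α β δ ⟨g, hg⟩ ⟨k, hk⟩
        exact ⟨k * g, fun γ => by rw [hk, hg]; group⟩ }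

/-- The representation variety `R(Σ, SU(3))` of conjugacy classes of representations, with the
quotient topology. -/
abbrev RepVariety (p q r : ℕ) (a c : ℤ) : Type := Quotient (conjSetoid (p := p) (q := q)
  (r := r) (a := a) (c := c))

/-- The conjugacy class `[α]`. -/
def cls (α : Reps p q r a c) : RepVariety p q r a c := Quotient.mk _ α

/-- `α` is irreducible if no linear subspace of `ℂ³` other than `0` and `ℂ³` is invariant. -/
def Irred (α : Reps p q r a c) : Prop :=
  ∀ W : Submodule ℂ (Fin 3 → ℂ),
    (∀ γ, ∀ w ∈ W, Matrix.mulVec (α γ : Matrix (Fin 3) (Fin 3) ℂ) w ∈ W) → W = ⊥ ∨ W = ⊤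

/-- `α` is reducible if it is not irreducible. -/
def Red (α : Reps p q r a c) : Prop := ¬ Irred α

/-! ### Reduction to `SU(2) × {1}` and the coefficients `ℂ²` -/

/-- The block matrix `diag(A, 1)`. -/
def block (A : Matrix (Fin 2) (Fin 2) ℂ) : Matrix (Fin 3) (Fin 3) ℂ :=
  !![A 0 0, A 0 1, 0; A 1 0, A 1 1, 0; 0, 0, 1]

/-- `α` is conjugate in `SU(3)` to the representation `γ ↦ diag(β γ, 1)`, with values in
`SU(2) × {1}`. -/
def ConjToSU2 (α : Reps p q r a c) (β : Pi1 p q r a c →* SU2) : Prop :=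
  ∃ g : SU3, ∀ γ, ((g * α γ * g⁻¹ : SU3) : Matrix (Fin 3) (Fin 3) ℂ) =
    block (β γ : Matrix (Fin 2) (Fin 2) ℂ)

/-- The representation of `π₁ Σ` on `ℂ²` given by `β : π₁ Σ → SU(2)` and the defining
representation of `SU(2)`. -/
def stdRep (β : Pi1 p q r a c →* SU2) : Representation ℂ (Pi1 p q r a c) (Fin 2 → ℂ) where
  toFun γ := Matrix.toLin' (β γ : Matrix (Fin 2) (Fin 2) ℂ)
  map_one' := by simp [Module.End.one_eq_id]
  map_mul' γ δ := by simp [Matrix.toLin'_mul, Module.End.mul_eq_comp]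

/-- The twisted cohomology `H¹(Σ; ℂ²_β) = H¹(π₁ Σ; ℂ²_β)`, as group cohomology. -/
abbrev H1C2 (β : Pi1 p q r a c →* SU2) : Type := groupCohomology.H1 (Rep.of (stdRep β))

/-! ### The coefficients `su(3)` and smooth points -/

/-- The real vector space `su(3)` of traceless skew-Hermitian matrices. -/
def su3 : Submodule ℝ (Matrix (Fin 3) (Fin 3) ℂ) where
  carrier := {X | X.conjTranspose = -X ∧ X.trace = 0}
  zero_mem' := by simp
  add_mem' := by
    rintro X Y ⟨hX, hX'⟩ ⟨hY, hY'⟩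
    refine ⟨?_, by simp [Matrix.trace_add, hX', hY']⟩
    rw [Matrix.conjTranspose_add, hX, hY, neg_add]
  smul_mem' := by
    rintro t X ⟨hX, hX'⟩
    refine ⟨?_, by simp [Matrix.trace_smul, hX']⟩
    rw [Matrix.conjTranspose_smul, hX]
    simp

/-- The action `X ↦ g X g⁻¹` on `3 × 3` matrices, as a real linear map. -/
def conjMap (g : SU3) : Matrix (Fin 3) (Fin 3) ℂ →ₗ[ℝ] Matrix (Fin 3) (Fin 3) ℂ where
  toFun X := (g : Matrix (Fin 3) (Fin 3) ℂ) * X * ((g⁻¹ : SU3) : Matrix (Fin 3) (Fin 3) ℂ)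
  map_add' X Y := by rw [mul_add, add_mul]
  map_smul' t X := by simp

theorem conjMap_mem (g : SU3) (X : Matrix (Fin 3) (Fin 3) ℂ) (hX : X ∈ su3) :
    conjMap g X ∈ su3 := by
  obtain ⟨h1, h2⟩ := hX
  have hinv : ((g⁻¹ : SU3) : Matrix (Fin 3) (Fin 3) ℂ)
      = (g : Matrix (Fin 3) (Fin 3) ℂ).conjTranspose := rfl
  have hmul : ((g⁻¹ : SU3) : Matrix (Fin 3) (Fin 3) ℂ) * (g : Matrix (Fin 3) (Fin 3) ℂ) = 1 := by
    rw [← Submonoid.coe_mul, inv_mul_cancel, Submonoid.coe_one]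
  refine ⟨?_, ?_⟩
  · change ((g : Matrix (Fin 3) (Fin 3) ℂ) * X * _).conjTranspose = -(_ * X * _)
    rw [hinv, Matrix.conjTranspose_mul, Matrix.conjTranspose_mul,
      Matrix.conjTranspose_conjTranspose, h1, Matrix.neg_mul, Matrix.mul_neg, mul_assoc]
  · change ((g : Matrix (Fin 3) (Fin 3) ℂ) * X * _).trace = 0
    rw [Matrix.trace_mul_comm, ← mul_assoc, hmul, one_mul, h2]

/-- The representation of `π₁ Σ` on `su(3)` given by `α` and the adjoint action of `SU(3)`. -/
def adRep (α : Reps p q r a c) : Representation ℝ (Pi1 p q r a c) su3 where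
  toFun γ := (conjMap (α γ)).restrict (conjMap_mem (α γ))
  map_one' := by
    ext1 X
    apply Subtype.ext
    simp [conjMap]
  map_mul' γ δ := by
    ext1 X
    apply Subtype.ext
    simp [conjMap, mul_assoc]

/-- The twisted cohomology `H¹(Σ; su(3)_α) = H¹(π₁ Σ; su(3)_α)`, as group cohomology. -/
abbrev H1su3 (α : Reps p q r a c) : Type := groupCohomology.H1 (Rep.of (adRep α))

/-- `[α]` is a smooth point of `R(Σ, SU(3))`: it has an open neighbourhood that is homeomorphic to
the finite-dimensional real vector space `H¹(Σ; su(3)_α)`. -/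
def SmoothAt (α : Reps p q r a c) : Prop :=
  ∃ U : Set (RepVariety p q r a c), IsOpen U ∧ cls α ∈ U ∧
    Nonempty (U ≃ₜ EuclideanSpace ℝ (Fin (Module.finrank ℝ (H1su3 α))))

/-! ### Pointed 2-spheres -/

/-- A pointed 2-sphere in `R(Σ, SU(3))`: a path component, homeomorphic to the 2-sphere, which
contains exactly one reducible conjugacy class `[β]`, and in which `[β]` is the only
point that is not smooth. -/
structure IsPointedSphere (C : Set (RepVariety p q r a c)) : Prop where
  isPathComponent : ∃ ξ, C = pathComponent ξ
  homeo : Nonempty (C ≃ₜ Metric.sphere (0 : EuclideanSpace ℝ (Fin 3)) 1)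
  exists_point : ∃ β : Reps p q r a c, cls β ∈ C ∧ Red β ∧ ¬ SmoothAt β ∧
    ∀ α : Reps p q r a c, cls α ∈ C → cls α ≠ cls β → Irred α ∧ SmoothAt α

/-- The conjugacy classes of nontrivial reducible representations `α` with `α(h) = I`. -/
def reducibleClasses (p q r : ℕ) (a c : ℤ) : Set (RepVariety p q r a c) :=
  {ξ | ∃ α : Reps p q r a c, cls α = ξ ∧ Red α ∧ α ≠ 1 ∧ α (gen p q r a c Gen.h) = 1}

end

end BrieskornSU3

/-!
The nontrivial reducible representations reduce to `SU(2) × {1}` because `π₁ Σ` is perfect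
(`eq_one_of_commute`): an invariant line, which exists in `ℂ³` for every reducible representation,
is fixed pointwise (`Red.exists_fixed`). None of `x`, `y`, `z` then goes to `±1` in `SU(2)`
(`rep_gen_ne`), while `h`, being central, goes to `±1`.

For any representation, `h` goes to an element of order dividing `6`, by Schur's lemma and the
reducible case. Hence the images of the generators have bounded order, their traces take finitely
many values, and the sets on which all these traces are constant are open and closed
(`isClopen_level`). This gives the constancy of `tr α(z)` on components, shows that the trivial
representation is isolated, and reduces everything to a single level set.

Let `α` be nontrivial and reducible with `α(h) = 1`. A class in the level set of `α` is that of a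
pair of matrices `X`, `Y` with `X = V diag(1, ζ, ζ̄) Vᴴ`, `Y = W diag(1, ξ, ξ̄) Wᴴ` and
`tr X Y = 1 + 2 Re ω`. The pair is determined by the unitary matrix `U = Vᴴ W` up to phases. The squared moduli
of `U` form a doubly stochastic matrix, on which the condition on `tr X Y` leaves two parameters
`e` and `t`. The rows of `U` are orthogonal, which means that three complex numbers with known
moduli form a triangle, and the remaining coordinate `s` is its signed area, up to a factor. By Heron's
formula `s² = F(e, t²)` for an explicit polynomial `F`, and these coordinates identify the level set with this
surface (`HasAngles.cls_eq_of_repCoords`, `HasAngles.exists_rep`). The reducible classes are those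
with coordinates `(0, 0, 0)`.

The region of the points `(e, t²)` is a disc whose boundary consists of two arcs, one on `t = 0`
and one on `F = 0` (`exists_region_shape`). The surface consists of four copies of it glued along
these arcs, hence is a sphere (`exists_surface_sphere`, `level_homeo`). The level set is therefore
a path component with a single reducible class, and this class is a limit of irreducible ones
because points of a sphere are not isolated. Conversely, limits of irreducible representations send
`h` to limits of scalar matrices, which among the elements of `SU(2) × {1}` leaves only the
identity.

Smoothness is a matter of counting cocycles. A cocycle that vanishes on `h` restricts to a
coboundary on each of the cyclic groups generated by `x`, `y`, `z`, and the only remaining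
condition is that from `x y z = 1` (`map_ker_le_range`, `range_evalMap`). With coefficients `ℂ²`
this shows that `H¹` is nonzero if `α(h) = 1`; otherwise the central element `h` acts by `-1` and
`H¹` vanishes. With coefficients `su(3)` the dimension is `2` at irreducible classes, which are
therefore smooth, and at least `3` at the reducible class, which is not smooth since no Euclidean
space of that dimension is homeomorphic to an open subset of the sphere
(`not_isOpenEmbedding_sphere`).
-/

namespace BrieskornSU3

noncomputable section

/-! ### The discriminant curve -/

/-- The affine function `m(e) = δ - κ e`, the difference of the two entries of the inner block of
a doubly stochastic matrix in the slice. -/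
def slopeFn (κ δ e : ℝ) : ℝ := δ - κ * e

/-- The value of the discriminant along the symmetry axis `T = 0`, divided by `e²`. -/
def axisFn (κ δ e : ℝ) : ℝ := 1 - 2 * e - slopeFn κ δ e ^ 2

/-- The linear coefficient of the discriminant, a quadratic polynomial in `T`. -/
def linFn (μ ν κ δ e : ℝ) : ℝ := (1 - 2 * e) * (μ + ν) + 2 * (1 - e) * slopeFn κ δ e

/-- The discriminant `F(e, T)` of the orthogonality triangle of two rows; the triangle exists if
and only if it is nonnegative. -/
def discFn (μ ν κ δ e T : ℝ) : ℝ := -T ^ 2 - linFn μ ν κ δ e * T + e ^ 2 * axisFn κ δ e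

/-- The affine function `P(e)` whose comparison with `ν e` bounds the region. -/
def boundFn (μ ν κ δ e : ℝ) : ℝ := (μ + ν) / 2 + slopeFn κ δ e

/-- A quarter of the discriminant of `F(e, T)` as a polynomial in `T`. -/
def radFn (μ ν κ δ e : ℝ) : ℝ :=
  (1 - 2 * e) * (boundFn μ ν κ δ e - μ * e) * (boundFn μ ν κ δ e - ν * e)

/-- The region in the plane of `(e, T)` over which the moduli space lies. -/
def Adm (μ ν κ δ e T : ℝ) : Prop :=
  0 ≤ e ∧ e ≤ 1 / 2 ∧ ν * e ≤ boundFn μ ν κ δ e ∧ 0 ≤ T ∧ 0 ≤ discFn μ ν κ δ e T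

section Region

variable {μ ν κ δ e T : ℝ}

theorem radFn_eq (hμν : μ * ν = 1) :
    radFn μ ν κ δ e = (linFn μ ν κ δ e / 2) ^ 2 + e ^ 2 * axisFn κ δ e := by
  unfold radFn linFn axisFn boundFn
  generalize slopeFn κ δ e = m
  linear_combination (e ^ 2 * (1 - 2 * e)) * hμν

theorem discFn_eq (hμν : μ * ν = 1) :
    discFn μ ν κ δ e T = radFn μ ν κ δ e - (T + linFn μ ν κ δ e / 2) ^ 2 := by
  rw [radFn_eq hμν]
  unfold discFn
  ring

/-- Where the discriminant is nonnegative, `T` is at most the larger root of `F(e, ·)`, and the two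
hypotheses say that `k` times this root is at most `w`. -/
theorem le_of_discFn_nonneg (hμν : μ * ν = 1) {k w : ℝ}
    (hw : 0 ≤ w + k * (linFn μ ν κ δ e / 2))
    (hsq : k ^ 2 * radFn μ ν κ δ e ≤ (w + k * (linFn μ ν κ δ e / 2)) ^ 2)
    (hF : 0 ≤ discFn μ ν κ δ e T) : k * T ≤ w := by
  by_contra! h
  rw [discFn_eq hμν] at hF
  have h1 : w + k * (linFn μ ν κ δ e / 2) < k * (T + linFn μ ν κ δ e / 2) := by linarith
  have h2 := pow_lt_pow_left₀ h1 hw two_ne_zero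
  have h3 := mul_nonneg (sq_nonneg k) hF
  nlinarith

/-- The sums of pairs of entries of the inner block are nonnegative in the region. -/
theorem Adm.slope_bounds (hμν : μ * ν = 1) (hμ : 0 < μ) (hle : μ ≤ ν) (hδ : |δ| < 1)
    (h : Adm μ ν κ δ e T) : 0 ≤ 1 - e + slopeFn κ δ e ∧ 0 ≤ 1 - e - slopeFn κ δ e := by
  obtain ⟨he0, he1, hP, hT, hF⟩ := h
  obtain ⟨hδ1, hδ2⟩ := abs_lt.1 hδ
  have hν1 : 1 ≤ ν := by nlinarith
  obtain ⟨t, ht⟩ : ∃ t, t = boundFn μ ν κ δ e - ν * e := ⟨_, rfl⟩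
  have ht0 : 0 ≤ t := by linarith
  have hm : slopeFn κ δ e = t + ν * e - (μ + ν) / 2 := by
    rw [ht]; unfold boundFn; ring
  have hm1 : 0 ≤ 1 - e - slopeFn κ δ e := by
    rcases le_or_gt (slopeFn κ δ e) 0 with h0 | h0
    · linarith
    rcases he0.eq_or_lt with h0' | h0'
    · subst h0'; unfold slopeFn; linarith
    have hL : 0 ≤ linFn μ ν κ δ e := by
      unfold linFn
      have := mul_nonneg (by linarith : 0 ≤ 1 - 2 * e) (by linarith : 0 ≤ μ + ν)
      have := mul_nonneg (by linarith : 0 ≤ 2 * (1 - e)) h0.le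
      linarith
    have hG : 0 ≤ axisFn κ δ e := by
      unfold discFn at hF
      have := mul_nonneg hL hT
      by_contra! hneg
      have := mul_neg_of_pos_of_neg (pow_pos h0' 2) hneg
      linarith [sq_nonneg T]
    unfold axisFn at hG
    have := (abs_le_of_sq_le_sq' (by linarith [sq_nonneg e] :
      slopeFn κ δ e ^ 2 ≤ (1 - e) ^ 2) (by linarith)).2
    linarith
  have hm2 : 0 ≤ 1 - e + slopeFn κ δ e := by
    rcases le_or_gt 0 (slopeFn κ δ e) with h0 | h0
    · linarith
    rcases le_or_gt 0 (axisFn κ δ e) with hG | hG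
    · unfold axisFn at hG
      have := (abs_le_of_sq_le_sq' (by linarith [sq_nonneg e] :
        slopeFn κ δ e ^ 2 ≤ (1 - e) ^ 2) (by linarith)).1
      linarith
    by_contra! hneg
    have h0' : 0 < e := by
      rcases he0.eq_or_lt with h0' | h0'
      · rw [← h0'] at hneg
        unfold slopeFn at hneg
        linarith
      · exact h0'
    have hL : linFn μ ν κ δ e < 0 := by
      by_contra! hL
      unfold discFn at hF
      have h1 := mul_nonneg hL hT
      have := mul_neg_of_pos_of_neg (pow_pos h0' 2) hG
      linarith [sq_nonneg T]
    have hL' : linFn μ ν κ δ e = e * (ν - μ - 2 * ν * e) + 2 * (1 - e) * t := by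
      unfold linFn; rw [hm]; ring
    have h2 : e * (ν - μ - 2 * ν * e) < 0 := by
      have := mul_nonneg (by linarith : 0 ≤ 2 * (1 - e)) ht0
      linarith
    have h3 : ν - μ - 2 * ν * e < 0 := by
      by_contra! h4
      have := mul_nonneg he0 h4
      linarith
    -- hence `e` exceeds `(1 - μ²) / 2`
    have h4 : 1 - e + slopeFn κ δ e = 1 - e + t + ν * e - (μ + ν) / 2 := by rw [hm]; ring
    have h5 : μ * (ν - μ - 2 * ν * e) < 0 := mul_neg_of_pos_of_neg hμ h3
    have h6 : 1 - μ ^ 2 < 2 * e := by nlinarith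
    have h7 : (ν - 1) * (1 - μ ^ 2) ≤ (ν - 1) * (2 * e) :=
      mul_le_mul_of_nonneg_left h6.le (by linarith)
    have h8 : (ν - 1) * (1 - μ ^ 2) = ν - μ - 1 + μ ^ 2 := by linear_combination (-μ) * hμν
    linarith [sq_nonneg (1 - μ)]
  exact ⟨hm2, hm1⟩

/-- In the region the entries of the doubly stochastic matrix are nonnegative. The inequalities are
those for products of pairs of entries. They hold because the discriminant is minus a square
wherever an entry vanishes, so that the curves on which entries vanish touch the discriminant
curve. -/
theorem Adm.entries (hμν : μ * ν = 1) (hμ : 0 < μ) (hle : μ ≤ ν) (hδ : |δ| < 1)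
    (h : Adm μ ν κ δ e T) :
    ν * T ≤ e ^ 2 ∧ 0 ≤ 1 - e + slopeFn κ δ e ∧ 0 ≤ 1 - e - slopeFn κ δ e ∧
      (μ + ν - 2) * T ≤ (1 - e + slopeFn κ δ e) ^ 2 ∧
      (μ + ν + 2) * T ≤ (1 - e - slopeFn κ δ e) ^ 2 := by
  obtain ⟨he0, he1, hP, hT, hF⟩ := id h
  have hν : 0 < ν := hμ.trans_le hle
  have hν1 : 1 ≤ ν := by nlinarith
  obtain ⟨t, ht⟩ : ∃ t, t = boundFn μ ν κ δ e - ν * e := ⟨_, rfl⟩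
  have ht0 : 0 ≤ t := by linarith
  have hm : slopeFn κ δ e = t + ν * e - (μ + ν) / 2 := by
    rw [ht]; unfold boundFn; ring
  -- the three lower bounds for the vertex of the parabola
  have hv1 : 0 ≤ e ^ 2 + ν * (linFn μ ν κ δ e / 2) := by
    have : e ^ 2 + ν * (linFn μ ν κ δ e / 2)
        = ν * (e * (1 / 2 - e) * (ν - μ) + (1 - e) * t) := by
      unfold linFn; rw [hm]; linear_combination (-e ^ 2) * hμν
    rw [this]
    have := mul_nonneg (mul_nonneg he0 (by linarith : 0 ≤ 1 / 2 - e)) (sub_nonneg.2 hle)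
    have := mul_nonneg (by linarith : 0 ≤ 1 - e) ht0
    exact mul_nonneg hν.le (by linarith)
  have hstep : 0 ≤ t * (e * (ν - (μ + ν) / 2)) :=
    mul_nonneg ht0 (mul_nonneg he0 (by linarith))
  have hv2 : 0 ≤ (1 - e + slopeFn κ δ e) ^ 2 + (μ + ν - 2) * (linFn μ ν κ δ e / 2) := by
    have : (1 - e + slopeFn κ δ e) ^ 2 + (μ + ν - 2) * (linFn μ ν κ δ e / 2)
        = (μ + ν - 2) ^ 2 * (1 - 2 * e) / 4 + t ^ 2 + 2 * (t * (e * (ν - (μ + ν) / 2))) := by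
      unfold linFn; rw [hm]; linear_combination (-e ^ 2) * hμν
    rw [this]
    have := mul_nonneg (sq_nonneg (μ + ν - 2)) (by linarith : 0 ≤ 1 - 2 * e)
    nlinarith [sq_nonneg t]
  have hv3 : 0 ≤ (1 - e - slopeFn κ δ e) ^ 2 + (μ + ν + 2) * (linFn μ ν κ δ e / 2) := by
    have : (1 - e - slopeFn κ δ e) ^ 2 + (μ + ν + 2) * (linFn μ ν κ δ e / 2)
        = (μ + ν + 2) ^ 2 * (1 - 2 * e) / 4 + t ^ 2 + 2 * (t * (e * (ν - (μ + ν) / 2))) := by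
      unfold linFn; rw [hm]; linear_combination (-e ^ 2) * hμν
    rw [this]
    have := mul_nonneg (sq_nonneg (μ + ν + 2)) (by linarith : 0 ≤ 1 - 2 * e)
    nlinarith [sq_nonneg t]
  obtain ⟨hm2, hm1⟩ := Adm.slope_bounds hμν hμ hle hδ h
  refine ⟨?_, hm2, hm1, ?_, ?_⟩
  · refine le_of_discFn_nonneg hμν hv1 ?_ hF
    have : (e ^ 2 + ν * (linFn μ ν κ δ e / 2)) ^ 2 - ν ^ 2 * radFn μ ν κ δ e
        = (e * (1 - e + ν * slopeFn κ δ e)) ^ 2 := by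
      rw [radFn_eq hμν]
      unfold linFn axisFn
      generalize slopeFn κ δ e = m
      linear_combination (e ^ 2 * (1 - 2 * e)) * hμν
    linarith [sq_nonneg (e * (1 - e + ν * slopeFn κ δ e))]
  · refine le_of_discFn_nonneg hμν hv2 ?_ hF
    have : ((1 - e + slopeFn κ δ e) ^ 2 + (μ + ν - 2) * (linFn μ ν κ δ e / 2)) ^ 2
        - (μ + ν - 2) ^ 2 * radFn μ ν κ δ e
        = ((1 - e + slopeFn κ δ e) ^ 2
          + (μ + ν - 2) * ((1 - e) * (1 - e + slopeFn κ δ e) - e ^ 2)) ^ 2 := by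
      rw [radFn_eq hμν]
      unfold linFn axisFn
      ring
    linarith [sq_nonneg ((1 - e + slopeFn κ δ e) ^ 2
          + (μ + ν - 2) * ((1 - e) * (1 - e + slopeFn κ δ e) - e ^ 2))]
  · refine le_of_discFn_nonneg hμν hv3 ?_ hF
    have : ((1 - e - slopeFn κ δ e) ^ 2 + (μ + ν + 2) * (linFn μ ν κ δ e / 2)) ^ 2
        - (μ + ν + 2) ^ 2 * radFn μ ν κ δ e
        = ((1 - e - slopeFn κ δ e) ^ 2
          - (μ + ν + 2) * ((1 - e) * (1 - e - slopeFn κ δ e) - e ^ 2)) ^ 2 := by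
      rw [radFn_eq hμν]
      unfold linFn axisFn
      ring
    linarith [sq_nonneg ((1 - e - slopeFn κ δ e) ^ 2
          - (μ + ν + 2) * ((1 - e) * (1 - e - slopeFn κ δ e) - e ^ 2))]

/-- Conversely, nonnegativity of the entries and of the discriminant characterizes the region. -/
theorem Adm.of_entries (hμν : μ * ν = 1) (hμ : 0 < μ) (hle : μ ≤ ν) (he0 : 0 ≤ e)
    (he1 : e ≤ 1 / 2) (hT : 0 ≤ T) (hTe : ν * T ≤ e ^ 2) (hm : 0 ≤ 1 - e + slopeFn κ δ e)
    (hF : 0 ≤ discFn μ ν κ δ e T) : Adm μ ν κ δ e T := by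
  refine ⟨he0, he1, ?_, hT, hF⟩
  have hν : 0 < ν := hμ.trans_le hle
  have hν1 : 1 ≤ ν := by nlinarith
  have hμ1 : μ ≤ 1 := by nlinarith
  have hk : 0 ≤ μ + ν - 2 := by nlinarith [sq_nonneg (ν - 1)]
  -- where the claim fails, the discriminant of `F(e, ·)` is nonnegative only if one of its first
  -- two factors vanishes
  by_contra! hneg
  have hP : e ≤ boundFn μ ν κ δ e := by unfold boundFn; linarith
  rw [discFn_eq hμν] at hF
  have hrad : 0 ≤ radFn μ ν κ δ e := by nlinarith [sq_nonneg (T + linFn μ ν κ δ e / 2)]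
  have hμe : μ * e ≤ e := by nlinarith
  have hfac : (1 - 2 * e) * (boundFn μ ν κ δ e - μ * e) = 0 := by
    have h1 : 0 ≤ (1 - 2 * e) * (boundFn μ ν κ δ e - μ * e) :=
      mul_nonneg (by linarith) (by linarith)
    have h2 : (boundFn μ ν κ δ e - ν * e) < 0 := by linarith
    unfold radFn at hrad
    by_contra h3
    have := mul_neg_of_pos_of_neg (lt_of_le_of_ne h1 (Ne.symm h3)) h2
    linarith
  rcases mul_eq_zero.1 hfac with h | h
  · have he : e = 1 / 2 := by linarith
    have h0 : radFn μ ν κ δ e = 0 := by unfold radFn; rw [he]; ring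
    rw [h0] at hF
    have hTL : T + linFn μ ν κ δ e / 2 = 0 := by
      have := sq_nonneg (T + linFn μ ν κ δ e / 2)
      exact pow_eq_zero_iff two_ne_zero |>.1 (le_antisymm (by linarith) this)
    unfold linFn at hTL
    unfold boundFn at hneg
    have : T ≤ μ / 4 := by
      have := mul_le_mul_of_nonneg_left hTe hμ.le
      rw [he] at this
      nlinarith
    rw [he] at hneg hTL
    nlinarith
  · have h1 : μ * e = e := by linarith
    rcases he0.eq_or_lt with h0 | h0
    · rw [← h0] at hneg h
      linarith
    · have : μ = 1 := by
        have : (μ - 1) * e = 0 := by linarith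
        rcases mul_eq_zero.1 this with h | h <;> linarith
      have : ν = 1 := by rw [this] at hμν; linarith
      have : ν * e = e := by rw [this, one_mul]
      linarith

end Region

section RegionShape

variable {μ ν κ δ : ℝ}

theorem continuous_axisFn : Continuous (axisFn κ δ) := by
  unfold axisFn slopeFn; fun_prop

theorem continuous_linFn : Continuous (linFn μ ν κ δ) := by
  unfold linFn slopeFn; fun_prop

theorem continuous_radFn : Continuous (radFn μ ν κ δ) := by
  unfold radFn boundFn slopeFn; fun_prop

/-- On the symmetry axis the discriminant changes sign exactly once. -/
theorem exists_axisFn_root (hδ : |δ| < 1) :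
    ∃ e₁, 0 < e₁ ∧ e₁ ≤ 1 / 2 ∧ axisFn κ δ e₁ = 0 ∧
      (∀ e, 0 ≤ e → e < e₁ → 0 < axisFn κ δ e) ∧ ∀ e, e₁ < e → axisFn κ δ e < 0 := by
  have h0 : 0 < axisFn κ δ 0 := by
    have := (sq_lt_one_iff_abs_lt_one δ).2 hδ
    unfold axisFn slopeFn
    simpa using this
  have h1 : axisFn κ δ (1 / 2) ≤ 0 := by
    unfold axisFn
    nlinarith [sq_nonneg (slopeFn κ δ (1 / 2))]
  obtain ⟨e₁, ⟨he0, he1⟩, he⟩ := intermediate_value_Icc' (by norm_num : (0 : ℝ) ≤ 1 / 2)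
    (continuous_axisFn (κ := κ) (δ := δ)).continuousOn ⟨h1, h0.le⟩
  have hpos : 0 < e₁ := by
    rcases he0.eq_or_lt with h | h
    · rw [← h] at he; linarith
    · exact h
  -- the second factor increases with `e`, and it is positive at `e = 0` since `axisFn` is
  have hfac : ∀ e, axisFn κ δ e = (e₁ - e) * (κ ^ 2 * (e + e₁) + 2 * (1 - δ * κ)) := by
    intro e
    have : axisFn κ δ e = axisFn κ δ e - axisFn κ δ e₁ := by rw [he, sub_zero]
    rw [this]
    unfold axisFn slopeFn
    ring
  have hq : 0 < κ ^ 2 * e₁ + 2 * (1 - δ * κ) := by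
    have := hfac 0
    rw [this] at h0
    have := (mul_pos_iff_of_pos_left (by linarith : 0 < e₁ - 0)).1 h0
    simpa using this
  have hq' : ∀ e, 0 ≤ e → 0 < κ ^ 2 * (e + e₁) + 2 * (1 - δ * κ) := by
    intro e h
    have := mul_nonneg (sq_nonneg κ) h
    linarith
  refine ⟨e₁, hpos, he1, he, fun e h h' => ?_, fun e h => ?_⟩
  · rw [hfac]
    exact mul_pos (by linarith) (hq' e h)
  · rw [hfac]
    exact mul_neg_of_neg_of_pos (by linarith) (hq' e (by linarith))

/-- The shape of the region: it lies between the graphs of two functions `l ≤ u` on an interval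
`[0, b]`, which meet only over the end points. Its intersection with the axis `T = 0` is
`[0, e₁]`, and the remaining part of its boundary is the discriminant curve. For `e₁ < b` the
region has a dent at the point `(e₁, 0)`. -/
theorem exists_region_shape (hμν : μ * ν = 1) (hμ : 0 < μ) (hle : μ ≤ ν) (hκ : 0 < κ)
    (hδ : |δ| < 1) :
    ∃ (e₁ b : ℝ) (l u : ℝ → ℝ), 0 < e₁ ∧ e₁ ≤ b ∧ Continuous l ∧ Continuous u ∧
      (∀ e T, Adm μ ν κ δ e T ↔ 0 ≤ e ∧ e ≤ b ∧ l e ≤ T ∧ T ≤ u e) ∧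
      (∀ e, 0 < e → e < b → l e < u e) ∧ l 0 = u 0 ∧ l b = u b ∧
      (∀ e, 0 ≤ e → e ≤ e₁ → l e = 0) ∧ (∀ e, e₁ < e → e ≤ b → 0 < l e) ∧
      ∀ e T, Adm μ ν κ δ e T →
        (discFn μ ν κ δ e T = 0 ↔ T = u e ∨ (T = l e ∧ e₁ ≤ e)) := by
  obtain ⟨hδ1, hδ2⟩ := abs_lt.1 hδ
  have hν : 0 < ν := hμ.trans_le hle
  have hρ : 2 ≤ μ + ν := by nlinarith [sq_nonneg (μ - ν)]
  obtain ⟨e₁, he₁0, he₁h, hG₁, hGpos, hGneg⟩ := exists_axisFn_root (κ := κ) hδ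
  -- `E` is the right end of the interval on which `F(e, ·)` has real roots `-L / 2 ± S`
  set E := min (1 / 2) (((μ + ν) / 2 + δ) / (κ + ν)) with hE
  have hκν : 0 < κ + ν := by linarith
  have hE_iff : ∀ e, e ≤ E ↔ e ≤ 1 / 2 ∧ ν * e ≤ boundFn μ ν κ δ e := by
    intro e
    rw [hE, le_min_iff, le_div_iff₀ hκν]
    unfold boundFn slopeFn
    constructor
    · rintro ⟨h, h'⟩; exact ⟨h, by linarith⟩
    · rintro ⟨h, h'⟩; exact ⟨h, by linarith⟩
  have hE_iff' : ∀ e, e < E ↔ e < 1 / 2 ∧ ν * e < boundFn μ ν κ δ e := by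
    intro e
    rw [hE, lt_min_iff, lt_div_iff₀ hκν]
    unfold boundFn slopeFn
    constructor
    · rintro ⟨h, h'⟩; exact ⟨h, by linarith⟩
    · rintro ⟨h, h'⟩; exact ⟨h, by linarith⟩
  have hA : ∀ e T, Adm μ ν κ δ e T ↔ 0 ≤ e ∧ e ≤ E ∧ 0 ≤ T ∧ 0 ≤ discFn μ ν κ δ e T := by
    intro e T
    rw [hE_iff]
    unfold Adm
    tauto
  have hE0 : 0 < E := (hE_iff' 0).2 ⟨by norm_num, by unfold boundFn slopeFn; linarith⟩
  have hradpos : ∀ e, 0 ≤ e → e < E → 0 < radFn μ ν κ δ e := by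
    intro e h0 h
    obtain ⟨h1, h2⟩ := (hE_iff' e).1 h
    have h3 : μ * e ≤ ν * e := mul_le_mul_of_nonneg_right hle h0
    exact mul_pos (mul_pos (by linarith) (by linarith)) (by linarith)
  have hradE : radFn μ ν κ δ E = 0 := by
    obtain ⟨h1, h2⟩ := (hE_iff E).1 le_rfl
    have h3 : ¬(E < 1 / 2 ∧ ν * E < boundFn μ ν κ δ E) := fun h => lt_irrefl _ ((hE_iff' E).2 h)
    unfold radFn
    by_cases h4 : E < 1 / 2
    · have : boundFn μ ν κ δ E - ν * E = 0 := by
        by_contra h5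
        exact h3 ⟨h4, lt_of_le_of_ne h2 fun h => h5 (by rw [h]; ring)⟩
      rw [this, mul_zero]
    · have : 1 - 2 * E = 0 := by linarith
      rw [this, zero_mul, zero_mul]
  have he₁E : e₁ ≤ E := by
    refine ((hA e₁ 0).1 (Adm.of_entries hμν hμ hle he₁0.le he₁h le_rfl ?_ ?_ ?_)).2.1
    · nlinarith [sq_nonneg e₁]
    · have h1 : slopeFn κ δ e₁ ^ 2 ≤ (1 - e₁) ^ 2 := by
        unfold axisFn at hG₁
        linarith [sq_nonneg e₁]
      have := (abs_le_of_sq_le_sq' h1 (by linarith)).1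
      linarith
    · unfold discFn
      rw [hG₁]
      simp
  set L := linFn μ ν κ δ with hL
  set S : ℝ → ℝ := fun e => √(radFn μ ν κ δ e) with hS
  have hScont : Continuous S := continuous_radFn.sqrt
  have hLcont : Continuous L := continuous_linFn
  have hradnn : ∀ e, 0 ≤ e → e ≤ E → 0 ≤ radFn μ ν κ δ e := by
    intro e h0 h
    rcases h.eq_or_lt with rfl | h
    · exact hradE.ge
    · exact (hradpos e h0 h).le
  have hSsq : ∀ e, 0 ≤ e → e ≤ E → S e ^ 2 = (L e / 2) ^ 2 + e ^ 2 * axisFn κ δ e := by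
    intro e h0 h
    rw [hS, hL, ← radFn_eq hμν]
    exact Real.sq_sqrt (hradnn e h0 h)
  have hS0 : ∀ e, 0 ≤ S e := fun e => Real.sqrt_nonneg _
  have hSpos : ∀ e, 0 ≤ e → e < E → 0 < S e := fun e h h' => Real.sqrt_pos.2 (hradpos e h h')
  have hSE : S E = 0 := by rw [hS]; simp [hradE]
  have hdisc : ∀ e T, 0 ≤ e → e ≤ E →
      discFn μ ν κ δ e T = (T - (-(L e / 2) - S e)) * (-(L e / 2) + S e - T) := by
    intro e T h0 h
    have h1 : discFn μ ν κ δ e T = S e ^ 2 - (T + L e / 2) ^ 2 := by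
      rw [discFn_eq hμν, hS]
      simp only [Real.sq_sqrt (hradnn e h0 h), hL]
    rw [h1]
    ring
  -- the roots have product `-e² G` with `G` the value of `axisFn`, whose sign therefore decides
  -- whether `0` lies between them
  have hle₁ : ∀ e, 0 ≤ e → e ≤ e₁ → |L e / 2| ≤ S e := by
    intro e h0 h
    refine abs_le_of_sq_le_sq ?_ (hS0 e)
    rw [hSsq e h0 (h.trans he₁E)]
    have : 0 ≤ axisFn κ δ e := by
      rcases h.eq_or_lt with rfl | h
      · exact hG₁.ge
      · exact (hGpos e h0 h).le
    have := mul_nonneg (sq_nonneg e) this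
    linarith
  have hlt₁ : ∀ e, 0 < e → e < e₁ → |L e / 2| < S e := by
    intro e h0 h
    refine abs_lt_of_sq_lt_sq ?_ (hS0 e)
    rw [hSsq e h0.le (h.le.trans he₁E)]
    have := mul_pos (pow_pos h0 2) (hGpos e h0.le h)
    linarith
  have hgt₁ : ∀ e, e₁ < e → e ≤ E → S e < |L e / 2| := by
    intro e h0 h
    refine lt_abs.2 ?_
    have h1 := hSsq e (by linarith) h
    have h2 := mul_neg_of_pos_of_neg (pow_pos (he₁0.trans h0) 2) (hGneg e h0)
    have h3 : S e ^ 2 < (L e / 2) ^ 2 := by linarith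
    have h4 := (sq_lt_sq₀ (hS0 e) (abs_nonneg (L e / 2))).1 (by rwa [sq_abs])
    exact lt_abs.1 h4
  have hat₁ : S e₁ = |L e₁ / 2| := by
    have h1 := hSsq e₁ he₁0.le he₁E
    rw [hG₁, mul_zero, add_zero, ← sq_abs (L e₁ / 2)] at h1
    exact (pow_left_inj₀ (hS0 _) (abs_nonneg _) two_ne_zero).1 h1
  have hzero : S 0 = L 0 / 2 := by
    have h1 := hSsq 0 le_rfl hE0.le
    have h2 : 0 ≤ L 0 / 2 := by rw [hL]; unfold linFn slopeFn; linarith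
    simp only [ne_eq, OfNat.ofNat_ne_zero, not_false_eq_true, zero_pow, zero_mul, add_zero] at h1
    exact (pow_left_inj₀ (hS0 _) h2 two_ne_zero).1 h1
  by_cases hcase : e₁ < E ∧ L E < 0
  · -- the region reaches beyond `e₁`, because `L` has no zero on `[e₁, E]`
    obtain ⟨hlt, hLE⟩ := hcase
    have hLneg : ∀ e, e₁ ≤ e → e ≤ E → L e < 0 := by
      intro e h1 h2
      by_contra! h3
      obtain ⟨e', ⟨h4, h5⟩, h6⟩ := intermediate_value_Icc' h2 hLcont.continuousOn
        (show (0 : ℝ) ∈ Set.Icc (L E) (L e) from ⟨hLE.le, h3⟩)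
      rcases (h1.trans h4).eq_or_lt with h7 | h7
      · have := hSpos e₁ he₁0.le hlt
        rw [hat₁, h7, h6] at this
        simp at this
      · have := hgt₁ e' h7 h5
        rw [h6] at this
        have := hS0 e'
        simp at *
        linarith
    refine ⟨e₁, E, fun e => max 0 (-(L e / 2) - S e), fun e => -(L e / 2) + S e, he₁0, he₁E,
      by fun_prop, by fun_prop, ?_, ?_, ?_, ?_, ?_, ?_, ?_⟩
    · intro e T
      rw [hA]
      simp only [max_le_iff]
      constructor
      · rintro ⟨h0, h1, h2, h3⟩
        rw [discFn_eq hμν] at h3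
        have h4 : |T + L e / 2| ≤ S e := Real.abs_le_sqrt (by linarith)
        obtain ⟨h5, h6⟩ := abs_le.1 h4
        exact ⟨h0, h1, ⟨h2, by linarith⟩, by linarith⟩
      · rintro ⟨h0, h1, ⟨h2, h3⟩, h4⟩
        refine ⟨h0, h1, h2, ?_⟩
        rw [hdisc e T h0 h1]
        exact mul_nonneg (by linarith) (by linarith)
    · intro e h0 h1
      refine max_lt ?_ (by linarith [hSpos e h0.le h1])
      rcases lt_or_ge e e₁ with h | h
      · have := (abs_lt.1 (hlt₁ e h0 h)).2
        linarith
      · have := hLneg e h h1.le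
        linarith [hS0 e]
    · change max 0 (-(L 0 / 2) - S 0) = -(L 0 / 2) + S 0
      rw [← hzero, neg_add_cancel]
      exact max_eq_left (by linarith [hS0 0])
    · have := hLneg E he₁E le_rfl
      simp only [hSE, sub_zero, add_zero]
      exact max_eq_right (by linarith)
    · intro e h0 h1
      have := (abs_le.1 (hle₁ e h0 h1)).1
      exact max_eq_left (by linarith)
    · intro e h0 h1
      have h2 := hLneg e h0.le h1
      have h3 := hgt₁ e h0 h1
      rw [abs_of_neg (by linarith)] at h3
      exact lt_max_of_lt_right (by linarith)
    · intro e T h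
      obtain ⟨h0, h1, h2, h3⟩ := (hA e T).1 h
      rw [hdisc e T h0 h1, mul_eq_zero]
      constructor
      · rintro (h4 | h4)
        · right
          have h5 : T = -(L e / 2) - S e := by linarith
          refine ⟨by
            change T = max 0 (-(L e / 2) - S e)
            rw [← h5]
            exact (max_eq_right h2).symm, ?_⟩
          by_contra! h6
          rcases h0.eq_or_lt with h7 | h7
          · rw [← h7] at h5
            have h8 : 0 < L 0 / 2 := by rw [hL]; unfold linFn slopeFn; linarith
            linarith [hzero]
          · have := (abs_lt.1 (hlt₁ e h7 h6)).1
            linarith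
        · left; linarith
      · rintro (h4 | ⟨h4, h5⟩)
        · right; linarith
        · left
          have h6 : 0 ≤ -(L e / 2) - S e := by
            rcases h5.eq_or_lt with h7 | h7
            · have := hLneg e h5 h1
              rw [← h7, hat₁, abs_of_neg (by rw [h7]; linarith)]
              linarith
            · have h8 := hgt₁ e h7 h1
              rw [abs_of_neg (by linarith [hLneg e h5 h1])] at h8
              linarith
          change T = max 0 (-(L e / 2) - S e) at h4
          rw [max_eq_right h6] at h4
          linarith
  · -- over `(e₁, E]` there is nothing
    have hLE : e₁ < E → 0 < L E := by
      intro h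
      have h1 : ¬ L E < 0 := fun h' => hcase ⟨h, h'⟩
      have h2 := hgt₁ E h le_rfl
      rw [hSE] at h2
      have h3 : L E ≠ 0 := by
        intro h4
        rw [h4] at h2
        simp at h2
      exact lt_of_le_of_ne (not_lt.1 h1) (Ne.symm h3)
    have hLpos : e₁ < E → ∀ e, e₁ ≤ e → e ≤ E → 0 < L e := by
      intro hlt e h1 h2
      by_contra! h3
      obtain ⟨e', ⟨h4, h5⟩, h6⟩ := intermediate_value_Icc h2 hLcont.continuousOn
        (show (0 : ℝ) ∈ Set.Icc (L e) (L E) from ⟨h3, (hLE hlt).le⟩)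
      rcases (h1.trans h4).eq_or_lt with h7 | h7
      · have := hSpos e₁ he₁0.le hlt
        rw [hat₁, h7, h6] at this
        simp at this
      · have := hgt₁ e' h7 h5
        rw [h6] at this
        have := hS0 e'
        simp at *
        linarith
    have hend : -(L e₁ / 2) + S e₁ = 0 := by
      rcases he₁E.eq_or_lt with h | h
      · have h1 : S e₁ = 0 := by rw [h, hSE]
        rw [h1] at hat₁ ⊢
        have := abs_eq_zero.1 hat₁.symm
        linarith
      · have := hLpos h e₁ le_rfl he₁E
        rw [hat₁, abs_of_pos (by linarith)]
        ring
    have hbd : ∀ e T, Adm μ ν κ δ e T → e ≤ e₁ := by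
      intro e T h
      obtain ⟨h0, h1, h2, h3⟩ := (hA e T).1 h
      by_contra! h4
      have h5 := hLpos (h4.trans_le h1) e h4.le h1
      have h6 := mul_neg_of_pos_of_neg (pow_pos (he₁0.trans h4) 2) (hGneg e h4)
      have h7 := mul_nonneg h5.le h2
      unfold discFn at h3
      linarith [sq_nonneg T]
    refine ⟨e₁, e₁, fun _ => 0, fun e => -(L e / 2) + S e, he₁0, le_rfl,
      continuous_const, by fun_prop, ?_, ?_, ?_, hend.symm, fun _ _ _ => rfl, ?_, ?_⟩
    · intro e T
      constructor
      · intro h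
        obtain ⟨h0, h1, h2, h3⟩ := (hA e T).1 h
        refine ⟨h0, hbd e T h, h2, ?_⟩
        rw [discFn_eq hμν] at h3
        have h4 : |T + L e / 2| ≤ S e := Real.abs_le_sqrt (by linarith)
        linarith [(abs_le.1 h4).2]
      · rintro ⟨h0, h1, h2, h3⟩
        refine (hA e T).2 ⟨h0, h1.trans he₁E, h2, ?_⟩
        rw [hdisc e T h0 (h1.trans he₁E)]
        have := (abs_le.1 (hle₁ e h0 h1)).1
        exact mul_nonneg (by linarith) (by linarith)
    · intro e h0 h1
      have := (abs_lt.1 (hlt₁ e h0 h1)).2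
      linarith
    · simp [hzero]
    · intro e h0 h1
      exact absurd h0 (not_lt.2 h1)
    · intro e T h
      have he := hbd e T h
      obtain ⟨h0, h1, h2, h3⟩ := (hA e T).1 h
      rw [hdisc e T h0 h1, mul_eq_zero]
      constructor
      · rintro (h4 | h4)
        · rcases h0.eq_or_lt with h7 | h7
          · rw [← h7] at h4
            have h8 : 0 < L 0 / 2 := by rw [hL]; unfold linFn slopeFn; linarith
            linarith [hzero]
          rcases he.eq_or_lt with h8 | h8
          · right
            have := (abs_le.1 (hle₁ e h0 he)).1
            exact ⟨by linarith, h8.ge⟩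
          · have := (abs_lt.1 (hlt₁ e h7 h8)).1
            linarith
        · left; linarith
      · rintro (h4 | ⟨h4, h5⟩)
        · right; linarith
        · right
          rw [h4, le_antisymm he h5, hend, sub_zero]

end RegionShape

/-! ### The sphere as a fourfold unfolding of a disc -/

/-- A region between the graphs of two functions that meet exactly over the end points of an
interval is a disc, and the homeomorphism can be taken to respect lower and upper boundaries. -/
theorem exists_disc_param {b : ℝ} (hb : 0 < b) {l u : ℝ → ℝ} (hl : Continuous l)
    (hu : Continuous u) (hlu : ∀ e, 0 < e → e < b → l e < u e) (h0 : l 0 = u 0) (hb' : l b = u b) :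
    ∃ Z : ℝ × ℝ → ℂ,
      ContinuousOn Z {p | 0 ≤ p.1 ∧ p.1 ≤ b ∧ l p.1 ≤ p.2 ∧ p.2 ≤ u p.1} ∧
      Set.BijOn Z {p | 0 ≤ p.1 ∧ p.1 ≤ b ∧ l p.1 ≤ p.2 ∧ p.2 ≤ u p.1}
        (Metric.closedBall 0 1) ∧
      ∀ p : ℝ × ℝ, 0 ≤ p.1 → p.1 ≤ b → l p.1 ≤ p.2 → p.2 ≤ u p.1 →
        (Z p).re = 2 * p.1 / b - 1 ∧ ((‖Z p‖ = 1 ∧ (Z p).im ≤ 0) ↔ p.2 = l p.1) ∧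
          ((‖Z p‖ = 1 ∧ 0 ≤ (Z p).im) ↔ p.2 = u p.1) := by
  set R : Set (ℝ × ℝ) := {p | 0 ≤ p.1 ∧ p.1 ≤ b ∧ l p.1 ≤ p.2 ∧ p.2 ≤ u p.1} with hR
  set X : ℝ → ℝ := fun e => 2 * e / b - 1 with hX
  set ρ : ℝ → ℝ := fun e => √(1 - X e ^ 2) with hρ
  set t : ℝ × ℝ → ℝ := fun p => (2 * p.2 - l p.1 - u p.1) / (u p.1 - l p.1) with ht
  have hXe : ∀ e, 1 - X e ^ 2 = 4 * e * (b - e) / b ^ 2 := by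
    intro e; rw [hX]; field_simp; ring
  have hX1 : ∀ e, 0 ≤ e → e ≤ b → 0 ≤ 1 - X e ^ 2 := by
    intro e h h'
    rw [hXe]
    exact div_nonneg (mul_nonneg (by linarith) (by linarith)) (by positivity)
  have hρ0 : ∀ e, 0 ≤ ρ e := fun e => Real.sqrt_nonneg _
  have hρsq : ∀ e, 0 ≤ e → e ≤ b → ρ e ^ 2 = 1 - X e ^ 2 := fun e h h' =>
    Real.sq_sqrt (hX1 e h h')
  have hρpos : ∀ e, 0 < e → e < b → 0 < ρ e := by
    intro e h h'
    refine Real.sqrt_pos.2 ?_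
    rw [hXe]
    exact div_pos (mul_pos (by linarith) (by linarith)) (by positivity)
  have hρend : ∀ e, (e = 0 ∨ e = b) → ρ e = 0 := by
    rintro e (rfl | rfl) <;> simp [hρ, hXe]
  have hend : ∀ e, 0 ≤ e → e ≤ b → ¬ (0 < e ∧ e < b) → (e = 0 ∨ e = b) := by
    intro e h h' h''
    by_contra! h3
    exact h'' ⟨lt_of_le_of_ne h (Ne.symm h3.1), lt_of_le_of_ne h' h3.2⟩
  have hlend : ∀ e, (e = 0 ∨ e = b) → l e = u e := by
    rintro e (rfl | rfl) <;> assumption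
  have htb : ∀ p ∈ R, |t p| ≤ 1 := by
    rintro p ⟨h1, h2, h3, h4⟩
    rw [ht, abs_div]
    refine div_le_one_of_le₀ ?_ (abs_nonneg _)
    rw [abs_of_nonneg (by linarith : 0 ≤ u p.1 - l p.1), abs_le]
    constructor <;> linarith
  have hρcont : Continuous ρ := by rw [hρ, hX]; fun_prop
  have hnorm : ∀ x y : ℝ, ‖(⟨x, y⟩ : ℂ)‖ = 1 ↔ x ^ 2 + y ^ 2 = 1 := by
    intro x y
    rw [← sq_eq_sq₀ (norm_nonneg _) zero_le_one, ← Complex.normSq_eq_norm_sq, Complex.normSq_mk,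
      one_pow, sq, sq]
  have hnorm' : ∀ z : ℂ, ‖z‖ ≤ 1 ↔ z.re ^ 2 + z.im ^ 2 ≤ 1 := by
    intro z
    rw [← sq_le_sq₀ (norm_nonneg _) zero_le_one, ← Complex.normSq_eq_norm_sq,
      Complex.normSq_apply, one_pow, sq, sq]
  -- map each vertical segment of the region affinely onto the vertical chord of the disc
  refine ⟨fun p => ⟨X p.1, ρ p.1 * t p⟩, ?_, ⟨?_, ?_, ?_⟩, ?_⟩
  · have him : ContinuousOn (fun p : ℝ × ℝ => ρ p.1 * t p) R := by
      intro p hp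
      by_cases hpin : 0 < p.1 ∧ p.1 < b
      · have hne : u p.1 - l p.1 ≠ 0 := (sub_pos.2 (hlu _ hpin.1 hpin.2)).ne'
        refine ContinuousAt.continuousWithinAt ?_
        rw [ht]
        exact (hρcont.comp continuous_fst).continuousAt.mul
          (ContinuousAt.div (by fun_prop) (by fun_prop) hne)
      · have hz := hρend _ (hend _ hp.1 hp.2.1 hpin)
        -- over the end points the quotient `t` is a junk value, but it is bounded and `ρ` tends to
        -- zero
        have h1 : Filter.Tendsto (fun p : ℝ × ℝ => ρ p.1) (nhdsWithin p R) (nhds 0) := by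
          have := (hρcont.comp continuous_fst).continuousWithinAt (s := R) (x := p)
          rw [ContinuousWithinAt, Function.comp_apply, hz] at this
          exact this
        rw [ContinuousWithinAt, hz, zero_mul]
        refine squeeze_zero_norm' ?_ h1
        filter_upwards [self_mem_nhdsWithin] with p' hp'
        rw [norm_mul, Real.norm_of_nonneg (hρ0 _), Real.norm_eq_abs]
        exact mul_le_of_le_one_right (hρ0 _) (htb p' hp')
    have hre : ContinuousOn (fun p : ℝ × ℝ => X p.1) R := by
      rw [hX]; fun_prop
    have : (fun p : ℝ × ℝ => (⟨X p.1, ρ p.1 * t p⟩ : ℂ))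
        = fun p => (X p.1 : ℂ) + (ρ p.1 * t p : ℝ) * Complex.I := by
      funext p
      exact Complex.mk_eq_add_mul_I _ _
    rw [this]
    exact (Complex.continuous_ofReal.comp_continuousOn hre).add
      ((Complex.continuous_ofReal.comp_continuousOn him).mul continuousOn_const)
  · rintro p hp
    rw [mem_closedBall_zero_iff, hnorm']
    have h1 := hρsq p.1 hp.1 hp.2.1
    have h2 : t p ^ 2 ≤ 1 := (sq_le_one_iff_abs_le_one _).2 (htb p hp)
    have h3 := mul_le_mul_of_nonneg_left h2 (sq_nonneg (ρ p.1))
    simp only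
    rw [mul_pow]
    linarith
  · rintro p hp p' hp' h
    simp only [Complex.mk.injEq] at h
    obtain ⟨h1, h2⟩ := h
    have he : p.1 = p'.1 := by
      simp only [hX] at h1
      field_simp at h1
      linarith
    refine Prod.ext he ?_
    by_cases hpin : 0 < p.1 ∧ p.1 < b
    · rw [← he] at h2
      have h3 := mul_left_cancel₀ (hρpos _ hpin.1 hpin.2).ne' h2
      have hne : u p.1 - l p.1 ≠ 0 := (sub_pos.2 (hlu _ hpin.1 hpin.2)).ne'
      simp only [ht] at h3
      rw [← he, div_left_inj' hne] at h3
      linarith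
    · have h3 := hlend _ (hend _ hp.1 hp.2.1 hpin)
      have h4 := hp.2.2
      have h5 := hp'.2.2
      rw [← he] at h5
      linarith [h4.1, h4.2, h5.1, h5.2]
  · intro z hz
    rw [mem_closedBall_zero_iff, hnorm'] at hz
    set e := b * (z.re + 1) / 2 with he
    have hXz : X e = z.re := by rw [hX, he]; field_simp; ring
    have hre := abs_le.1 ((sq_le_one_iff_abs_le_one z.re).1 (by nlinarith [sq_nonneg z.im]))
    have he0 : 0 ≤ e := by
      rw [he]
      exact div_nonneg (mul_nonneg hb.le (by linarith [hre.1])) (by norm_num)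
    have heb : e ≤ b := by
      rw [he]
      nlinarith [hre.2]
    by_cases hin : 0 < e ∧ e < b
    · have hρe := hρpos e hin.1 hin.2
      have hsq := hρsq e he0 heb
      have hlt := hlu e hin.1 hin.2
      set τ := z.im / ρ e with hτ
      have hτ1 : |τ| ≤ 1 := by
        rw [← sq_le_one_iff_abs_le_one, hτ, div_pow, div_le_one (by positivity), hsq, hXz]
        linarith
      obtain ⟨h1, h2⟩ := abs_le.1 hτ1
      refine ⟨(e, (l e + u e + τ * (u e - l e)) / 2), ⟨he0, heb, ?_, ?_⟩, ?_⟩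
      · simp only
        nlinarith
      · simp only
        nlinarith
      · have : t (e, (l e + u e + τ * (u e - l e)) / 2) = τ := by
          have hne : u e - l e ≠ 0 := (sub_pos.2 hlt).ne'
          simp only [ht]
          field_simp
          ring
        apply Complex.ext
        · exact hXz
        · simp only [this]
          rw [hτ]
          field_simp
    · have h1 := hend e he0 heb hin
      have h2 := hlend e h1
      refine ⟨(e, l e), ⟨he0, heb, le_rfl, h2.le⟩, ?_⟩
      apply Complex.ext
      · exact hXz
      · have h3 := hρsq e he0 heb
        rw [hρend e h1, hXz] at h3
        have h4 : z.im ^ 2 ≤ 0 := by linarith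
        simp only [hρend e h1, zero_mul]
        exact (pow_eq_zero_iff two_ne_zero |>.1 (le_antisymm h4 (sq_nonneg _))).symm
  · intro p h1 h2 h3 h4
    refine ⟨rfl, ?_⟩
    simp only [hnorm]
    by_cases hin : 0 < p.1 ∧ p.1 < b
    · have hρp := hρpos _ hin.1 hin.2
      have hlt := hlu _ hin.1 hin.2
      have hne : 0 < u p.1 - l p.1 := sub_pos.2 hlt
      have hiff : X p.1 ^ 2 + (ρ p.1 * t p) ^ 2 = 1 ↔ t p ^ 2 = 1 := by
        rw [mul_pow, hρsq _ h1 h2]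
        have h5 := (hρsq _ h1 h2) ▸ pow_pos hρp 2
        constructor
        · intro h
          have : (1 - X p.1 ^ 2) * (t p ^ 2 - 1) = 0 := by linarith
          rcases mul_eq_zero.1 this with h | h <;> linarith
        · intro h; rw [h]; ring
      have hlow : t p = -1 ↔ p.2 = l p.1 := by
        simp only [ht]
        rw [div_eq_iff hne.ne']
        constructor <;> intro h <;> linarith
      have hupp : t p = 1 ↔ p.2 = u p.1 := by
        simp only [ht]
        rw [div_eq_iff hne.ne']
        constructor <;> intro h <;> linarith
      rw [hiff, ← hlow, ← hupp, show t p ^ 2 = 1 ↔ t p = 1 ∨ t p = -1 by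
        rw [← sq_eq_sq_iff_eq_or_eq_neg, one_pow]]
      constructor
      · constructor
        · rintro ⟨h | h, h'⟩
          · rw [h, mul_one] at h'; linarith
          · exact h
        · intro h
          rw [h]
          exact ⟨Or.inr rfl, by linarith⟩
      · constructor
        · rintro ⟨h | h, h'⟩
          · exact h
          · rw [h] at h'; linarith
        · intro h
          rw [h]
          exact ⟨Or.inl rfl, by linarith⟩
    · have h5 := hend _ h1 h2 hin
      have h6 := hlend _ h5
      have h7 := hρsq _ h1 h2
      rw [hρend _ h5] at h7 ⊢
      simp only [zero_mul, le_refl, and_true]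
      have h8 : X p.1 ^ 2 + 0 ^ 2 = 1 := by linarith
      simp only [h8, true_iff]
      constructor <;> linarith

/-- The automorphism `z ↦ ((1 + iβ) z + iβ) / (-iβ z + 1 - iβ)` of the closed unit disc, a
parabolic Möbius transformation with fixed point `-1`. -/
def parab (β : ℝ) (z : ℂ) : ℂ :=
  ((1 + Complex.I * β) * z + Complex.I * β) / (-(Complex.I * β) * z + (1 - Complex.I * β))

section Parab

variable {β : ℝ} {z : ℂ}

theorem normSq_parab_num_sub (β : ℝ) (z : ℂ) :
    Complex.normSq ((1 + Complex.I * β) * z + Complex.I * β)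
      - Complex.normSq (-(Complex.I * β) * z + (1 - Complex.I * β)) = Complex.normSq z - 1 := by
  simp only [Complex.normSq_apply, Complex.add_re, Complex.mul_re, Complex.add_im, Complex.mul_im,
    Complex.neg_re, Complex.neg_im, Complex.sub_re, Complex.sub_im, Complex.I_re, Complex.I_im,
    Complex.one_re, Complex.one_im, Complex.ofReal_re, Complex.ofReal_im]
  ring

theorem norm_le_one_iff_normSq : ‖z‖ ≤ 1 ↔ Complex.normSq z ≤ 1 := by
  rw [Complex.normSq_eq_norm_sq, sq_le_one_iff₀ (norm_nonneg _)]

theorem norm_eq_one_iff_normSq : ‖z‖ = 1 ↔ Complex.normSq z = 1 := by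
  rw [Complex.normSq_eq_norm_sq, pow_eq_one_iff_of_nonneg (norm_nonneg z) two_ne_zero]

theorem parab_den_ne_zero (hz : ‖z‖ ≤ 1) :
    -(Complex.I * β) * z + (1 - Complex.I * β) ≠ 0 := by
  intro h
  have h1 := normSq_parab_num_sub β z
  have hz' := norm_le_one_iff_normSq.1 hz
  rw [h, map_zero, sub_zero] at h1
  have h2 : Complex.normSq ((1 + Complex.I * β) * z + Complex.I * β) = 0 :=
    le_antisymm (by linarith) (Complex.normSq_nonneg _)
  have h3 := Complex.normSq_eq_zero.1 h2
  have h4 : z = -1 := by linear_combination h + h3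
  rw [h4] at h
  have : (1 : ℂ) = 0 := by linear_combination h
  exact one_ne_zero this

theorem normSq_parab (hz : ‖z‖ ≤ 1) :
    Complex.normSq (parab β z) - 1
      = (Complex.normSq z - 1) / Complex.normSq (-(Complex.I * β) * z + (1 - Complex.I * β)) := by
  have h := Complex.normSq_pos.2 (parab_den_ne_zero (β := β) hz)
  rw [← normSq_parab_num_sub β z, parab, map_div₀, sub_div, div_self h.ne']

theorem norm_parab_le (hz : ‖z‖ ≤ 1) : ‖parab β z‖ ≤ 1 := by
  have h := Complex.normSq_pos.2 (parab_den_ne_zero (β := β) hz)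
  rw [norm_le_one_iff_normSq] at hz ⊢
  have := normSq_parab (β := β) (norm_le_one_iff_normSq.2 hz)
  have h2 := div_nonpos_of_nonpos_of_nonneg (by linarith : Complex.normSq z - 1 ≤ 0) h.le
  linarith

theorem norm_parab_eq_one_iff (hz : ‖z‖ ≤ 1) : ‖parab β z‖ = 1 ↔ ‖z‖ = 1 := by
  have h := Complex.normSq_pos.2 (parab_den_ne_zero (β := β) hz)
  rw [norm_eq_one_iff_normSq, norm_eq_one_iff_normSq, ← sub_eq_zero, normSq_parab hz,
    div_eq_zero_iff, sub_eq_zero, or_iff_left h.ne']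

theorem parab_parab (hz : ‖z‖ ≤ 1) : parab (-β) (parab β z) = z := by
  have h := parab_den_ne_zero (β := β) hz
  rw [parab, parab]
  push_cast
  generalize hd : -(Complex.I * (β : ℂ)) * z + (1 - Complex.I * β) = d at h ⊢
  have h1 : -(Complex.I * -(β : ℂ)) * (((1 + Complex.I * β) * z + Complex.I * β) / d)
      + (1 - Complex.I * -(β : ℂ)) = 1 / d := by
    rw [eq_div_iff h, add_mul, mul_assoc, div_mul_cancel₀ _ h, ← hd]
    ring
  have h2 : (1 + Complex.I * -(β : ℂ)) * (((1 + Complex.I * β) * z + Complex.I * β) / d)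
      + Complex.I * -(β : ℂ) = z / d := by
    rw [eq_div_iff h, add_mul, mul_assoc, div_mul_cancel₀ _ h, ← hd]
    ring
  rw [h1, h2]
  field_simp

theorem bijOn_parab (β : ℝ) :
    Set.BijOn (parab β) (Metric.closedBall 0 1) (Metric.closedBall 0 1) := by
  refine ⟨fun z hz => ?_, fun z hz w hw h => ?_, fun z hz => ?_⟩
  · rw [mem_closedBall_zero_iff] at hz ⊢
    exact norm_parab_le hz
  · rw [mem_closedBall_zero_iff] at hz hw
    rw [← parab_parab (β := β) hz, h, parab_parab hw]
  · rw [mem_closedBall_zero_iff] at hz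
    refine ⟨parab (-β) z, ?_, ?_⟩
    · rw [mem_closedBall_zero_iff]
      exact norm_parab_le hz
    · simpa using parab_parab (β := -β) hz

theorem continuousOn_parab (β : ℝ) : ContinuousOn (parab β) (Metric.closedBall 0 1) := by
  unfold parab
  refine ContinuousOn.div (by fun_prop) (by fun_prop) fun z hz => ?_
  exact parab_den_ne_zero (mem_closedBall_zero_iff.1 hz)

/-- On the unit circle the sign of the imaginary part is that of an affine function vanishing at
`-1` and at the preimage of `1`. -/
theorem parab_im (hz : ‖z‖ = 1) :
    (parab β z).im = (z.im + 2 * β * (1 + z.re))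
      / Complex.normSq (-(Complex.I * β) * z + (1 - Complex.I * β)) := by
  have h1 : z.re * z.re + z.im * z.im = 1 := by
    rw [← Complex.normSq_apply]; exact norm_eq_one_iff_normSq.1 hz
  rw [parab, Complex.div_im, ← sub_div]
  congr 1
  simp only [Complex.add_re, Complex.mul_re, Complex.add_im, Complex.mul_im,
    Complex.neg_re, Complex.neg_im, Complex.sub_re, Complex.sub_im, Complex.I_re, Complex.I_im,
    Complex.one_re, Complex.one_im, Complex.ofReal_re, Complex.ofReal_im]
  linear_combination β * h1

end Parab

/-- The parametrization of the region by the disc, rotated so that the part of the boundary on the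
axis is the lower semicircle and the remaining part is the upper semicircle. -/
theorem exists_disc_param_edges {b e₁ : ℝ} (he₁ : 0 < e₁) (hb : e₁ ≤ b) {l u : ℝ → ℝ}
    (hl : Continuous l) (hu : Continuous u) (hlu : ∀ e, 0 < e → e < b → l e < u e)
    (h0 : l 0 = u 0) (hb' : l b = u b) :
    ∃ Z : ℝ × ℝ → ℂ,
      ContinuousOn Z {p | 0 ≤ p.1 ∧ p.1 ≤ b ∧ l p.1 ≤ p.2 ∧ p.2 ≤ u p.1} ∧
      Set.BijOn Z {p | 0 ≤ p.1 ∧ p.1 ≤ b ∧ l p.1 ≤ p.2 ∧ p.2 ≤ u p.1}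
        (Metric.closedBall 0 1) ∧
      ∀ p : ℝ × ℝ, 0 ≤ p.1 → p.1 ≤ b → l p.1 ≤ p.2 → p.2 ≤ u p.1 →
        ((‖Z p‖ = 1 ∧ (Z p).im ≤ 0) ↔ (p.2 = l p.1 ∧ p.1 ≤ e₁)) ∧
        ((‖Z p‖ = 1 ∧ 0 ≤ (Z p).im) ↔ (p.2 = u p.1 ∨ (p.2 = l p.1 ∧ e₁ ≤ p.1))) := by
  have hbpos : 0 < b := he₁.trans_le hb
  obtain ⟨Z, hZc, hZb, hZ⟩ := exists_disc_param hbpos hl hu hlu h0 hb'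
  set x₁ : ℝ := 2 * e₁ / b - 1 with hx₁
  have hx₁' : 0 < 1 + x₁ := by
    rw [hx₁]
    have : 0 < 2 * e₁ / b := by positivity
    linarith
  have hx₁1 : x₁ ≤ 1 := by
    have : 2 * e₁ / b ≤ 2 := by rw [div_le_iff₀ hbpos]; linarith
    linarith
  have hx₁n : 0 ≤ (1 - x₁) / (1 + x₁) := div_nonneg (by linarith) hx₁'.le
  -- this `β` makes the Möbius transformation send to `1` the point of the lower semicircle with
  -- real part `x₁`
  set β : ℝ := √((1 - x₁) / (1 + x₁)) / 2 with hβ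
  have hβ0 : 0 ≤ β := by positivity
  have hβ2 : (2 * β) ^ 2 * (1 + x₁) = 1 - x₁ := by
    rw [hβ, mul_div_cancel₀ _ two_ne_zero, Real.sq_sqrt hx₁n]
    field_simp
  have key : ∀ z : ℂ, ‖z‖ = 1 →
      ((z.im + 2 * β * (1 + z.re) ≤ 0 ↔ z.im ≤ 0 ∧ z.re ≤ x₁) ∧
        (0 ≤ z.im + 2 * β * (1 + z.re) ↔ 0 ≤ z.im ∨ (z.im ≤ 0 ∧ x₁ ≤ z.re))) := by
    intro z hz
    have h1 : z.re * z.re + z.im * z.im = 1 := by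
      rw [← Complex.normSq_apply]; exact norm_eq_one_iff_normSq.1 hz
    have hre : -1 ≤ z.re ∧ z.re ≤ 1 :=
      abs_le.1 ((sq_le_one_iff_abs_le_one z.re).1 (by nlinarith [sq_nonneg z.im]))
    have hw : 0 ≤ 2 * β * (1 + z.re) := mul_nonneg (by linarith) (by linarith [hre.1])
    -- compare squares
    have hsq : (1 + x₁) * (z.im ^ 2 - (2 * β * (1 + z.re)) ^ 2)
        = 2 * (1 + z.re) * (x₁ - z.re) := by
      have h2 : z.im ^ 2 = 1 - z.re ^ 2 := by linarith
      rw [h2]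
      linear_combination (-(1 + z.re) ^ 2) * hβ2
    rcases hre.1.eq_or_lt with h2 | h2
    · have h3 : z.im = 0 := by
        rw [← h2] at h1
        have : z.im * z.im = 0 := by linarith
        simpa using this
      rw [h3, ← h2]
      constructor <;> constructor <;> intro h <;> simp
      linarith
    · have h3 : 0 < 1 + z.re := by linarith
      constructor
      · constructor
        · intro h
          refine ⟨by linarith, ?_⟩
          have h4 : (2 * β * (1 + z.re)) ^ 2 ≤ z.im ^ 2 := by nlinarith
          have h5 : 0 ≤ 2 * (1 + z.re) * (x₁ - z.re) := by
            rw [← hsq]; exact mul_nonneg hx₁'.le (by linarith)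
          have := nonneg_of_mul_nonneg_right h5 (by linarith)
          linarith
        · rintro ⟨h, h'⟩
          have h5 : 0 ≤ 2 * (1 + z.re) * (x₁ - z.re) := mul_nonneg (by linarith) (by linarith)
          rw [← hsq] at h5
          have h6 := nonneg_of_mul_nonneg_right h5 hx₁'
          have h7 := abs_le_of_sq_le_sq (by linarith : (2 * β * (1 + z.re)) ^ 2 ≤ (-z.im) ^ 2)
            (by linarith)
          linarith [le_abs_self (2 * β * (1 + z.re))]
      · constructor
        · intro h
          by_contra! h4
          have h5 := h4.2 h4.1.le
          have h6 : 0 < 2 * (1 + z.re) * (x₁ - z.re) := mul_pos (by linarith) (by linarith)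
          rw [← hsq] at h6
          have h7 := (pos_iff_pos_of_mul_pos h6).1 hx₁'
          have h8 := abs_lt_of_sq_lt_sq (by linarith : (2 * β * (1 + z.re)) ^ 2 < (-z.im) ^ 2)
            (by linarith)
          linarith [le_abs_self (2 * β * (1 + z.re))]
        · rintro (h | ⟨h, h'⟩)
          · linarith
          · have h5 : 2 * (1 + z.re) * (x₁ - z.re) ≤ 0 :=
              mul_nonpos_of_nonneg_of_nonpos (by linarith) (by linarith)
            rw [← hsq] at h5
            have h6 : z.im ^ 2 - (2 * β * (1 + z.re)) ^ 2 ≤ 0 := by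
              by_contra! h7
              have := mul_pos hx₁' h7
              linarith
            have h8 := abs_le_of_sq_le_sq (by linarith : (-z.im) ^ 2 ≤ (2 * β * (1 + z.re)) ^ 2) hw
            linarith [le_abs_self (-z.im)]
  refine ⟨fun p => parab β (Z p), (continuousOn_parab β).comp hZc hZb.mapsTo,
    (bijOn_parab β).comp hZb, fun p hp1 hp2 hp3 hp4 => ?_⟩
  obtain ⟨hre, hlow, hupp⟩ := hZ p hp1 hp2 hp3 hp4
  have hnorm : ‖Z p‖ ≤ 1 := mem_closedBall_zero_iff.1 (hZb.mapsTo ⟨hp1, hp2, hp3, hp4⟩)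
  have hden := Complex.normSq_pos.2 (parab_den_ne_zero (β := β) hnorm)
  have hle : (Z p).re ≤ x₁ ↔ p.1 ≤ e₁ := by
    rw [hre, hx₁, sub_le_sub_iff_right, div_le_div_iff_of_pos_right hbpos]
    constructor <;> intro h <;> linarith
  have hge : x₁ ≤ (Z p).re ↔ e₁ ≤ p.1 := by
    rw [hre, hx₁, sub_le_sub_iff_right, div_le_div_iff_of_pos_right hbpos]
    constructor <;> intro h <;> linarith
  rw [norm_parab_eq_one_iff hnorm]
  rw [← hlow, ← hupp, ← hle, ← hge]
  constructor
  · constructor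
    · rintro ⟨h1, h2⟩
      rw [parab_im h1, div_le_iff₀ hden, zero_mul, (key _ h1).1] at h2
      exact ⟨⟨h1, h2.1⟩, h2.2⟩
    · rintro ⟨⟨h1, h2⟩, h3⟩
      rw [parab_im h1, div_le_iff₀ hden, zero_mul, (key _ h1).1]
      exact ⟨h1, h2, h3⟩
  · constructor
    · rintro ⟨h1, h2⟩
      rw [parab_im h1, le_div_iff₀ hden, zero_mul, (key _ h1).2] at h2
      tauto
    · intro h
      have h1 : ‖Z p‖ = 1 := by tauto
      rw [parab_im h1, le_div_iff₀ hden, zero_mul, (key _ h1).2]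
      tauto

/-- Gluing along `f = 0` is continuous if the other factor vanishes there. -/
theorem continuous_sign_mul {X : Type*} [TopologicalSpace X] {f g : X → ℝ} (hf : Continuous f)
    (hg : Continuous g) (h : ∀ x, f x = 0 → g x = 0) :
    Continuous fun x => (SignType.sign (f x) : ℝ) * g x := by
  rw [continuous_iff_continuousAt]
  intro x
  by_cases hx : f x = 0
  · have hgx := h x hx
    rw [ContinuousAt, hgx, mul_zero]
    have h1 : Filter.Tendsto (fun x => |g x|) (nhds x) (nhds 0) := by
      have := hg.abs.continuousAt (x := x)
      rwa [ContinuousAt, hgx, abs_zero] at this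
    refine squeeze_zero_norm (fun y => ?_) h1
    rw [norm_mul, Real.norm_eq_abs, Real.norm_eq_abs]
    refine mul_le_of_le_one_left (abs_nonneg _) ?_
    rcases lt_trichotomy (f y) 0 with h | h | h <;> simp [h]
  · have h1 : ContinuousAt (fun x => (SignType.sign (f x) : ℝ)) x := by
      have h2 : ContinuousAt (fun t : ℝ => (SignType.sign t : ℝ)) (f x) :=
        (continuous_of_discreteTopology (f := fun s : SignType => (s : ℝ))).continuousAt.comp
          (continuousAt_sign_of_ne_zero hx)
      exact h2.comp hf.continuousAt
    exact h1.mul hg.continuousAt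

theorem sign_mul_sqrt_sq {t g : ℝ} (h : t = 0 → g = 0) :
    ((SignType.sign t : ℝ) * g) ^ 2 = g ^ 2 := by
  rcases lt_trichotomy t 0 with h1 | h1 | h1
  · simp [h1]
  · simp [h h1]
  · simp [h1]

/-- Two numbers with equal squares agree if a number vanishing exactly with them gets the same sign
from both. -/
theorem eq_of_sq_eq_of_sign_mul_eq {t t' g : ℝ} (hsq : t ^ 2 = t' ^ 2)
    (hg : g = 0 → t = 0)
    (h : (SignType.sign t : ℝ) * g = (SignType.sign t' : ℝ) * g) : t = t' := by
  by_cases hg0 : g = 0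
  · have h1 := hg hg0
    rw [h1] at hsq ⊢
    have : t' ^ 2 = 0 := by rw [← hsq]; ring
    exact (pow_eq_zero_iff two_ne_zero |>.1 this).symm
  · have h1 := mul_right_cancel₀ hg0 h
    rcases sq_eq_sq_iff_eq_or_eq_neg.1 hsq with h2 | h2
    · exact h2
    · rcases lt_trichotomy t' 0 with h3 | h3 | h3
      · have : 0 < t := by linarith
        simp [this, h3] at h1
        norm_num at h1
      · rw [h2, h3, neg_zero]
      · have : t < 0 := by linarith
        simp [this, h3] at h1
        norm_num at h1

/-- If a plane region is a disc whose boundary consists of the two arcs `T = 0` and `F = 0`, then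
the surface `s² = F(e, t²)`, four copies of the region glued along these arcs, is a sphere. -/
theorem exists_sphere_param {R : Set (ℝ × ℝ)} {Z : ℝ × ℝ → ℂ} {F : ℝ → ℝ → ℝ}
    (hZc : ContinuousOn Z R) (hZb : Set.BijOn Z R (Metric.closedBall 0 1))
    (hT : ∀ p ∈ R, 0 ≤ p.2) (hF : ∀ p ∈ R, 0 ≤ F p.1 p.2)
    (hT0 : ∀ p ∈ R, ((‖Z p‖ = 1 ∧ (Z p).im ≤ 0) ↔ p.2 = 0))
    (hF0 : ∀ p ∈ R, ((‖Z p‖ = 1 ∧ 0 ≤ (Z p).im) ↔ F p.1 p.2 = 0)) :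
    ∃ Ψ : {w : ℝ × ℝ × ℝ | (w.1, w.2.1 ^ 2) ∈ R ∧ w.2.2 ^ 2 = F w.1 (w.2.1 ^ 2)} →
      Metric.sphere (0 : EuclideanSpace ℝ (Fin 3)) 1, Continuous Ψ ∧ Function.Bijective Ψ := by
  set M := {w : ℝ × ℝ × ℝ | (w.1, w.2.1 ^ 2) ∈ R ∧ w.2.2 ^ 2 = F w.1 (w.2.1 ^ 2)} with hM
  set r : ℂ → ℝ := fun z => √(1 - z.re ^ 2) with hr
  -- `U` vanishes on the lower and `V` on the upper semicircle, and `(Re z)² + U² + V² = 1`, so that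
  -- `(Re z, ±U, ±V)` unfolds the disc to the sphere, with the signs of `t` and `s`
  set U : ℂ → ℝ := fun z => √((r z ^ 2 + r z * z.im) / 2) with hU
  set V : ℂ → ℝ := fun z => √((r z ^ 2 - r z * z.im) / 2) with hV
  set ζ : M → ℂ := fun w => Z (w.1.1, w.1.2.1 ^ 2) with hζ
  have hζ1 : ∀ w : M, ‖ζ w‖ ≤ 1 := fun w => mem_closedBall_zero_iff.1 (hZb.mapsTo w.2.1)
  have hζc : Continuous ζ := by
    refine hZc.comp_continuous (f := fun w : M => (w.1.1, w.1.2.1 ^ 2)) (by fun_prop) ?_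
    exact fun w => w.2.1
  have hr2 : ∀ z : ℂ, ‖z‖ ≤ 1 → r z ^ 2 = 1 - z.re ^ 2 := by
    intro z hz
    refine Real.sq_sqrt ?_
    have := norm_le_one_iff_normSq.1 hz
    rw [Complex.normSq_apply] at this
    nlinarith [mul_self_nonneg z.im]
  have hr0 : ∀ z, 0 ≤ r z := fun z => Real.sqrt_nonneg _
  have him : ∀ z : ℂ, ‖z‖ ≤ 1 → |z.im| ≤ r z := by
    intro z hz
    refine abs_le_of_sq_le_sq ?_ (hr0 z)
    rw [hr2 z hz]
    have := norm_le_one_iff_normSq.1 hz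
    rw [Complex.normSq_apply] at this
    linarith
  have hU2 : ∀ z : ℂ, ‖z‖ ≤ 1 → U z ^ 2 = (r z ^ 2 + r z * z.im) / 2 := by
    intro z hz
    refine Real.sq_sqrt ?_
    have := (abs_le.1 (him z hz)).1
    have := mul_nonneg (hr0 z) (by linarith : 0 ≤ r z + z.im)
    linarith
  have hV2 : ∀ z : ℂ, ‖z‖ ≤ 1 → V z ^ 2 = (r z ^ 2 - r z * z.im) / 2 := by
    intro z hz
    refine Real.sq_sqrt ?_
    have := (abs_le.1 (him z hz)).2
    have := mul_nonneg (hr0 z) (by linarith : 0 ≤ r z - z.im)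
    linarith
  have hU0 : ∀ z : ℂ, ‖z‖ ≤ 1 → (U z = 0 ↔ (‖z‖ = 1 ∧ z.im ≤ 0)) := by
    intro z hz
    rw [← pow_eq_zero_iff two_ne_zero, hU2 z hz, norm_eq_one_iff_normSq, Complex.normSq_apply]
    have h1 := hr2 z hz
    have h2 := abs_le.1 (him z hz)
    constructor
    · intro h
      have h3 : r z * (r z + z.im) = 0 := by linarith
      rcases mul_eq_zero.1 h3 with h4 | h4
      · rw [h4] at h2 h1
        have h5 : z.im = 0 := by linarith [h2.1, h2.2]
        rw [h5]
        constructor <;> linarith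
      · have h5 : r z = -z.im := by linarith
        rw [h5] at h1
        constructor
        · linarith
        · linarith [hr0 z]
    · rintro ⟨h3, h4⟩
      have h5 : r z ^ 2 = z.im ^ 2 := by linarith
      have h6 : r z = -z.im := by
        have h7 : r z ^ 2 = (-z.im) ^ 2 := by linarith
        exact (pow_left_inj₀ (hr0 z) (by linarith) two_ne_zero).1 h7
      rw [h6]; ring
  have hV0 : ∀ z : ℂ, ‖z‖ ≤ 1 → (V z = 0 ↔ (‖z‖ = 1 ∧ 0 ≤ z.im)) := by
    intro z hz
    have h := hU0 (starRingEnd ℂ z) (by rwa [Complex.norm_conj])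
    simpa [hU, hV, hr, sub_eq_add_neg] using h
  have hUt : ∀ w : M, U (ζ w) = 0 ↔ w.1.2.1 = 0 := by
    intro w
    rw [hU0 _ (hζ1 w)]
    exact (hT0 _ w.2.1).trans (pow_eq_zero_iff two_ne_zero)
  have hVs : ∀ w : M, V (ζ w) = 0 ↔ w.1.2.2 = 0 := by
    intro w
    rw [hV0 _ (hζ1 w)]
    refine (hF0 _ w.2.1).trans ?_
    rw [← pow_eq_zero_iff (n := 2) (a := w.1.2.2) two_ne_zero, w.2.2]
  set ψ : M → EuclideanSpace ℝ (Fin 3) := fun w =>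
    !₂[(ζ w).re, (SignType.sign w.1.2.1 : ℝ) * U (ζ w),
      (SignType.sign w.1.2.2 : ℝ) * V (ζ w)] with hψ
  have hnorm : ∀ w, ψ w ∈ Metric.sphere (0 : EuclideanSpace ℝ (Fin 3)) 1 := by
    intro w
    rw [mem_sphere_zero_iff_norm, EuclideanSpace.norm_eq, Real.sqrt_eq_one, Fin.sum_univ_three]
    simp only [hψ, Real.norm_eq_abs, sq_abs, Matrix.cons_val_zero, Matrix.cons_val_one,
      Matrix.cons_val]
    rw [sign_mul_sqrt_sq (hUt w).2, sign_mul_sqrt_sq (hVs w).2, hU2 _ (hζ1 w), hV2 _ (hζ1 w)]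
    linarith [hr2 _ (hζ1 w)]
  refine ⟨fun w => ⟨ψ w, hnorm w⟩, ?_, ?_, ?_⟩
  · refine Continuous.subtype_mk ?_ _
    refine (PiLp.continuous_toLp 2 _).comp ?_
    refine continuous_pi fun i => ?_
    have hrc : Continuous r := by rw [hr]; fun_prop
    have hUc : Continuous U := by rw [hU]; fun_prop
    have hVc : Continuous V := by rw [hV]; fun_prop
    fin_cases i
    · exact Complex.continuous_re.comp hζc
    · exact continuous_sign_mul (by fun_prop) (hUc.comp hζc) fun w => (hUt w).2
    · exact continuous_sign_mul (by fun_prop) (hVc.comp hζc) fun w => (hVs w).2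
  · intro w w' h
    have h' : ψ w = ψ w' := congrArg Subtype.val h
    have h0 : (ζ w).re = (ζ w').re := by simpa [hψ] using congrFun (congrArg WithLp.ofLp h') 0
    have h1 : (SignType.sign w.1.2.1 : ℝ) * U (ζ w) = (SignType.sign w'.1.2.1 : ℝ) * U (ζ w') := by
      simpa [hψ] using congrFun (congrArg WithLp.ofLp h') 1
    have h2 : (SignType.sign w.1.2.2 : ℝ) * V (ζ w) = (SignType.sign w'.1.2.2 : ℝ) * V (ζ w') := by
      simpa [hψ] using congrFun (congrArg WithLp.ofLp h') 2
    have hUsq := congrArg (· ^ 2) h1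
    have hVsq := congrArg (· ^ 2) h2
    simp only [sign_mul_sqrt_sq (hUt w).2, sign_mul_sqrt_sq (hUt w').2] at hUsq
    simp only [sign_mul_sqrt_sq (hVs w).2, sign_mul_sqrt_sq (hVs w').2] at hVsq
    have hrr : r (ζ w) = r (ζ w') := by simp only [hr, h0]
    have hzz : ζ w = ζ w' := by
      refine Complex.ext h0 ?_
      rw [hU2 _ (hζ1 w), hU2 _ (hζ1 w'), hrr] at hUsq
      by_cases hr' : r (ζ w') = 0
      · have h3 := him _ (hζ1 w)
        have h4 := him _ (hζ1 w')
        rw [hrr, hr', abs_nonpos_iff] at h3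
        rw [hr', abs_nonpos_iff] at h4
        rw [h3, h4]
      · have : r (ζ w') * (ζ w).im = r (ζ w') * (ζ w').im := by linarith
        exact mul_left_cancel₀ hr' this
    have hp : (w.1.1, w.1.2.1 ^ 2) = (w'.1.1, w'.1.2.1 ^ 2) := hZb.injOn w.2.1 w'.2.1 hzz
    obtain ⟨hp1, hp2⟩ := Prod.mk.injEq _ _ _ _ ▸ hp
    rw [← hzz] at h1 h2
    have ht : w.1.2.1 = w'.1.2.1 := eq_of_sq_eq_of_sign_mul_eq hp2 (hUt w).1 h1
    have hs : w.1.2.2 = w'.1.2.2 := by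
      refine eq_of_sq_eq_of_sign_mul_eq ?_ (hVs w).1 h2
      rw [w.2.2, w'.2.2, hp1, hp2]
    exact Subtype.ext (Prod.ext hp1 (Prod.ext ht hs))
  · rintro ⟨v, hv⟩
    rw [mem_sphere_zero_iff_norm, EuclideanSpace.norm_eq, Real.sqrt_eq_one,
      Fin.sum_univ_three] at hv
    simp only [Real.norm_eq_abs, sq_abs] at hv
    -- the point of the disc is recovered from `r · Im z = U² - V²`; for `r = 0` the quotient below
    -- is `0`, which is the correct value
    set q : ℝ := √(1 - v 0 ^ 2) with hq
    have hq2 : q ^ 2 = v 1 ^ 2 + v 2 ^ 2 := by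
      rw [hq, Real.sq_sqrt (by nlinarith [sq_nonneg (v 1), sq_nonneg (v 2)])]
      linarith
    set z : ℂ := ⟨v 0, (v 1 ^ 2 - v 2 ^ 2) / q⟩ with hz
    have hqim : q * ((v 1 ^ 2 - v 2 ^ 2) / q) = v 1 ^ 2 - v 2 ^ 2 := by
      by_cases h : q = 0
      · rw [h] at hq2 ⊢
        have h1 : v 1 ^ 2 = 0 := by nlinarith [sq_nonneg (v 1), sq_nonneg (v 2)]
        have h2 : v 2 ^ 2 = 0 := by nlinarith [sq_nonneg (v 1), sq_nonneg (v 2)]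
        rw [h1, h2]; ring
      · field_simp
    have hz1 : ‖z‖ ≤ 1 := by
      rw [norm_le_one_iff_normSq, hz, Complex.normSq_mk]
      have h1 : ((v 1 ^ 2 - v 2 ^ 2) / q) ^ 2 ≤ q ^ 2 := by
        by_cases h : q = 0
        · rw [h]; simp
        · rw [div_pow, div_le_iff₀ (by positivity), hq2]
          nlinarith [mul_nonneg (sq_nonneg (v 1)) (sq_nonneg (v 2))]
      nlinarith
    obtain ⟨p, hp, hpz⟩ := hZb.surjOn (mem_closedBall_zero_iff.2 hz1)
    have hrz : r z = q := rfl
    have hUz : U z = |v 1| := by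
      simp only [hU, hrz]
      rw [show q * z.im = v 1 ^ 2 - v 2 ^ 2 from hqim, hq2, ← Real.sqrt_sq_eq_abs]
      congr 1; ring
    have hVz : V z = |v 2| := by
      simp only [hV, hrz]
      rw [show q * z.im = v 1 ^ 2 - v 2 ^ 2 from hqim, hq2, ← Real.sqrt_sq_eq_abs]
      congr 1; ring
    have hsgn : ∀ a x : ℝ, 0 ≤ x → (a = 0 ↔ x = 0) →
        ((SignType.sign a : ℝ) * √x) ^ 2 = x ∧
          (SignType.sign ((SignType.sign a : ℝ) * √x) : ℝ) * |a| = a := by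
      intro a x hx hax
      rcases hx.eq_or_lt with h | h
      · have ha := hax.2 h.symm
        rw [← h, ha]
        simp
      · have h1 : 0 < √x := Real.sqrt_pos.2 h
        have ha : a ≠ 0 := fun h' => h.ne' (hax.1 h')
        constructor
        · rw [sign_mul_sqrt_sq (fun h' => absurd h' ha), Real.sq_sqrt hx]
        · rw [sign_mul, sign_pos h1, mul_one]
          rcases lt_or_gt_of_ne ha with h2 | h2
          · simp [h2, abs_of_neg h2]
          · simp [h2, abs_of_pos h2]
    have hT' : v 1 = 0 ↔ p.2 = 0 := by
      rw [← hT0 p hp, hpz, ← hU0 z hz1, hUz, abs_eq_zero]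
    have hF' : v 2 = 0 ↔ F p.1 p.2 = 0 := by
      rw [← hF0 p hp, hpz, ← hV0 z hz1, hVz, abs_eq_zero]
    obtain ⟨ht1, ht2⟩ := hsgn _ _ (hT p hp) hT'
    obtain ⟨hs1, hs2⟩ := hsgn _ _ (hF p hp) hF'
    refine ⟨⟨(p.1, (SignType.sign (v 1) : ℝ) * √p.2, (SignType.sign (v 2) : ℝ) * √(F p.1 p.2)),
      ?_, ?_⟩, ?_⟩
    · simp only [ht1]; exact hp
    · simp only [ht1, hs1]
    · apply Subtype.ext
      simp only [hψ, hζ, ht1]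
      rw [show Z (p.1, p.2) = z from hpz, hUz, hVz, ht2, hs2]
      ext i
      fin_cases i <;> simp [hz]

/-- The moduli surface `s² = F(e, t²)` over the admissible region is a sphere. -/
theorem exists_surface_sphere {μ ν κ δ : ℝ} (hμν : μ * ν = 1) (hμ : 0 < μ) (hle : μ ≤ ν)
    (hκ : 0 < κ) (hδ : |δ| < 1) :
    ∃ Ψ : {w : ℝ × ℝ × ℝ | Adm μ ν κ δ w.1 (w.2.1 ^ 2) ∧
        w.2.2 ^ 2 = discFn μ ν κ δ w.1 (w.2.1 ^ 2)} →
      Metric.sphere (0 : EuclideanSpace ℝ (Fin 3)) 1, Continuous Ψ ∧ Function.Bijective Ψ := by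
  obtain ⟨e₁, b, l, u, he₁, hb, hl, hu, hR, hlu, h0, hb', hl0, hlpos, hF0⟩ :=
    exists_region_shape hμν hμ hle hκ hδ
  obtain ⟨Z, hZc, hZb, hZ⟩ := exists_disc_param_edges he₁ hb hl hu hlu h0 hb'
  have hset : {p : ℝ × ℝ | 0 ≤ p.1 ∧ p.1 ≤ b ∧ l p.1 ≤ p.2 ∧ p.2 ≤ u p.1}
      = {p | Adm μ ν κ δ p.1 p.2} := by
    ext p
    exact (hR p.1 p.2).symm
  rw [hset] at hZc hZb
  refine exists_sphere_param (R := {p | Adm μ ν κ δ p.1 p.2}) hZc hZb (fun p hp => hp.2.2.2.1)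
    (fun p hp => hp.2.2.2.2) (fun p hp => ?_) (fun p hp => ?_)
  · obtain ⟨h1, h2, h3, h4⟩ := (hR p.1 p.2).1 hp
    rw [(hZ p h1 h2 h3 h4).1]
    constructor
    · rintro ⟨h5, h6⟩
      rw [h5, hl0 _ h1 h6]
    · intro h5
      have h6 : p.1 ≤ e₁ := by
        by_contra! h7
        have := hlpos _ h7 h2
        linarith
      exact ⟨by rw [h5, hl0 _ h1 h6], h6⟩
  · obtain ⟨h1, h2, h3, h4⟩ := (hR p.1 p.2).1 hp
    rw [(hZ p h1 h2 h3 h4).2]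
    exact (hF0 _ _ hp).symm

/-! ### Euclidean spaces of dimension at least three do not embed as open sets in the sphere -/

/-- A continuous logarithm of a constant is constant on a preconnected set. -/
theorem eqOn_const_of_exp_eq {X : Type*} [TopologicalSpace X] {S : Set X} (hS : IsPreconnected S)
    {f : X → ℂ} (hf : ContinuousOn f S) {w : ℂ} (h : ∀ x ∈ S, Complex.exp (f x) = w)
    {x y : X} (hx : x ∈ S) (hy : y ∈ S) : f x = f y := by
  have : PreconnectedSpace S := Subtype.preconnectedSpace hS
  have h1 := Complex.isCoveringMap_exp.eq_of_comp_eq (A := S) (g₁ := fun a => f a.1)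
    (g₂ := fun _ => f y) (continuousOn_iff_continuous_domRestrict.1 hf) continuous_const
    (by
      funext a
      exact Subtype.ext ((h a.1 a.2).trans (h y hy).symm)) ⟨y, hy⟩ rfl
  exact congrFun h1 ⟨x, hx⟩

/-- Continuous logarithms exist on star-shaped open sets. -/
theorem exists_log_of_starConvex {E : Type*} [NormedAddCommGroup E] [NormedSpace ℝ E] {S : Set E}
    {v : E} (hS : IsOpen S) (hstar : StarConvex ℝ v S) (hv : v ∈ S) {f : E → ℂ}
    (hf : ContinuousOn f S) (h0 : ∀ x ∈ S, f x ≠ 0) :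
    ∃ g : E → ℂ, ContinuousOn g S ∧ ∀ x ∈ S, Complex.exp (g x) = f x := by
  classical
  have : ContractibleSpace S := hstar.contractibleSpace ⟨v, hv⟩
  have : LocallyPathConnectedSpace S := hS.locallyPathConnectedSpace
  obtain ⟨F, ⟨-, hF⟩, -⟩ := Complex.isCoveringMapOn_exp.existsUnique_continuousMap_lifts
    (A := S) ⟨fun a => f a.1, continuousOn_iff_continuous_domRestrict.1 hf⟩ (a₀ := ⟨v, hv⟩)
    (e₀ := Complex.log (f v)) (Complex.exp_log (h0 v hv)) (fun a => h0 a.1 a.2)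
  refine ⟨fun x => if h : x ∈ S then F ⟨x, h⟩ else 0, ?_, ?_⟩
  · rw [continuousOn_iff_continuous_domRestrict]
    convert! F.continuous using 1
    funext a
    simp
  · intro x hx
    simp only [hx, dif_pos]
    exact congrFun hF ⟨x, hx⟩

/-- Continuous logarithms exist on the complement of a point in dimension at least three. The
complement is the union of the complements of two opposite closed rays, which are star-shaped, and
the intersection of these is the complement of a line, hence connected. -/
theorem exists_log_compl_zero {E : Type*} [NormedAddCommGroup E] [NormedSpace ℝ E]
    [FiniteDimensional ℝ E] (hE : 3 ≤ Module.finrank ℝ E) {f : E → ℂ}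
    (hf : ContinuousOn f {0}ᶜ) (h0 : ∀ x, x ≠ 0 → f x ≠ 0) :
    ∃ g : E → ℂ, ContinuousOn g {0}ᶜ ∧ ∀ x, x ≠ 0 → Complex.exp (g x) = f x := by
  classical
  have : Nontrivial E := Module.nontrivial_of_finrank_pos (R := ℝ) (by omega)
  obtain ⟨v, hv⟩ := exists_ne (0 : E)
  -- the complement of the closed ray opposite to `v`
  let A : E → Set E := fun v => {x | ∀ t : ℝ, 0 ≤ t → x ≠ -(t • v)}
  have hAopen : ∀ v : E, v ≠ 0 → IsOpen (A v) := by
    intro v hv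
    have : (A v)ᶜ = (fun t : ℝ => -(t • v)) '' Set.Ici 0 := by
      ext x
      simp only [A, Set.mem_compl_iff, Set.mem_ofPred_eq, not_forall, Set.mem_image, Set.mem_Ici]
      constructor
      · rintro ⟨t, ht, h⟩
        exact ⟨t, ht, (not_not.1 h).symm⟩
      · rintro ⟨t, ht, h⟩
        exact ⟨t, ht, not_not.2 h.symm⟩
    rw [← isClosed_compl_iff, this]
    have hemb : Topology.IsClosedEmbedding fun t : ℝ => -(t • v) := by
      have := LinearMap.isClosedEmbedding_of_injective (𝕜 := ℝ)
        (f := LinearMap.toSpanSingleton ℝ E (-v))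
        (LinearMap.ker_eq_bot.2 (smul_left_injective ℝ (neg_ne_zero.2 hv)))
      simpa [LinearMap.toSpanSingleton] using this
    exact hemb.isClosedMap _ isClosed_Ici
  have hAv : ∀ v : E, v ≠ 0 → v ∈ A v := by
    intro v hv t ht h
    have : (1 + t) • v = 0 := by
      rw [add_smul, one_smul]
      nth_rewrite 1 [h]
      simp
    rcases smul_eq_zero.1 this with h1 | h1
    · linarith
    · exact hv h1
  have hAstar : ∀ v : E, v ≠ 0 → StarConvex ℝ v (A v) := by
    intro v hv x hx a b ha hb hab t ht h
    rcases hb.eq_or_lt with hb0 | hb0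
    · have hb1 : a = 1 := by linarith
      rw [← hb0, hb1] at h
      simp only [one_smul, zero_smul, add_zero] at h
      exact hAv v hv t ht h
    · have h1 : x = -(((a + t) / b) • v) := by
        have h2 : b • x = -((a + t) • v) := by
          rw [add_smul, neg_add, ← h]
          abel
        rw [div_eq_inv_mul, mul_smul, ← smul_neg, ← h2, smul_smul, inv_mul_cancel₀ hb0.ne',
          one_smul]
      exact hx _ (div_nonneg (by linarith) hb0.le) h1
  have hA0 : ∀ v : E, ∀ x ∈ A v, x ≠ 0 := by
    intro v x hx h
    exact hx 0 le_rfl (by simp [h])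
  have hnv : -v ≠ 0 := neg_ne_zero.2 hv
  obtain ⟨g₁, hg₁, hg₁'⟩ := exists_log_of_starConvex (hAopen v hv) (hAstar v hv) (hAv v hv)
    (hf.mono fun x hx => hA0 v x hx) fun x hx => h0 x (hA0 v x hx)
  obtain ⟨g₂, hg₂, hg₂'⟩ := exists_log_of_starConvex (hAopen (-v) hnv) (hAstar (-v) hnv)
    (hAv (-v) hnv) (hf.mono fun x hx => hA0 (-v) x hx) fun x hx => h0 x (hA0 (-v) x hx)
  have hline : A v ∩ A (-v) = ((Submodule.span ℝ {v} : Submodule ℝ E) : Set E)ᶜ := by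
    ext x
    simp only [A, Set.mem_inter_iff, Set.mem_ofPred_eq, Set.mem_compl_iff, SetLike.mem_coe,
      Submodule.mem_span_singleton, smul_neg, neg_neg]
    constructor
    · rintro ⟨h1, h2⟩ ⟨t, rfl⟩
      rcases le_total 0 t with ht | ht
      · exact h2 t ht rfl
      · exact h1 (-t) (by linarith) (by simp)
    · intro h
      exact ⟨fun t _ hx => h ⟨-t, by simp [hx]⟩, fun t _ hx => h ⟨t, hx.symm⟩⟩
  have hconn : IsConnected (A v ∩ A (-v)) := by
    rw [hline]
    refine isConnected_compl_of_one_lt_codim ?_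
    have h1 := Submodule.finrank_quotient_add_finrank (Submodule.span ℝ {v} : Submodule ℝ E)
    rw [finrank_span_singleton hv] at h1
    rw [← Module.finrank_eq_rank]
    exact_mod_cast (by omega : 1 < Module.finrank ℝ (E ⧸ (Submodule.span ℝ {v} : Submodule ℝ E)))
  obtain ⟨x₀, hx₀⟩ := hconn.nonempty
  -- on the overlap the two logarithms differ by a constant multiple of `2πi`
  have hdiff : ∀ x ∈ A v ∩ A (-v), g₁ x = g₂ x + (g₁ x₀ - g₂ x₀) := by
    intro x hx
    have := eqOn_const_of_exp_eq (f := fun x => g₁ x - g₂ x) (w := 1) hconn.isPreconnected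
      ((hg₁.mono Set.inter_subset_left).sub (hg₂.mono Set.inter_subset_right)) (fun y hy => by
        rw [Complex.exp_sub, hg₁' y hy.1, hg₂' y hy.2, div_self (h0 y (hA0 v y hy.1))]) hx hx₀
    linear_combination this
  have hexp : Complex.exp (g₁ x₀ - g₂ x₀) = 1 := by
    rw [Complex.exp_sub, hg₁' x₀ hx₀.1, hg₂' x₀ hx₀.2, div_self (h0 x₀ (hA0 v x₀ hx₀.1))]
  have hcover : ∀ x : E, x ≠ 0 → x ∈ A v ∨ x ∈ A (-v) := by
    intro x hx
    by_contra! h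
    simp only [A, Set.mem_ofPred_eq, not_forall, not_not, smul_neg, neg_neg] at h
    obtain ⟨⟨t, ht, h1⟩, ⟨s, hs, h2⟩⟩ := h
    have h3 : (s + t) • v = 0 := by
      rw [add_smul, ← h2, h1]; simp
    rcases smul_eq_zero.1 h3 with h4 | h4
    · have : s = 0 := by linarith
      rw [this, zero_smul] at h2
      exact hx h2
    · exact hv h4
  have hg2 : ∀ x ∈ A (-v), (if x ∈ A v then g₁ x else g₂ x + (g₁ x₀ - g₂ x₀))
      = g₂ x + (g₁ x₀ - g₂ x₀) := by
    intro x hx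
    split_ifs with h
    · exact hdiff x ⟨h, hx⟩
    · rfl
  refine ⟨fun x => if x ∈ A v then g₁ x else g₂ x + (g₁ x₀ - g₂ x₀), ?_, ?_⟩
  · intro x hx
    refine ContinuousAt.continuousWithinAt ?_
    rcases hcover x hx with h | h
    · refine (hg₁.continuousAt ((hAopen v hv).mem_nhds h)).congr ?_
      filter_upwards [(hAopen v hv).mem_nhds h] with y hy
      rw [if_pos hy]
    · refine ((hg₂.continuousAt ((hAopen (-v) hnv).mem_nhds h)).add
        (continuousAt_const (y := g₁ x₀ - g₂ x₀))).congr ?_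
      filter_upwards [(hAopen (-v) hnv).mem_nhds h] with y hy
      exact (hg2 y hy).symm
  · intro x hx
    rcases hcover x hx with h | h
    · simp only [if_pos h]
      exact hg₁' x h
    · simp only [hg2 x h]
      rw [Complex.exp_add, hexp, mul_one]
      exact hg₂' x h

/-- The complex plane has no open subset homeomorphic to a Euclidean space of dimension at least
three: a small circle around a point has no continuous logarithm. -/
theorem not_isOpenEmbedding_complex {E : Type*} [NormedAddCommGroup E] [NormedSpace ℝ E]
    [FiniteDimensional ℝ E] (hE : 3 ≤ Module.finrank ℝ E) {f : E → ℂ}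
    (hf : Topology.IsOpenEmbedding f) : False := by
  have hf0 : ∀ x, x ≠ 0 → f x - f 0 ≠ 0 := fun x hx h =>
    hx (hf.injective (sub_eq_zero.1 h))
  obtain ⟨g, hg, hg'⟩ := exists_log_compl_zero hE (f := fun x => f x - f 0)
    (hf.continuous.sub continuous_const).continuousOn hf0
  obtain ⟨ε, hε, hball⟩ := Metric.isOpen_iff.1 hf.isOpen_range (f 0) ⟨0, rfl⟩
  have hmem : ∀ t : ℝ, f 0 + (ε / 2 : ℝ) * Complex.exp (t * Complex.I) ∈ Set.range f := by
    intro t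
    refine hball ?_
    rw [Metric.mem_ball, dist_eq_norm, add_sub_cancel_left, norm_mul, Complex.norm_exp_ofReal_mul_I,
      Complex.norm_real, Real.norm_of_nonneg (by positivity)]
    linarith
  let e := hf.isEmbedding.toHomeomorph
  -- the preimage of a small circle around `f 0`
  let γ : ℝ → E := fun t => e.symm ⟨_, hmem t⟩
  have hγ : ∀ t, f (γ t) = f 0 + (ε / 2 : ℝ) * Complex.exp (t * Complex.I) := by
    intro t
    exact congrArg Subtype.val (e.apply_symm_apply ⟨_, hmem t⟩)
  have hγc : Continuous γ := e.symm.continuous.comp (Continuous.subtype_mk (by fun_prop) _)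
  have hγ0 : ∀ t, γ t ≠ 0 := by
    intro t h
    have := hγ t
    rw [h] at this
    have h2 : ((ε / 2 : ℝ) : ℂ) * Complex.exp (t * Complex.I) = 0 := by linear_combination -this
    rcases mul_eq_zero.1 h2 with h3 | h3
    · have : ε / 2 = 0 := by exact_mod_cast h3
      linarith
    · exact Complex.exp_ne_zero _ h3
  have hgγ : Continuous fun t => g (γ t) - t * Complex.I := by
    exact (hg.comp_continuous hγc hγ0).sub (by fun_prop)
  have hconst := eqOn_const_of_exp_eq (S := Set.univ) isPreconnected_univ
    (f := fun t : ℝ => g (γ t) - t * Complex.I) (w := (ε / 2 : ℝ)) hgγ.continuousOn (fun t _ => by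
      rw [Complex.exp_sub, hg' _ (hγ0 t), hγ t, add_sub_cancel_left,
        mul_div_cancel_right₀ _ (Complex.exp_ne_zero _)]) (Set.mem_univ 0)
      (Set.mem_univ (2 * Real.pi))
  have hper : γ (2 * Real.pi) = γ 0 := by
    apply hf.injective
    rw [hγ, hγ]
    push_cast
    rw [Complex.exp_two_pi_mul_I, zero_mul, Complex.exp_zero]
  simp only [hper] at hconst
  push_cast at hconst
  have h1 : (2 * Real.pi * Complex.I : ℂ) = 0 := by linear_combination hconst
  exact Complex.two_pi_I_ne_zero h1

/-- An open embedding into the sphere misses a point, since Euclidean space is not compact, and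
stereographic projection from that point leads to the plane. -/
theorem not_isOpenEmbedding_sphere {n : ℕ} (hn : 3 ≤ n)
    {f : EuclideanSpace ℝ (Fin n) → Metric.sphere (0 : EuclideanSpace ℝ (Fin 3)) 1}
    (hf : Topology.IsOpenEmbedding f) : False := by
  have hfact : Fact (Module.finrank ℝ (EuclideanSpace ℝ (Fin 3)) = 2 + 1) :=
    ⟨finrank_euclideanSpace_fin⟩
  have hdim : 3 ≤ Module.finrank ℝ (EuclideanSpace ℝ (Fin n)) := by
    rwa [finrank_euclideanSpace_fin]
  have hne : Set.range f ≠ Set.univ := by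
    intro h
    have hcs : CompactSpace (EuclideanSpace ℝ (Fin n)) :=
      (hf.isEmbedding.toHomeomorph.trans ((Homeomorph.setCongr h).trans
        (Homeomorph.Set.univ _))).symm.compactSpace
    have : Nontrivial (EuclideanSpace ℝ (Fin n)) :=
      Module.nontrivial_of_finrank_pos (R := ℝ) (by omega)
    exact (NormedSpace.noncompactSpace ℝ (EuclideanSpace ℝ (Fin n))).noncompact_univ
      hcs.isCompact_univ
  obtain ⟨v, hv⟩ := (Set.ne_univ_iff_exists_notMem _).1 hne
  have hsrc : ∀ x, f x ∈ (stereographic' 2 v).source := by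
    intro x
    rw [stereographic'_source]
    exact fun h => hv ⟨x, h⟩
  have h1 : Topology.IsOpenEmbedding fun x => stereographic' 2 v (f x) := by
    refine Topology.IsOpenEmbedding.of_continuous_injective_isOpenMap ?_ ?_ ?_
    · exact (stereographic' 2 v).continuousOn.comp_continuous hf.continuous hsrc
    · intro x y h
      exact hf.injective ((stereographic' 2 v).injOn (hsrc x) (hsrc y) h)
    · intro s hs
      have h2 : (fun x => stereographic' 2 v (f x)) '' s = stereographic' 2 v '' (f '' s) := by
        rw [Set.image_image]
      rw [h2]
      refine (stereographic' 2 v).isOpen_image_of_subset_source (hf.isOpenMap s hs) ?_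
      rintro _ ⟨x, -, rfl⟩
      exact hsrc x
  let c : EuclideanSpace ℝ (Fin 2) ≃ₜ ℂ :=
    Complex.orthonormalBasisOneI.repr.symm.toHomeomorph
  exact not_isOpenEmbedding_complex hdim (c.isOpenEmbedding.comp h1)

/-! ### The fundamental group -/

section Group

variable {p q r : ℕ} {a c : ℤ}

/-- The generator `x` of the fundamental group. -/
abbrev gx (p q r : ℕ) (a c : ℤ) : Pi1 p q r a c := gen p q r a c Gen.x

/-- The generator `y` of the fundamental group. -/
abbrev gy (p q r : ℕ) (a c : ℤ) : Pi1 p q r a c := gen p q r a c Gen.y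

/-- The generator `z` of the fundamental group. -/
abbrev gz (p q r : ℕ) (a c : ℤ) : Pi1 p q r a c := gen p q r a c Gen.z

/-- The generator `h` of the fundamental group, the class of the regular fibre. -/
abbrev gh (p q r : ℕ) (a c : ℤ) : Pi1 p q r a c := gen p q r a c Gen.h

theorem mk_relator {w : FreeGroup Gen} (hw : w ∈ relators p q r a c) :
    PresentedGroup.mk (relators p q r a c) w = 1 :=
  PresentedGroup.mk_eq_one_iff.2 (Subgroup.subset_normalClosure hw)

theorem gx_pow : gx p q r a c ^ p = gh p q r a c ^ a := by
  have h := mk_relator (p := p) (q := q) (r := r) (a := a) (c := c)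
    (w := FreeGroup.of Gen.x ^ p * (FreeGroup.of Gen.h ^ a)⁻¹) (by simp [relators])
  rw [map_mul, map_inv, map_pow, map_zpow] at h
  exact mul_inv_eq_one.1 h

theorem gy_pow : gy p q r a c ^ q = gh p q r a c ^ a := by
  have h := mk_relator (p := p) (q := q) (r := r) (a := a) (c := c)
    (w := FreeGroup.of Gen.y ^ q * (FreeGroup.of Gen.h ^ a)⁻¹) (by simp [relators])
  rw [map_mul, map_inv, map_pow, map_zpow] at h
  exact mul_inv_eq_one.1 h

theorem gz_pow : gz p q r a c ^ r = gh p q r a c ^ c := by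
  have h := mk_relator (p := p) (q := q) (r := r) (a := a) (c := c)
    (w := FreeGroup.of Gen.z ^ r * (FreeGroup.of Gen.h ^ c)⁻¹) (by simp [relators])
  rw [map_mul, map_inv, map_pow, map_zpow] at h
  exact mul_inv_eq_one.1 h

theorem gx_mul_gy_mul_gz : gx p q r a c * gy p q r a c * gz p q r a c = 1 := by
  have h := mk_relator (p := p) (q := q) (r := r) (a := a) (c := c)
    (w := FreeGroup.of Gen.x * FreeGroup.of Gen.y * FreeGroup.of Gen.z) (by simp [relators])
  rw [map_mul, map_mul] at h
  exact h

theorem commute_gh_gx : Commute (gh p q r a c) (gx p q r a c) := by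
  have h := mk_relator (p := p) (q := q) (r := r) (a := a) (c := c)
    (w := FreeGroup.of Gen.h * FreeGroup.of Gen.x * (FreeGroup.of Gen.x * FreeGroup.of Gen.h)⁻¹)
    (by simp [relators])
  rw [map_mul, map_inv, map_mul, map_mul] at h
  exact mul_inv_eq_one.1 h

theorem commute_gh_gy : Commute (gh p q r a c) (gy p q r a c) := by
  have h := mk_relator (p := p) (q := q) (r := r) (a := a) (c := c)
    (w := FreeGroup.of Gen.h * FreeGroup.of Gen.y * (FreeGroup.of Gen.y * FreeGroup.of Gen.h)⁻¹)
    (by simp [relators])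
  rw [map_mul, map_inv, map_mul, map_mul] at h
  exact mul_inv_eq_one.1 h

theorem gz_eq : gz p q r a c = (gx p q r a c * gy p q r a c)⁻¹ :=
  eq_inv_of_mul_eq_one_right gx_mul_gy_mul_gz

/-- A property closed under the group operations holds on the whole fundamental group as soon as it
holds for the generators. -/
theorem pi1_induction {P : Pi1 p q r a c → Prop} (hx : P (gx p q r a c)) (hy : P (gy p q r a c))
    (hh : P (gh p q r a c)) (h1 : P 1) (hmul : ∀ g k, P g → P k → P (g * k))
    (hinv : ∀ g, P g → P g⁻¹) (g : Pi1 p q r a c) : P g := by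
  have hz : P (gz p q r a c) := by
    rw [gz_eq]
    exact hinv _ (hmul _ _ hx hy)
  have hg : g ∈ Subgroup.closure
      (Set.range (PresentedGroup.of : Gen → PresentedGroup (relators p q r a c))) := by
    rw [PresentedGroup.closure_range_of]
    trivial
  induction hg using Subgroup.closure_induction with
  | mem x hx' =>
    obtain ⟨s, rfl⟩ := hx'
    cases s
    exacts [hx, hy, hz, hh]
  | one => exact h1
  | mul x y _ _ hx hy => exact hmul _ _ hx hy
  | inv x _ hx => exact hinv _ hx

theorem pi1_hom_ext {K : Type*} [Group K] {φ ψ : Pi1 p q r a c →* K}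
    (hx : φ (gx p q r a c) = ψ (gx p q r a c)) (hy : φ (gy p q r a c) = ψ (gy p q r a c))
    (hh : φ (gh p q r a c) = ψ (gh p q r a c)) : φ = ψ := by
  refine MonoidHom.ext fun g => ?_
  refine pi1_induction (P := fun g => φ g = ψ g) hx hy hh (by simp) ?_ ?_ g
  · intro g k h1 h2
    rw [map_mul, map_mul, h1, h2]
  · intro g h
    rw [map_inv, map_inv, h]

theorem commute_gh (g : Pi1 p q r a c) : Commute (gh p q r a c) g := by
  refine pi1_induction (P := fun g => Commute (gh p q r a c) g) commute_gh_gx commute_gh_gy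
    (Commute.refl _) (Commute.one_right _) ?_ ?_ g
  · exact fun g k h1 h2 => h1.mul_right h2
  · exact fun g h => h.inv_right

/-- Homomorphisms out of the fundamental group that kill the regular fibre. -/
theorem exists_pi1_hom {K : Type*} [Group K] {X Y Z : K} (hX : X ^ p = 1) (hY : Y ^ q = 1)
    (hZ : Z ^ r = 1) (hXYZ : X * Y * Z = 1) :
    ∃ φ : Pi1 p q r a c →* K, φ (gx p q r a c) = X ∧ φ (gy p q r a c) = Y ∧
      φ (gz p q r a c) = Z ∧ φ (gh p q r a c) = 1 := by
  let f : Gen → K := fun s => match s with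
    | Gen.x => X
    | Gen.y => Y
    | Gen.z => Z
    | Gen.h => 1
  have hf : ∀ w ∈ relators p q r a c, FreeGroup.lift f w = 1 := by
    intro w hw
    simp only [relators, Set.mem_insert_iff, Set.mem_singleton_iff] at hw
    rcases hw with rfl | rfl | rfl | rfl | rfl | rfl | rfl <;> simp [f, hX, hY, hZ, hXYZ]
  refine ⟨PresentedGroup.toGroup hf, ?_, ?_, ?_, ?_⟩ <;>
  exact PresentedGroup.toGroup.of hf

theorem eq_one_of_pow_coprime {K : Type*} [Group K] {X : K} {m n : ℕ} (h : m.Coprime n)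
    (hm : X ^ m = 1) (hn : X ^ n = 1) : X = 1 := by
  have := Nat.dvd_gcd (orderOf_dvd_of_pow_eq_one hm) (orderOf_dvd_of_pow_eq_one hn)
  rw [h.gcd_eq_one] at this
  exact orderOf_eq_one_iff.1 (Nat.dvd_one.1 this)

/-- A homomorphism with commuting images of `x` and `y` is trivial. In particular the fundamental
group of a homology sphere is perfect. -/
theorem eq_one_of_commute {K : Type*} [Group K] (hpq : p.Coprime q) (hqr : q.Coprime r)
    (hpr : p.Coprime r) (hac : a * r * (p + q) + c * p * q = 1) (φ : Pi1 p q r a c →* K)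
    (h : Commute (φ (gx p q r a c)) (φ (gy p q r a c))) : φ = 1 := by
  have hX : φ (gx p q r a c) ^ p = φ (gh p q r a c) ^ a := by
    rw [← map_pow, ← map_zpow, gx_pow]
  have hY : φ (gy p q r a c) ^ q = φ (gh p q r a c) ^ a := by
    rw [← map_pow, ← map_zpow, gy_pow]
  have hZ : φ (gz p q r a c) ^ r = φ (gh p q r a c) ^ c := by
    rw [← map_pow, ← map_zpow, gz_pow]
  have hZ' : φ (gz p q r a c) = (φ (gx p q r a c) * φ (gy p q r a c))⁻¹ := by
    rw [gz_eq, map_inv, map_mul]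
  generalize φ (gz p q r a c) = Z at hZ hZ'
  generalize hXX : φ (gx p q r a c) = X at hX hZ' h
  generalize hYY : φ (gy p q r a c) = Y at hY hZ' h
  generalize hHH : φ (gh p q r a c) = H at hX hY hZ
  have hH : H = 1 := by
    -- here the relation between `a` and `c` enters: the exponents of `H` add up to `1`
    have h1 : H = X ^ (p * q * r) * Y ^ (p * q * r) * Z ^ (p * q * r) := by
      have e1 : X ^ (p * q * r) = H ^ (a * (q * r)) := by
        rw [mul_assoc, pow_mul, hX, zpow_mul]
        norm_cast
      have e2 : Y ^ (p * q * r) = H ^ (a * (p * r)) := by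
        rw [mul_comm p q, mul_assoc, pow_mul, hY, zpow_mul]
        norm_cast
      have e3 : Z ^ (p * q * r) = H ^ (c * (p * q)) := by
        rw [mul_comm (p * q) r, pow_mul, hZ, zpow_mul]
        norm_cast
      rw [e1, e2, e3, ← zpow_add, ← zpow_add]
      rw [show a * (q * r) + a * (p * r) + c * (p * q) = 1 by rw [← hac]; ring, zpow_one]
    rw [h1, ← h.mul_pow, hZ', inv_pow, mul_inv_cancel]
  rw [hH, one_zpow] at hX hY hZ
  have h2 : X ^ r * Y ^ r = 1 := by
    rw [← h.mul_pow, ← inv_inj, ← inv_pow, ← hZ', hZ, inv_one]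
  have h3 : X ^ r = (Y ^ r)⁻¹ := eq_inv_of_mul_eq_one_left h2
  have hXr : X ^ r = 1 := by
    refine eq_one_of_pow_coprime hpq ?_ ?_
    · rw [← pow_mul, mul_comm, pow_mul, hX, one_pow]
    · rw [h3, inv_pow, ← pow_mul, mul_comm, pow_mul, hY, one_pow, inv_one]
  have hYr : Y ^ r = 1 := by rw [hXr, one_mul] at h2; exact h2
  refine pi1_hom_ext ?_ ?_ ?_
  · rw [hXX, MonoidHom.one_apply]
    exact eq_one_of_pow_coprime hpr hX hXr
  · rw [hYY, MonoidHom.one_apply]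
    exact eq_one_of_pow_coprime hqr hY hYr
  · rw [hHH, MonoidHom.one_apply]
    exact hH

end Group

end

noncomputable section

open Matrix

/-! ### Reducible representations -/

section Unitary

theorem coe_inv_SU {n : ℕ} (g : specialUnitaryGroup (Fin n) ℂ) :
    ((g⁻¹ : specialUnitaryGroup (Fin n) ℂ) : Matrix (Fin n) (Fin n) ℂ)
      = (g : Matrix (Fin n) (Fin n) ℂ)ᴴ := rfl

theorem conjTranspose_mul_self_SU {n : ℕ} (g : specialUnitaryGroup (Fin n) ℂ) :
    (g : Matrix (Fin n) (Fin n) ℂ)ᴴ * (g : Matrix (Fin n) (Fin n) ℂ) = 1 := by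
  rw [← coe_inv_SU, ← Submonoid.coe_mul, inv_mul_cancel, Submonoid.coe_one]

theorem mul_conjTranspose_self_SU {n : ℕ} (g : specialUnitaryGroup (Fin n) ℂ) :
    (g : Matrix (Fin n) (Fin n) ℂ) * (g : Matrix (Fin n) (Fin n) ℂ)ᴴ = 1 := by
  rw [← coe_inv_SU, ← Submonoid.coe_mul, mul_inv_cancel, Submonoid.coe_one]

theorem mem_SU_iff {n : ℕ} {A : Matrix (Fin n) (Fin n) ℂ} :
    A ∈ specialUnitaryGroup (Fin n) ℂ ↔ A * Aᴴ = 1 ∧ A.det = 1 := by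
  rw [mem_specialUnitaryGroup_iff, mem_unitaryGroup_iff]
  rfl

theorem star_dotProduct_mulVec_SU {n : ℕ} (g : specialUnitaryGroup (Fin n) ℂ)
    (v w : Fin n → ℂ) :
    star ((g : Matrix (Fin n) (Fin n) ℂ) *ᵥ v) ⬝ᵥ ((g : Matrix (Fin n) (Fin n) ℂ) *ᵥ w)
      = star v ⬝ᵥ w := by
  rw [star_mulVec, dotProduct_mulVec, vecMul_vecMul, conjTranspose_mul_self_SU, vecMul_one]

/-- Three orthonormal vectors are the columns of a unitary matrix. -/
theorem exists_unitary_of_orthonormal {v : Fin 3 → Fin 3 → ℂ}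
    (hv : ∀ i j, star (v i) ⬝ᵥ v j = if i = j then 1 else 0) :
    (Matrix.of fun i j => v j i)ᴴ * (Matrix.of fun i j => v j i) = 1 := by
  ext i j
  rw [mul_apply, one_apply, ← hv i j]
  rfl

/-- A unit vector is the last column of a special unitary matrix. -/
theorem exists_SU3_col (v : Fin 3 → ℂ) (hv : star v ⬝ᵥ v = 1) :
    ∃ g : SU3, (g : Matrix (Fin 3) (Fin 3) ℂ) *ᵥ Pi.single 2 1 = v := by
  set E := EuclideanSpace ℂ (Fin 3)
  have hnorm : ‖(WithLp.toLp 2 v : E)‖ = 1 := by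
    have h1 := inner_self_eq_norm_sq_to_K (𝕜 := ℂ) (WithLp.toLp 2 v : E)
    rw [EuclideanSpace.inner_eq_star_dotProduct, dotProduct_comm] at h1
    have h2 : ((‖(WithLp.toLp 2 v : E)‖ ^ 2 : ℝ) : ℂ) = 1 := by
      push_cast
      exact h1.symm.trans hv
    have h3 : ‖(WithLp.toLp 2 v : E)‖ ^ 2 = 1 := by exact_mod_cast h2
    exact (pow_eq_one_iff_of_nonneg (norm_nonneg _) two_ne_zero).1 h3
  have horth : Orthonormal ℂ (({2} : Set (Fin 3)).domRestrict
      (fun _ : Fin 3 => (WithLp.toLp 2 v : E))) := by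
    constructor
    · intro i
      exact hnorm
    · intro i j hij
      exact absurd (Subsingleton.elim i j) hij
  obtain ⟨b, hb⟩ := horth.exists_orthonormalBasis_extension_of_card_eq (by simp)
  have hortho : ∀ i j, star (b i).ofLp ⬝ᵥ (b j).ofLp = if i = j then 1 else 0 := by
    intro i j
    rw [dotProduct_comm, ← EuclideanSpace.inner_eq_star_dotProduct]
    exact orthonormal_iff_ite.1 b.orthonormal i j
  have hB := exists_unitary_of_orthonormal hortho
  set B : Matrix (Fin 3) (Fin 3) ℂ := Matrix.of fun i j => (b j).ofLp i with hBdef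
  have hdet : star B.det * B.det = 1 := by
    rw [← det_conjTranspose, ← det_mul, hB, det_one]
  -- correct the determinant by rescaling the first column
  set C : Matrix (Fin 3) (Fin 3) ℂ := B * diagonal ![star B.det, 1, 1] with hC
  have hCmem : C ∈ specialUnitaryGroup (Fin 3) ℂ := by
    rw [mem_SU_iff]
    constructor
    · refine _root_.mul_eq_one_comm.1 ?_
      rw [hC, conjTranspose_mul, mul_assoc, ← mul_assoc Bᴴ, hB, one_mul, diagonal_conjTranspose,
        diagonal_mul_diagonal, ← diagonal_one]
      congr 1
      funext i
      fin_cases i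
      · simpa [mul_comm] using hdet
      · simp
      · simp
    · rw [hC, det_mul, det_diagonal, Fin.prod_univ_three]
      simp only [cons_val_zero, cons_val_one, cons_val, mul_one]
      rw [mul_comm]
      exact hdet
  refine ⟨⟨C, hCmem⟩, ?_⟩
  funext i
  simp only [mulVec_single_one, col_apply, hC, mul_diagonal]
  have : (b 2).ofLp = v := by
    rw [hb 2 rfl]
  simp [hBdef, this]

theorem block_mul (A B : Matrix (Fin 2) (Fin 2) ℂ) : block A * block B = block (A * B) := by
  ext i j
  fin_cases i <;> fin_cases j <;> simp [block, mul_apply, Fin.sum_univ_succ]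

theorem block_one : block 1 = 1 := by
  ext i j
  fin_cases i <;> fin_cases j <;> simp [block, one_apply]

theorem block_injective : Function.Injective block := by
  intro A B h
  ext i j
  have h00 := congrFun (congrFun h 0) 0
  have h01 := congrFun (congrFun h 0) 1
  have h10 := congrFun (congrFun h 1) 0
  have h11 := congrFun (congrFun h 1) 1
  simp only [block, of_apply, cons_val', cons_val_zero, cons_val_one,
    cons_val_fin_one] at h00 h01 h10 h11
  fin_cases i <;> fin_cases j <;> assumption

theorem block_conjTranspose (A : Matrix (Fin 2) (Fin 2) ℂ) : (block A)ᴴ = block Aᴴ := by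
  ext i j
  fin_cases i <;> fin_cases j <;> simp [block, conjTranspose_apply]

theorem det_block (A : Matrix (Fin 2) (Fin 2) ℂ) : (block A).det = A.det := by
  simp [block, det_fin_three, det_fin_two]

theorem trace_block (A : Matrix (Fin 2) (Fin 2) ℂ) : (block A).trace = A.trace + 1 := by
  simp [block, trace_fin_three, trace_fin_two]

/-- A unitary matrix fixing the last basis vector is a block matrix. -/
theorem exists_block_eq (M : SU3)
    (hM : (M : Matrix (Fin 3) (Fin 3) ℂ) *ᵥ Pi.single 2 1 = Pi.single 2 1) :
    ∃ A : SU2, block (A : Matrix (Fin 2) (Fin 2) ℂ) = (M : Matrix (Fin 3) (Fin 3) ℂ) := by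
  have hM' : ((M : Matrix (Fin 3) (Fin 3) ℂ)ᴴ) *ᵥ Pi.single 2 1 = Pi.single 2 1 := by
    conv_lhs => rw [← hM, mulVec_mulVec, conjTranspose_mul_self_SU, one_mulVec]
  have hcol : ∀ i, (M : Matrix (Fin 3) (Fin 3) ℂ) i 2 = (Pi.single 2 1 : Fin 3 → ℂ) i := by
    intro i
    have := congrFun hM i
    simpa [mulVec_single_one] using this
  have hrow : ∀ i, (M : Matrix (Fin 3) (Fin 3) ℂ) 2 i = (Pi.single 2 1 : Fin 3 → ℂ) i := by
    intro i
    have := congrArg star (congrFun hM' i)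
    rw [mulVec_single_one, col_apply, conjTranspose_apply, star_star] at this
    rw [this]
    fin_cases i <;> simp
  set A : Matrix (Fin 2) (Fin 2) ℂ := !![(M : Matrix (Fin 3) (Fin 3) ℂ) 0 0,
    (M : Matrix (Fin 3) (Fin 3) ℂ) 0 1; (M : Matrix (Fin 3) (Fin 3) ℂ) 1 0,
    (M : Matrix (Fin 3) (Fin 3) ℂ) 1 1] with hA
  have hAM : block A = (M : Matrix (Fin 3) (Fin 3) ℂ) := by
    ext i j
    fin_cases i <;> fin_cases j <;> simp [block, hA, hcol, hrow]
  refine ⟨⟨A, mem_SU_iff.2 ⟨?_, ?_⟩⟩, hAM⟩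
  · apply block_injective
    rw [← block_mul, ← block_conjTranspose, hAM, mul_conjTranspose_self_SU, block_one]
  · rw [← det_block, hAM]
    exact (mem_SU_iff.1 M.2).2

/-- The commutant of a non-scalar `2 × 2` matrix is commutative. -/
theorem commute_of_commute_nonscalar {A B C : Matrix (Fin 2) (Fin 2) ℂ} (hA : A * B = B * A)
    (hC : C * B = B * C) (hB : ¬ ∃ t : ℂ, B = t • (1 : Matrix (Fin 2) (Fin 2) ℂ)) :
    A * C = C * A := by
  have e : ∀ X Y : Matrix (Fin 2) (Fin 2) ℂ, X * Y = Y * X ↔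
      (X 0 1 * Y 1 0 = Y 0 1 * X 1 0 ∧
        X 0 1 * (Y 0 0 - Y 1 1) = Y 0 1 * (X 0 0 - X 1 1) ∧
        X 1 0 * (Y 0 0 - Y 1 1) = Y 1 0 * (X 0 0 - X 1 1)) := by
    intro X Y
    rw [← Matrix.ext_iff]
    simp only [Fin.forall_fin_two, mul_apply, Fin.sum_univ_two]
    constructor
    · rintro ⟨⟨h1, h2⟩, h3, h4⟩
      refine ⟨?_, ?_, ?_⟩
      · linear_combination h1
      · linear_combination -h2
      · linear_combination h3
    · rintro ⟨h1, h2, h3⟩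
      refine ⟨⟨?_, ?_⟩, ?_, ?_⟩
      · linear_combination h1
      · linear_combination -h2
      · linear_combination h3
      · linear_combination -h1
  obtain ⟨a1, a2, a3⟩ := (e A B).1 hA
  obtain ⟨c1, c2, c3⟩ := (e C B).1 hC
  rw [e]
  by_cases h01 : B 0 1 = 0
  · by_cases h10 : B 1 0 = 0
    · have hd : B 0 0 - B 1 1 ≠ 0 := by
        intro h
        refine hB ⟨B 0 0, ?_⟩
        ext i j
        fin_cases i <;> fin_cases j <;> simp [h01, h10]
        linear_combination -h
      rw [h01, zero_mul] at a2 c2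
      rw [h10, zero_mul] at a3 c3
      have := (mul_eq_zero.1 a2).resolve_right hd
      have := (mul_eq_zero.1 a3).resolve_right hd
      have := (mul_eq_zero.1 c2).resolve_right hd
      have := (mul_eq_zero.1 c3).resolve_right hd
      simp [*]
    · refine ⟨?_, ?_, ?_⟩ <;> refine mul_left_cancel₀ h10 ?_
      · linear_combination C 1 0 * a1 - A 1 0 * c1
      · linear_combination (C 0 0 - C 1 1) * a1 - A 1 0 * c2 + C 0 1 * a3
      · linear_combination C 1 0 * a3 - A 1 0 * c3
  · refine ⟨?_, ?_, ?_⟩ <;> refine mul_left_cancel₀ h01 ?_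
    · linear_combination C 0 1 * a1 - A 0 1 * c1
    · linear_combination C 0 1 * a2 - A 0 1 * c2
    · linear_combination C 1 0 * a2 - (C 0 0 - C 1 1) * a1 - A 0 1 * c3

end Unitary

section Reps

variable {p q r : ℕ} {a c : ℤ}

/-- An invariant line of a representation of a perfect group is fixed pointwise. -/
theorem fixed_of_invariant_line (hpq : p.Coprime q) (hqr : q.Coprime r)
    (hpr : p.Coprime r) (hac : a * r * (p + q) + c * p * q = 1) (α : Reps p q r a c)
    {v : Fin 3 → ℂ} (hv : star v ⬝ᵥ v = 1)
    (h : ∀ γ, ∃ t : ℂ, (α γ : Matrix (Fin 3) (Fin 3) ℂ) *ᵥ v = t • v) (γ : Pi1 p q r a c) :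
    (α γ : Matrix (Fin 3) (Fin 3) ℂ) *ᵥ v = v := by
  choose χ hχ using h
  have hχ' : ∀ γ, star v ⬝ᵥ ((α γ : Matrix (Fin 3) (Fin 3) ℂ) *ᵥ v) = χ γ := by
    intro γ
    rw [hχ, dotProduct_smul, hv, smul_eq_mul, mul_one]
  let φ : Pi1 p q r a c →* ℂ :=
    { toFun := χ
      map_one' := by rw [← hχ', map_one, Submonoid.coe_one, one_mulVec, hv]
      map_mul' := fun g k => by
        rw [← hχ', map_mul, Submonoid.coe_mul, ← mulVec_mulVec, hχ k, mulVec_smul, hχ g,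
          dotProduct_smul, dotProduct_smul, hv]
        simp [mul_comm] }
  have h1 : φ.toHomUnits = 1 := eq_one_of_commute hpq hqr hpr hac _ (mul_comm _ _)
  have h2 : χ γ = 1 := by
    have := congrArg Units.val (DFunLike.congr_fun h1 γ)
    exact this
  rw [hχ, h2, one_smul]

/-- A reducible representation fixes a unit vector: an invariant line or the orthogonal complement
of an invariant plane is fixed pointwise. -/
theorem Red.exists_fixed (hpq : p.Coprime q) (hqr : q.Coprime r)
    (hpr : p.Coprime r) (hac : a * r * (p + q) + c * p * q = 1) {α : Reps p q r a c}
    (hα : Red α) :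
    ∃ v : Fin 3 → ℂ, star v ⬝ᵥ v = 1 ∧
      ∀ γ, (α γ : Matrix (Fin 3) (Fin 3) ℂ) *ᵥ v = v := by
  unfold Red Irred at hα
  push Not at hα
  obtain ⟨W, hW, hbot, htop⟩ := hα
  set E := EuclideanSpace ℂ (Fin 3)
  let L : E ≃ₗ[ℂ] (Fin 3 → ℂ) := WithLp.linearEquiv 2 ℂ (Fin 3 → ℂ)
  have hinner : ∀ x y : E, inner ℂ x y = star x.ofLp ⬝ᵥ y.ofLp := by
    intro x y
    rw [EuclideanSpace.inner_eq_star_dotProduct, dotProduct_comm]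
  -- a nonzero vector spanning an invariant line
  have hline : ∃ w : E, w ≠ 0 ∧ ∀ γ, ∃ t : ℂ,
      (α γ : Matrix (Fin 3) (Fin 3) ℂ) *ᵥ w.ofLp = t • w.ofLp := by
    set W' : Submodule ℂ E := W.comap (L : E →ₗ[ℂ] (Fin 3 → ℂ)) with hW'
    have hmem : ∀ w : E, w ∈ W' ↔ w.ofLp ∈ W := fun w => Iff.rfl
    have hbot' : W' ≠ ⊥ := by
      intro h
      refine hbot ((Submodule.eq_bot_iff _).2 fun w hw => ?_)
      have h1 : (WithLp.toLp 2 w : E) ∈ W' := hw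
      rw [h, Submodule.mem_bot] at h1
      exact congrArg WithLp.ofLp h1
    have htop' : W' ≠ ⊤ := by
      intro h
      refine htop (Submodule.eq_top_iff'.2 fun w => ?_)
      have h1 : (WithLp.toLp 2 w : E) ∈ W' := h ▸ Submodule.mem_top
      exact h1
    have hone : ∀ V : Submodule ℂ E, Module.finrank ℂ V = 1 →
        (∀ γ, ∀ w : E, w ∈ V →
          WithLp.toLp 2 ((α γ : Matrix (Fin 3) (Fin 3) ℂ) *ᵥ w.ofLp) ∈ V) →
        ∃ w : E, w ≠ 0 ∧ ∀ γ, ∃ t : ℂ,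
          (α γ : Matrix (Fin 3) (Fin 3) ℂ) *ᵥ w.ofLp = t • w.ofLp := by
      intro V hV hinv
      obtain ⟨⟨w, hw⟩, hw0, hspan⟩ := finrank_eq_one_iff'.1 hV
      refine ⟨w, fun h => hw0 (Subtype.ext h), fun γ => ?_⟩
      obtain ⟨t, ht⟩ := hspan ⟨_, hinv γ w hw⟩
      exact ⟨t, (congrArg WithLp.ofLp (congrArg Subtype.val ht)).symm⟩
    have hsum := W'.finrank_add_finrank_orthogonal
    rw [finrank_euclideanSpace_fin] at hsum
    have h0 : 0 < Module.finrank ℂ W' := by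
      rw [Nat.pos_iff_ne_zero, Ne, Submodule.finrank_eq_zero]
      exact hbot'
    have h3 : Module.finrank ℂ W' < 3 := by
      have := Submodule.finrank_lt (lt_top_iff_ne_top.2 htop').ne
      rwa [finrank_euclideanSpace_fin] at this
    have hcases : Module.finrank ℂ W' = 1 ∨ Module.finrank ℂ W'ᗮ = 1 := by omega
    rcases hcases with h1 | h1
    · exact hone W' h1 fun γ w hw => hW γ _ hw
    · refine hone W'ᗮ h1 fun γ w hw => ?_
      rw [Submodule.mem_orthogonal] at hw ⊢
      intro u hu
      have h2 := hw (WithLp.toLp 2 ((α γ⁻¹ : Matrix (Fin 3) (Fin 3) ℂ) *ᵥ u.ofLp)) (hW γ⁻¹ _ hu)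
      rw [hinner] at h2 ⊢
      have h4 : (α γ : Matrix (Fin 3) (Fin 3) ℂ) *ᵥ
          ((α γ⁻¹ : Matrix (Fin 3) (Fin 3) ℂ) *ᵥ u.ofLp) = u.ofLp := by
        rw [mulVec_mulVec, ← Submonoid.coe_mul, ← map_mul, mul_inv_cancel, map_one,
          Submonoid.coe_one, one_mulVec]
      rw [← star_dotProduct_mulVec_SU (α γ), h4] at h2
      exact h2
  obtain ⟨w, hw0, hw⟩ := hline
  have hw1 : ‖w‖ ≠ 0 := norm_ne_zero_iff.2 hw0
  set v : Fin 3 → ℂ := ((‖w‖⁻¹ : ℝ) : ℂ) • w.ofLp with hv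
  have hvv : star v ⬝ᵥ v = 1 := by
    have h1 := inner_self_eq_norm_sq_to_K (𝕜 := ℂ) w
    rw [hinner] at h1
    rw [hv, star_smul, smul_dotProduct, dotProduct_smul, h1]
    simp only [Complex.ofReal_inv, star_inv₀, RCLike.star_def, Complex.conj_ofReal, smul_eq_mul]
    have : (‖w‖ : ℂ) ≠ 0 := by exact_mod_cast hw1
    change (‖w‖ : ℂ)⁻¹ * ((‖w‖ : ℂ)⁻¹ * (‖w‖ : ℂ) ^ 2) = 1
    field_simp
  refine ⟨v, hvv, fun γ => fixed_of_invariant_line hpq hqr hpr hac α hvv (fun γ => ?_) γ⟩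
  obtain ⟨t, ht⟩ := hw γ
  exact ⟨t, by rw [hv, mulVec_smul, ht, smul_comm]⟩

/-- Reducible representations are conjugate to representations in `SU(2) × {1}`. -/
theorem Red.exists_conjToSU2 (hpq : p.Coprime q) (hqr : q.Coprime r)
    (hpr : p.Coprime r) (hac : a * r * (p + q) + c * p * q = 1) {α : Reps p q r a c}
    (hα : Red α) : ∃ β : Pi1 p q r a c →* SU2, ConjToSU2 α β := by
  obtain ⟨v, hv, hfix⟩ := hα.exists_fixed hpq hqr hpr hac
  obtain ⟨g, hg⟩ := exists_SU3_col v hv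
  have hginv : ((g⁻¹ : SU3) : Matrix (Fin 3) (Fin 3) ℂ) *ᵥ v = Pi.single 2 1 := by
    rw [← hg, mulVec_mulVec, ← Submonoid.coe_mul, inv_mul_cancel, Submonoid.coe_one, one_mulVec]
  have hex : ∀ γ, ∃ A : SU2, block (A : Matrix (Fin 2) (Fin 2) ℂ)
      = ((g⁻¹ * α γ * g : SU3) : Matrix (Fin 3) (Fin 3) ℂ) := by
    intro γ
    refine exists_block_eq _ ?_
    rw [Submonoid.coe_mul, Submonoid.coe_mul, ← mulVec_mulVec, ← mulVec_mulVec, hg, hfix, hginv]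
  choose B hB using hex
  refine ⟨MonoidHom.mk' B fun γ δ => ?_, g⁻¹, fun γ => ?_⟩
  · apply Subtype.ext
    apply block_injective
    rw [Submonoid.coe_mul, ← block_mul, hB, hB, hB, ← Submonoid.coe_mul, map_mul]
    congr 1
    group
  · rw [inv_inv, ← hB]
    rfl

theorem ConjToSU2.eq_one_iff {α : Reps p q r a c} {β : Pi1 p q r a c →* SU2}
    (h : ConjToSU2 α β) (γ : Pi1 p q r a c) : α γ = 1 ↔ β γ = 1 := by
  obtain ⟨g, hg⟩ := h
  have h1 : α γ = 1 ↔ g * α γ * g⁻¹ = 1 := by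
    rw [mul_inv_eq_one, mul_eq_left]
  rw [h1, ← Subtype.coe_inj, hg, Submonoid.coe_one, ← block_one, block_injective.eq_iff,
    ← Submonoid.coe_one, Subtype.coe_inj]

theorem ConjToSU2.trace_eq {α : Reps p q r a c} {β : Pi1 p q r a c →* SU2}
    (h : ConjToSU2 α β) (γ : Pi1 p q r a c) :
    (α γ : Matrix (Fin 3) (Fin 3) ℂ).trace = (β γ : Matrix (Fin 2) (Fin 2) ℂ).trace + 1 := by
  obtain ⟨g, hg⟩ := h
  rw [← trace_block, ← hg, Submonoid.coe_mul, Submonoid.coe_mul, trace_mul_comm, ← mul_assoc,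
    ← Submonoid.coe_mul, inv_mul_cancel, Submonoid.coe_one, one_mul]

theorem ConjToSU2.ne_one {α : Reps p q r a c} {β : Pi1 p q r a c →* SU2}
    (h : ConjToSU2 α β) (hα : α ≠ 1) : β ≠ 1 := by
  rintro rfl
  exact hα (MonoidHom.ext fun γ => (h.eq_one_iff γ).2 rfl)

/-- An element of `SU(2)` that commutes with the image of a nontrivial representation is `±1`. -/
theorem eq_one_or_neg_one_of_commute (hpq : p.Coprime q) (hqr : q.Coprime r)
    (hpr : p.Coprime r) (hac : a * r * (p + q) + c * p * q = 1)
    {β : Pi1 p q r a c →* SU2} (hβ : β ≠ 1) {B : SU2}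
    (hx : Commute B (β (gx p q r a c))) (hy : Commute B (β (gy p q r a c))) :
    (B : Matrix (Fin 2) (Fin 2) ℂ) = 1 ∨ (B : Matrix (Fin 2) (Fin 2) ℂ) = -1 := by
  by_cases hs : ∃ t : ℂ, (B : Matrix (Fin 2) (Fin 2) ℂ) = t • (1 : Matrix (Fin 2) (Fin 2) ℂ)
  · obtain ⟨t, ht⟩ := hs
    have hdet := (mem_SU_iff.1 B.2).2
    rw [ht, det_smul, det_one, mul_one, Fintype.card_fin] at hdet
    rcases (sq_eq_sq_iff_eq_or_eq_neg.1 (hdet.trans (one_pow 2).symm) : t = 1 ∨ t = -1) with h | h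
    · left; rw [ht, h, one_smul]
    · right; rw [ht, h, neg_smul, one_smul]
  · exfalso
    refine hβ (eq_one_of_commute hpq hqr hpr hac β ?_)
    apply Subtype.ext
    have h1 := congrArg Subtype.val hx.eq.symm
    have h2 := congrArg Subtype.val hy.eq.symm
    exact commute_of_commute_nonscalar h1 h2 hs

theorem rep_gh_eq (hpq : p.Coprime q) (hqr : q.Coprime r)
    (hpr : p.Coprime r) (hac : a * r * (p + q) + c * p * q = 1)
    {β : Pi1 p q r a c →* SU2} (hβ : β ≠ 1) :
    β (gh p q r a c) = 1 ∨ (β (gh p q r a c) : Matrix (Fin 2) (Fin 2) ℂ) = -1 := by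
  have := eq_one_or_neg_one_of_commute hpq hqr hpr hac hβ
    ((commute_gh_gx (p := p) (q := q) (r := r) (a := a) (c := c)).map β) (commute_gh_gy.map β)
  exact this.imp_left fun h => Subtype.ext h

/-- None of the generators `x`, `y`, `z` is sent to `±1` by a nontrivial representation. -/
theorem rep_gen_ne (hpq : p.Coprime q) (hqr : q.Coprime r)
    (hpr : p.Coprime r) (hac : a * r * (p + q) + c * p * q = 1)
    {β : Pi1 p q r a c →* SU2} (hβ : β ≠ 1) {g : Pi1 p q r a c}
    (hg : g = gx p q r a c ∨ g = gy p q r a c ∨ g = gz p q r a c) :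
    (β g : Matrix (Fin 2) (Fin 2) ℂ) ≠ 1 ∧ (β g : Matrix (Fin 2) (Fin 2) ℂ) ≠ -1 := by
  rw [← not_or]
  intro h
  have hcent : ∀ B : SU2, Commute (β g) B := by
    intro B
    apply Subtype.ext
    change (β g : Matrix (Fin 2) (Fin 2) ℂ) * B = B * (β g : Matrix (Fin 2) (Fin 2) ℂ)
    rcases h with h | h <;> rw [h] <;> simp
  refine hβ (eq_one_of_commute hpq hqr hpr hac β ?_)
  rcases hg with rfl | rfl | rfl
  · exact hcent _
  · exact (hcent _).symm
  · have h1 := hcent (β (gx p q r a c))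
    rw [gz_eq, map_inv, map_mul] at h1
    have h2 := h1.inv_left
    rw [inv_inv] at h2
    have h3 : Commute (β (gx p q r a c) * β (gy p q r a c)) (β (gx p q r a c)) := h2
    have h4 := h3.eq
    rw [mul_assoc] at h4
    exact (mul_left_cancel h4).symm

/-- Schur's lemma. -/
theorem Irred.exists_scalar {α : Reps p q r a c} (hα : Irred α) {B : Matrix (Fin 3) (Fin 3) ℂ}
    (hB : ∀ γ, B * (α γ : Matrix (Fin 3) (Fin 3) ℂ) = (α γ : Matrix (Fin 3) (Fin 3) ℂ) * B) :
    ∃ t : ℂ, B = t • (1 : Matrix (Fin 3) (Fin 3) ℂ) := by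
  obtain ⟨t, ht⟩ := Module.End.exists_eigenvalue (Matrix.toLin' B)
  have htop := hα (Module.End.eigenspace (Matrix.toLin' B) t) fun γ w hw => by
    rw [Module.End.mem_eigenspace_iff, toLin'_apply] at hw ⊢
    rw [mulVec_mulVec, hB, ← mulVec_mulVec, hw, mulVec_smul]
  rcases htop with h | h
  · exact absurd h ht
  · refine ⟨t, ?_⟩
    apply Matrix.toLin'.injective
    refine LinearMap.ext fun v => ?_
    have : v ∈ Module.End.eigenspace (Matrix.toLin' B) t := h ▸ Submodule.mem_top
    rw [Module.End.mem_eigenspace_iff] at this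
    rw [this, map_smul, toLin'_one]
    rfl

theorem Irred.gh_scalar {α : Reps p q r a c} (hα : Irred α) :
    ∃ t : ℂ, (α (gh p q r a c) : Matrix (Fin 3) (Fin 3) ℂ)
      = t • (1 : Matrix (Fin 3) (Fin 3) ℂ) := by
  refine hα.exists_scalar fun γ => ?_
  exact congrArg Subtype.val ((commute_gh γ).map α).eq

/-- The regular fibre goes to a cube root of unity for an irreducible representation, by Schur's
lemma, and to `diag(±1, ±1, 1)` for a reducible one. -/
theorem gh_pow_six (hpq : p.Coprime q) (hqr : q.Coprime r)
    (hpr : p.Coprime r) (hac : a * r * (p + q) + c * p * q = 1) (α : Reps p q r a c) :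
    α (gh p q r a c) ^ 6 = 1 := by
  by_cases hα : Irred α
  · obtain ⟨t, ht⟩ := hα.gh_scalar
    have hdet := (mem_SU_iff.1 (α (gh p q r a c)).2).2
    rw [ht, det_smul, det_one, mul_one, Fintype.card_fin] at hdet
    apply Subtype.ext
    rw [SubmonoidClass.coe_pow, ht, smul_pow, one_pow, show (6 : ℕ) = 3 * 2 from rfl, pow_mul,
      hdet, one_pow, one_smul, Submonoid.coe_one]
  · obtain ⟨β, hβ⟩ := Red.exists_conjToSU2 hpq hqr hpr hac hα
    rw [← map_pow, hβ.eq_one_iff, map_pow]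
    by_cases h1 : β = 1
    · rw [h1]; simp
    · rcases rep_gh_eq hpq hqr hpr hac h1 with h | h
      · rw [h, one_pow]
      · apply Subtype.ext
        rw [SubmonoidClass.coe_pow, h, Even.neg_one_pow (by decide), Submonoid.coe_one]

/-- The images of `x`, `y`, `z`, `h` have bounded finite order, uniformly in the representation. -/
theorem exists_uniform_exponent (hp : 0 < p) (hq : 0 < q) (hr : 0 < r) (hpq : p.Coprime q)
    (hqr : q.Coprime r) (hpr : p.Coprime r) (hac : a * r * (p + q) + c * p * q = 1)
    (s : Gen) : ∃ n : ℕ, 0 < n ∧ ∀ α : Reps p q r a c, α (gen p q r a c s) ^ n = 1 := by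
  have key : ∀ (m : ℕ) (k : ℤ) (g : Pi1 p q r a c), g ^ m = gh p q r a c ^ k →
      ∀ α : Reps p q r a c, α g ^ (m * 6) = 1 := by
    intro m k g hg α
    rw [pow_mul, ← map_pow, hg, map_zpow, ← zpow_natCast, ← _root_.zpow_mul, mul_comm,
      _root_.zpow_mul,
      zpow_natCast, gh_pow_six hpq hqr hpr hac, _root_.one_zpow]
  cases s
  · exact ⟨p * 6, by omega, key _ _ _ gx_pow⟩
  · exact ⟨q * 6, by omega, key _ _ _ gy_pow⟩
  · exact ⟨r * 6, by omega, key _ _ _ gz_pow⟩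
  · exact ⟨6, by omega, gh_pow_six hpq hqr hpr hac⟩

/-- The trace of a matrix with `M ^ n = 1` is a sum of three `n`-th roots of unity. -/
theorem finite_trace_of_pow {n : ℕ} (hn : 0 < n) :
    Set.Finite {t : ℂ | ∃ M : Matrix (Fin 3) (Fin 3) ℂ, M ^ n = 1 ∧ M.trace = t} := by
  have hfin : Set.Finite {u : ℂ | u ^ n = 1} := by
    refine (Polynomial.nthRoots n (1 : ℂ)).toFinset.finite_toSet.subset fun u hu => ?_
    simpa [Polynomial.mem_nthRoots hn] using hu
  refine ((hfin.prod (hfin.prod hfin)).image fun w : ℂ × ℂ × ℂ => w.1 + w.2.1 + w.2.2).subset ?_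
  rintro t ⟨M, hM, rfl⟩
  have hroot : ∀ u ∈ M.charpoly.roots, u ^ n = 1 := by
    intro u hu
    have h1 : Module.End.HasEigenvalue (Matrix.toLin' M) u := by
      rw [Module.End.hasEigenvalue_iff_isRoot_charpoly, Matrix.charpoly_toLin']
      exact (Polynomial.mem_roots'.1 hu).2
    obtain ⟨v, hv⟩ := h1.exists_hasEigenvector
    have h2 := hv.pow_apply n
    rw [← Matrix.toLin'_pow, hM, toLin'_one, LinearMap.id_apply] at h2
    have h3 : (u ^ n - 1) • v = 0 := by rw [sub_smul, ← h2, one_smul, sub_self]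
    exact sub_eq_zero.1 ((smul_eq_zero.1 h3).resolve_right hv.2)
  have hcard : Multiset.card M.charpoly.roots = 3 := by
    rw [← (IsAlgClosed.splits M.charpoly).natDegree_eq_card_roots, charpoly_natDegree_eq_dim,
      Fintype.card_fin]
  obtain ⟨u, v, w, huvw⟩ := Multiset.card_eq_three.1 hcard
  rw [huvw] at hroot
  refine ⟨(u, v, w), ⟨hroot u (by simp), hroot v (by simp), hroot w (by simp)⟩, ?_⟩
  rw [trace_eq_sum_roots_charpoly, huvw]
  simp [add_assoc]

open scoped ComplexOrder in
/-- A special unitary matrix with maximal trace is the identity, as `‖M - 1‖² = 2 (n - Re tr M)`. -/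
theorem eq_one_of_trace {n : ℕ} {M : specialUnitaryGroup (Fin n) ℂ}
    (h : (M : Matrix (Fin n) (Fin n) ℂ).trace = n) : M = 1 := by
  have h1 : (((M : Matrix (Fin n) (Fin n) ℂ) - 1)ᴴ * ((M : Matrix (Fin n) (Fin n) ℂ) - 1)).trace
      = 0 := by
    rw [conjTranspose_sub, conjTranspose_one, sub_mul, mul_sub, mul_sub, conjTranspose_mul_self_SU]
    simp [trace_conjTranspose, h]
  have h2 := (trace_conjTranspose_mul_self_eq_zero_iff).1 h1
  exact Subtype.ext (sub_eq_zero.1 h2)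

end Reps

/-! ### Topology of the representation variety -/

section Topology

variable {p q r : ℕ} {a c : ℤ}

theorem continuous_rep_apply (γ : Pi1 p q r a c) : Continuous fun α : Reps p q r a c => α γ :=
  (continuous_apply γ).comp continuous_induced_dom

theorem continuous_rep_coe (γ : Pi1 p q r a c) :
    Continuous fun α : Reps p q r a c => (α γ : Matrix (Fin 3) (Fin 3) ℂ) :=
  continuous_subtype_val.comp (continuous_rep_apply γ)

/-- The special unitary group is compact: it is closed, and matrix entries are bounded by `1`. -/
instance compactSpace_SU3 : CompactSpace SU3 := by
  suffices h : IsCompact (specialUnitaryGroup (Fin 3) ℂ : Set (Matrix (Fin 3) (Fin 3) ℂ)) from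
    isCompact_iff_compactSpace.1 h
  have hsub : (specialUnitaryGroup (Fin 3) ℂ : Set (Matrix (Fin 3) (Fin 3) ℂ)) ⊆
      Set.pi Set.univ fun _ => Set.pi Set.univ fun _ => Metric.closedBall (0 : ℂ) 1 := by
    intro M hM i _ j _
    rw [mem_closedBall_zero_iff]
    exact entry_norm_bound_of_unitary (mem_specialUnitaryGroup_iff.1 hM).1 i j
  refine IsCompact.of_isClosed_subset ?_ ?_ hsub
  · exact isCompact_univ_pi fun _ => isCompact_univ_pi fun _ => isCompact_closedBall _ _
  · have h1 : (specialUnitaryGroup (Fin 3) ℂ : Set (Matrix (Fin 3) (Fin 3) ℂ))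
        = {M | M * Mᴴ = 1 ∧ M.det = 1} := by
      ext M
      exact mem_SU_iff
    rw [h1]
    refine IsClosed.inter ?_ ?_
    · exact isClosed_eq (by fun_prop) continuous_const
    · exact isClosed_eq (Continuous.matrix_det continuous_id) continuous_const

instance compactSpace_reps : CompactSpace (Reps p q r a c) := by
  have hemb : Topology.IsClosedEmbedding
      (fun α : Reps p q r a c => (α : Pi1 p q r a c → SU3)) := by
    refine ⟨⟨⟨rfl⟩, DFunLike.coe_injective⟩, ?_⟩
    exact MonoidHom.isClosed_range_coe (Pi1 p q r a c) SU3
  exact hemb.compactSpace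

theorem continuous_cls : Continuous (cls : Reps p q r a c → RepVariety p q r a c) :=
  continuous_quotient_mk'

theorem cls_eq_iff {α β : Reps p q r a c} :
    cls α = cls β ↔ ∃ g : SU3, ∀ γ, β γ = g * α γ * g⁻¹ := Quotient.eq

theorem exists_cls_eq (ξ : RepVariety p q r a c) : ∃ α, cls α = ξ := Quotient.exists_rep ξ

/-- The representation `γ ↦ g α(γ) g⁻¹`. -/
def conjRep (g : SU3) (α : Reps p q r a c) : Reps p q r a c :=
  (MulAut.conj g).toMonoidHom.comp α

theorem conjRep_apply (g : SU3) (α : Reps p q r a c) (γ : Pi1 p q r a c) :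
    conjRep g α γ = g * α γ * g⁻¹ := rfl

theorem cls_conjRep (g : SU3) (α : Reps p q r a c) : cls (conjRep g α) = cls α :=
  (cls_eq_iff.2 ⟨g, fun _ => rfl⟩).symm

theorem continuous_conjRep (g : SU3) :
    Continuous (conjRep g : Reps p q r a c → Reps p q r a c) := by
  refine continuous_induced_rng.2 (continuous_pi fun γ => ?_)
  exact ((continuous_const.mul (continuous_rep_apply γ)).mul continuous_const)

/-- The quotient map to the representation variety is open. -/
theorem isOpenMap_cls : IsOpenMap (cls : Reps p q r a c → RepVariety p q r a c) := by
  intro U hU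
  have h1 : cls ⁻¹' (cls '' U) = ⋃ g : SU3, conjRep g ⁻¹' U := by
    ext α
    simp only [Set.mem_preimage, Set.mem_image, Set.mem_iUnion]
    constructor
    · rintro ⟨β, hβ, h⟩
      obtain ⟨g, hg⟩ := cls_eq_iff.1 h.symm
      refine ⟨g, ?_⟩
      have : conjRep g α = β := MonoidHom.ext fun γ => (hg γ).symm
      rwa [this]
    · rintro ⟨g, hg⟩
      exact ⟨_, hg, cls_conjRep g α⟩
  have h2 : IsOpen (cls ⁻¹' (cls '' U)) := by
    rw [h1]
    exact isOpen_iUnion fun g => hU.preimage (continuous_conjRep g)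
  exact h2

theorem trace_conj (g M : SU3) : ((g * M * g⁻¹ : SU3) : Matrix (Fin 3) (Fin 3) ℂ).trace
    = (M : Matrix (Fin 3) (Fin 3) ℂ).trace := by
  rw [Submonoid.coe_mul, Submonoid.coe_mul, trace_mul_comm, ← mul_assoc,
    ← Submonoid.coe_mul, inv_mul_cancel, Submonoid.coe_one, one_mul]

/-- The trace of a generator, as a function on the representation variety. -/
def trCls (s : Gen) : RepVariety p q r a c → ℂ :=
  Quotient.lift (fun α : Reps p q r a c => (α (gen p q r a c s) : Matrix (Fin 3) (Fin 3) ℂ).trace)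
    (by
      rintro α β ⟨g, hg⟩
      rw [hg, trace_conj])

theorem trCls_cls (s : Gen) (α : Reps p q r a c) :
    trCls s (cls α) = (α (gen p q r a c s) : Matrix (Fin 3) (Fin 3) ℂ).trace := rfl

/-- A continuous function with finitely many values in a `T1` space is locally constant. -/
theorem isLocallyConstant_of_finite_range {X Y : Type*} [TopologicalSpace X] [TopologicalSpace Y]
    [T1Space Y] {f : X → Y} (hf : Continuous f) (h : (Set.range f).Finite) :
    IsLocallyConstant f := by
  refine IsLocallyConstant.iff_isOpen_fiber.2 fun y => ?_
  have h1 : f ⁻¹' {y} = (f ⁻¹' (Set.range f \ {y}))ᶜ := by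
    ext x
    simp
  rw [h1, isOpen_compl_iff]
  exact (h.subset Set.sdiff_subset).isClosed.preimage hf

/-- The traces of the generators are locally constant on the representation variety, being sums of
roots of unity of bounded order. -/
theorem isLocallyConstant_trCls (hp : 0 < p) (hq : 0 < q) (hr : 0 < r) (hpq : p.Coprime q)
    (hqr : q.Coprime r) (hpr : p.Coprime r) (hac : a * r * (p + q) + c * p * q = 1) (s : Gen) :
    IsLocallyConstant (trCls s : RepVariety p q r a c → ℂ) := by
  refine isLocallyConstant_of_finite_range ?_ ?_
  · exact Continuous.quotient_lift (Continuous.matrix_trace (continuous_rep_coe _)) _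
  · obtain ⟨n, hn, h⟩ := exists_uniform_exponent hp hq hr hpq hqr hpr hac s
    refine (finite_trace_of_pow hn).subset ?_
    rintro t ⟨ξ, rfl⟩
    obtain ⟨α, rfl⟩ := exists_cls_eq ξ
    exact ⟨_, by rw [← SubmonoidClass.coe_pow, h, Submonoid.coe_one], rfl⟩

/-- The classes on which the generators have the same traces as on `ξ`. -/
def level (ξ : RepVariety p q r a c) : Set (RepVariety p q r a c) :=
  {η | ∀ s, trCls s η = trCls s ξ}

theorem isClopen_level (hp : 0 < p) (hq : 0 < q) (hr : 0 < r) (hpq : p.Coprime q)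
    (hqr : q.Coprime r) (hpr : p.Coprime r) (hac : a * r * (p + q) + c * p * q = 1)
    (ξ : RepVariety p q r a c) : IsClopen (level ξ) := by
  have h1 : level ξ = ((trCls Gen.x ⁻¹' {trCls Gen.x ξ} ∩ trCls Gen.y ⁻¹' {trCls Gen.y ξ}) ∩
      trCls Gen.z ⁻¹' {trCls Gen.z ξ}) ∩ trCls Gen.h ⁻¹' {trCls Gen.h ξ} := by
    ext η
    constructor
    · intro h
      exact ⟨⟨⟨h _, h _⟩, h _⟩, h _⟩
    · rintro ⟨⟨⟨h1, h2⟩, h3⟩, h4⟩ s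
      cases s
      exacts [h1, h2, h3, h4]
  have h2 := fun s => (isLocallyConstant_trCls hp hq hr hpq hqr hpr hac s).isClopen_fiber
    (trCls s ξ)
  rw [h1]
  exact (((h2 _).inter (h2 _)).inter (h2 _)).inter (h2 _)

theorem pathComponent_subset_level (hp : 0 < p) (hq : 0 < q) (hr : 0 < r) (hpq : p.Coprime q)
    (hqr : q.Coprime r) (hpr : p.Coprime r) (hac : a * r * (p + q) + c * p * q = 1)
    (ξ : RepVariety p q r a c) : pathComponent ξ ⊆ level ξ := by
  intro η hη s
  exact (isLocallyConstant_trCls hp hq hr hpq hqr hpr hac s).apply_eq_of_isPreconnected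
    isPathConnected_pathComponent.isConnected.isPreconnected hη (mem_pathComponent_self ξ)

theorem eq_one_of_trCls {α : Reps p q r a c} {s : Gen} (h : trCls s (cls α) = 3) :
    α (gen p q r a c s) = 1 :=
  eq_one_of_trace (by rw [← trCls_cls, h]; norm_num)

theorem trCls_of_eq_one {α : Reps p q r a c} {s : Gen} (h : α (gen p q r a c s) = 1) :
    trCls s (cls α) = 3 := by
  rw [trCls_cls, h, Submonoid.coe_one, trace_one, Fintype.card_fin]
  norm_num

end Topology

/-! ### Spectral projections -/

section Spectral

/-- The eigenvalues `1, ζ, ζ̄` of the special unitary matrices with trace `1 + 2 Re ζ`. -/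
def ev (ζ : ℂ) : Fin 3 → ℂ := ![1, ζ, star ζ]

/-- The diagonal matrix `diag(1, ζ, ζ̄)`. -/
def dg (ζ : ℂ) : Matrix (Fin 3) (Fin 3) ℂ := diagonal (ev ζ)

theorem ev_ne {ζ : ℂ} (hζ : ζ.im ≠ 0) {i j : Fin 3} (hij : i ≠ j) : ev ζ i ≠ ev ζ j := by
  have h1 : ζ ≠ 1 := fun h => hζ (by rw [h]; simp)
  have h2 : star ζ ≠ 1 := fun h => h1 (by rw [← star_star ζ, h, star_one])
  have h3 : star ζ ≠ ζ := fun h => hζ (Complex.conj_eq_iff_im.1 h)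
  fin_cases i <;> fin_cases j <;> first | exact absurd rfl hij | skip
  · exact h1.symm
  · exact h2.symm
  · exact h1
  · exact h3.symm
  · exact h2
  · exact h3

theorem star_ev_mul_ev {ζ : ℂ} (hζ : star ζ * ζ = 1) (i : Fin 3) :
    star (ev ζ i) * ev ζ i = 1 := by
  fin_cases i
  · simp [ev]
  · simpa [ev] using hζ
  · simpa [ev, mul_comm] using hζ

theorem dg_mul_conjTranspose {ζ : ℂ} (hζ : star ζ * ζ = 1) : dg ζ * (dg ζ)ᴴ = 1 := by
  rw [dg, diagonal_conjTranspose, diagonal_mul_diagonal, ← diagonal_one]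
  congr 1
  funext i
  rw [mul_comm]
  exact star_ev_mul_ev hζ i

theorem det_dg {ζ : ℂ} (hζ : star ζ * ζ = 1) : (dg ζ).det = 1 := by
  rw [dg, det_diagonal, Fin.prod_univ_three]
  simpa [ev, mul_comm] using hζ

theorem dg_pow {ζ : ℂ} {n : ℕ} (hζ : ζ ^ n = 1) : dg ζ ^ n = 1 := by
  rw [dg, diagonal_pow, ← diagonal_one]
  congr 1
  funext i
  fin_cases i
  · simp [ev]
  · simpa [ev] using hζ
  · simpa [ev] using congrArg star hζ

theorem trace_dg (ζ : ℂ) : (dg ζ).trace = 1 + 2 * (ζ.re : ℂ) := by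
  rw [dg, trace_diagonal, Fin.sum_univ_three]
  have := Complex.add_conj ζ
  simp only [ev, cons_val_zero, cons_val_one, cons_val, RCLike.star_def]
  push_cast at this
  rw [add_assoc, this]

/-- The Lagrange polynomial in `X` that is the projection onto the `i`-th eigenspace. -/
def proj (ζ : ℂ) (i : Fin 3) (X : Matrix (Fin 3) (Fin 3) ℂ) : Matrix (Fin 3) (Fin 3) ℂ :=
  ((ev ζ i - ev ζ (i + 1)) * (ev ζ i - ev ζ (i + 2)))⁻¹ •
    ((X - ev ζ (i + 1) • (1 : Matrix (Fin 3) (Fin 3) ℂ)) *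
      (X - ev ζ (i + 2) • (1 : Matrix (Fin 3) (Fin 3) ℂ)))

theorem continuous_proj (ζ : ℂ) (i : Fin 3) : Continuous (proj ζ i) := by
  unfold proj
  fun_prop

theorem proj_conj (ζ : ℂ) (i : Fin 3) (g X : Matrix (Fin 3) (Fin 3) ℂ) (hg : gᴴ * g = 1) :
    proj ζ i (g * X * gᴴ) = g * proj ζ i X * gᴴ := by
  have hg' : g * gᴴ = 1 := _root_.mul_eq_one_comm.1 hg
  have e : ∀ t : ℂ, g * X * gᴴ - t • (1 : Matrix (Fin 3) (Fin 3) ℂ)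
      = g * (X - t • (1 : Matrix (Fin 3) (Fin 3) ℂ)) * gᴴ := by
    intro t
    rw [mul_sub, sub_mul, mul_smul_comm, smul_mul_assoc, mul_one, hg']
  rw [proj, proj, e, e, mul_smul_comm, smul_mul_assoc]
  congr 1
  simp only [mul_assoc]
  rw [← mul_assoc gᴴ g, hg, one_mul]

theorem proj_dg {ζ : ℂ} (hζ : ζ.im ≠ 0) (i : Fin 3) :
    proj ζ i (dg ζ) = diagonal (Pi.single i 1) := by
  have e : ∀ t : ℂ, dg ζ - t • (1 : Matrix (Fin 3) (Fin 3) ℂ)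
      = diagonal fun k => ev ζ k - t := by
    intro t
    rw [dg, smul_one_eq_diagonal, ← diagonal_sub]
  have h1 := ev_ne hζ (i := i) (j := i + 1) (by fin_cases i <;> decide)
  have h2 := ev_ne hζ (i := i) (j := i + 2) (by fin_cases i <;> decide)
  rw [proj, e, e, diagonal_mul_diagonal, ← diagonal_smul]
  congr 1
  funext k
  simp only [Pi.smul_apply, smul_eq_mul]
  have hk : k = i ∨ k = i + 1 ∨ k = i + 2 := by fin_cases i <;> fin_cases k <;> decide
  rcases hk with rfl | rfl | rfl
  · rw [Pi.single_eq_same, inv_mul_cancel₀]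
    exact mul_ne_zero (sub_ne_zero.2 h1) (sub_ne_zero.2 h2)
  · rw [sub_self, zero_mul, mul_zero, Pi.single_eq_of_ne]
    fin_cases i <;> decide
  · rw [sub_self, mul_zero, mul_zero, Pi.single_eq_of_ne]
    fin_cases i <;> decide

/-- The projections of `X = V diag(1, ζ, ζ̄) Vᴴ` are given by the columns of `V`. -/
theorem proj_eq {ζ : ℂ} (hζ : ζ.im ≠ 0) (i : Fin 3) {V : Matrix (Fin 3) (Fin 3) ℂ}
    (hV : Vᴴ * V = 1) :
    proj ζ i (V * dg ζ * Vᴴ) = vecMulVec (V.col i) (star (V.col i)) := by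
  rw [proj_conj _ _ _ _ hV, proj_dg hζ]
  ext k l
  rw [mul_apply]
  simp only [mul_diagonal, conjTranspose_apply, vecMulVec_apply, Pi.single_apply]
  rw [Finset.sum_eq_single i]
  · simp
  · intro b _ hb
    simp [hb]
  · simp

/-- The characteristic polynomial of a `3 × 3` matrix. -/
theorem det_smul_one_sub (X : Matrix (Fin 3) (Fin 3) ℂ) (t : ℂ) :
    (X - t • (1 : Matrix (Fin 3) (Fin 3) ℂ)).det
      = X.det - X.adjugate.trace * t + X.trace * t ^ 2 - t ^ 3 := by
  rw [adjugate_fin_three]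
  simp [det_fin_three, trace_fin_three]
  ring

theorem adjugate_SU (X : SU3) :
    (X : Matrix (Fin 3) (Fin 3) ℂ).adjugate = (X : Matrix (Fin 3) (Fin 3) ℂ)ᴴ := by
  have h1 := mul_adjugate (X : Matrix (Fin 3) (Fin 3) ℂ)
  rw [(mem_SU_iff.1 X.2).2, one_smul] at h1
  calc (X : Matrix (Fin 3) (Fin 3) ℂ).adjugate
      = ((X : Matrix (Fin 3) (Fin 3) ℂ)ᴴ * (X : Matrix (Fin 3) (Fin 3) ℂ))
        * (X : Matrix (Fin 3) (Fin 3) ℂ).adjugate := by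
          rw [conjTranspose_mul_self_SU, one_mul]
    _ = _ := by rw [mul_assoc, h1, mul_one]

/-- A nonzero vector can be normalized. -/
theorem exists_unit_smul {v : Fin 3 → ℂ} (hv : v ≠ 0) :
    ∃ t : ℂ, star (t • v) ⬝ᵥ (t • v) = 1 := by
  set w : EuclideanSpace ℂ (Fin 3) := WithLp.toLp 2 v with hw
  have hw0 : w ≠ 0 := fun h => hv (congrArg WithLp.ofLp h)
  have h1 := inner_self_eq_norm_sq_to_K (𝕜 := ℂ) w
  rw [EuclideanSpace.inner_eq_star_dotProduct, dotProduct_comm] at h1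
  refine ⟨((‖w‖⁻¹ : ℝ) : ℂ), ?_⟩
  have h2 : star v ⬝ᵥ v = ((‖w‖ : ℝ) : ℂ) ^ 2 := h1
  rw [star_smul, smul_dotProduct, dotProduct_smul, h2]
  have h3 : ((‖w‖ : ℝ) : ℂ) ≠ 0 := by exact_mod_cast norm_ne_zero_iff.2 hw0
  simp only [Complex.ofReal_inv, star_inv₀, RCLike.star_def, Complex.conj_ofReal, smul_eq_mul]
  field_simp

/-- Diagonalization of special unitary matrices with eigenvalues `1, ζ, ζ̄`. -/
theorem exists_diagonalization {ζ : ℂ} (hζ : star ζ * ζ = 1) (him : ζ.im ≠ 0) (X : SU3)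
    (htr : (X : Matrix (Fin 3) (Fin 3) ℂ).trace = 1 + 2 * (ζ.re : ℂ)) :
    ∃ V : Matrix (Fin 3) (Fin 3) ℂ, Vᴴ * V = 1 ∧
      (X : Matrix (Fin 3) (Fin 3) ℂ) = V * dg ζ * Vᴴ := by
  have hre : ζ + star ζ = 2 * (ζ.re : ℂ) := by
    have := Complex.add_conj ζ
    push_cast at this
    exact this
  have hroot : ∀ i, ((X : Matrix (Fin 3) (Fin 3) ℂ)
      - ev ζ i • (1 : Matrix (Fin 3) (Fin 3) ℂ)).det = 0 := by
    intro i
    have hst : star (1 + 2 * (ζ.re : ℂ)) = 1 + 2 * (ζ.re : ℂ) := by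
      simp
    rw [det_smul_one_sub, adjugate_SU, trace_conjTranspose, htr, hst, (mem_SU_iff.1 X.2).2, ← hre]
    fin_cases i
    · change 1 - _ * (1 : ℂ) + _ * (1 : ℂ) ^ 2 - (1 : ℂ) ^ 3 = 0
      ring
    · change 1 - _ * ζ + _ * ζ ^ 2 - ζ ^ 3 = 0
      linear_combination (ζ - 1) * hζ
    · change 1 - _ * star ζ + _ * star ζ ^ 2 - star ζ ^ 3 = 0
      linear_combination (star ζ - 1) * hζ
  have hvec : ∀ i, ∃ v : Fin 3 → ℂ, star v ⬝ᵥ v = 1 ∧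
      (X : Matrix (Fin 3) (Fin 3) ℂ) *ᵥ v = ev ζ i • v := by
    intro i
    obtain ⟨v, hv0, hv⟩ := exists_mulVec_eq_zero_iff.2 (hroot i)
    obtain ⟨t, ht⟩ := exists_unit_smul hv0
    refine ⟨t • v, ht, ?_⟩
    rw [sub_mulVec, smul_mulVec, one_mulVec, sub_eq_zero] at hv
    rw [mulVec_smul, hv, smul_comm]
  choose v hv1 hv using hvec
  have hortho : ∀ i j, star (v i) ⬝ᵥ v j = if i = j then 1 else 0 := by
    intro i j
    split_ifs with hij
    · rw [← hij, hv1]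
    · have h1 := star_dotProduct_mulVec_SU X (v i) (v j)
      rw [hv, hv, star_smul, smul_dotProduct, dotProduct_smul, smul_eq_mul, smul_eq_mul] at h1
      by_contra hne
      have h2 : star (ev ζ i) * ev ζ j = 1 := by
        refine mul_right_cancel₀ hne ?_
        rw [mul_assoc, h1, one_mul]
      refine ev_ne him hij ?_
      calc ev ζ i = ev ζ i * (star (ev ζ i) * ev ζ j) := by rw [h2, mul_one]
        _ = (star (ev ζ i) * ev ζ i) * ev ζ j := by ring
        _ = ev ζ j := by rw [star_ev_mul_ev hζ, one_mul]
  have hV := exists_unitary_of_orthonormal hortho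
  refine ⟨Matrix.of fun i j => v j i, hV, ?_⟩
  have hXV : (X : Matrix (Fin 3) (Fin 3) ℂ) * (Matrix.of fun i j => v j i)
      = (Matrix.of fun i j => v j i) * dg ζ := by
    ext i j
    rw [dg, mul_diagonal]
    have := congrFun (hv j) i
    rw [Pi.smul_apply, smul_eq_mul, mul_comm] at this
    exact this
  rw [← hXV, mul_assoc, _root_.mul_eq_one_comm.1 hV, mul_one]

/-- Squared moduli of the inner products of the eigenvectors of two matrices. -/
def modSq (ζ ξ : ℂ) (i j : Fin 3) (X Y : Matrix (Fin 3) (Fin 3) ℂ) : ℝ :=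
  (trace (proj ζ i X * proj ξ j Y)).re

/-- The Bargmann invariant of two pairs of eigenvectors of two matrices. -/
def bargmann (ζ ξ : ℂ) (X Y : Matrix (Fin 3) (Fin 3) ℂ) : ℝ :=
  (trace (proj ζ 0 X * proj ξ 0 Y * proj ζ 1 X * proj ξ 1 Y)).im

theorem modSq_conj (ζ ξ : ℂ) (i j : Fin 3) (X Y g : Matrix (Fin 3) (Fin 3) ℂ)
    (hg : gᴴ * g = 1) :
    modSq ζ ξ i j (g * X * gᴴ) (g * Y * gᴴ) = modSq ζ ξ i j X Y := by
  rw [modSq, modSq, proj_conj _ _ _ _ hg, proj_conj _ _ _ _ hg, mul_assoc _ gᴴ,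
    ← mul_assoc gᴴ, ← mul_assoc gᴴ, hg, one_mul, ← mul_assoc, trace_mul_comm, ← mul_assoc,
    ← mul_assoc, hg, one_mul]

theorem bargmann_conj (ζ ξ : ℂ) (X Y g : Matrix (Fin 3) (Fin 3) ℂ)
    (hg : gᴴ * g = 1) :
    bargmann ζ ξ (g * X * gᴴ) (g * Y * gᴴ) = bargmann ζ ξ X Y := by
  have e : ∀ A B : Matrix (Fin 3) (Fin 3) ℂ, g * A * gᴴ * (g * B * gᴴ) = g * (A * B) * gᴴ := by
    intro A B
    rw [mul_assoc _ gᴴ, ← mul_assoc gᴴ, ← mul_assoc gᴴ, hg, one_mul]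
    simp only [mul_assoc]
  rw [bargmann, bargmann, proj_conj _ _ _ _ hg, proj_conj _ _ _ _ hg, proj_conj _ _ _ _ hg,
    proj_conj _ _ _ _ hg, e, e, e, trace_mul_comm, ← mul_assoc, hg, one_mul]

variable {ζ ξ : ℂ} {V W : Matrix (Fin 3) (Fin 3) ℂ}

theorem star_col_dotProduct_col (i j : Fin 3) :
    star (V.col i) ⬝ᵥ W.col j = (Vᴴ * W) i j := rfl

theorem modSq_eq (hζ : ζ.im ≠ 0) (hξ : ξ.im ≠ 0) (hV : Vᴴ * V = 1) (hW : Wᴴ * W = 1)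
    (i j : Fin 3) :
    modSq ζ ξ i j (V * dg ζ * Vᴴ) (W * dg ξ * Wᴴ) = Complex.normSq ((Vᴴ * W) i j) := by
  rw [modSq, proj_eq hζ i hV, proj_eq hξ j hW, vecMulVec_mul_vecMulVec, trace_vecMulVec,
    dotProduct_smul, star_col_dotProduct_col]
  have : V.col i ⬝ᵥ star (W.col j) = star ((Vᴴ * W) i j) := by
    rw [← star_col_dotProduct_col, star_dotProduct, star_star, dotProduct_comm]
  rw [this, smul_eq_mul, RCLike.star_def, Complex.mul_conj, Complex.ofReal_re]

theorem bargmann_eq (hζ : ζ.im ≠ 0) (hξ : ξ.im ≠ 0) (hV : Vᴴ * V = 1) (hW : Wᴴ * W = 1) :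
    bargmann ζ ξ (V * dg ζ * Vᴴ) (W * dg ξ * Wᴴ)
      = ((Vᴴ * W) 0 0 * star ((Vᴴ * W) 1 0) * ((Vᴴ * W) 1 1 * star ((Vᴴ * W) 0 1))).im := by
  have e : ∀ i j, star (W.col j) ⬝ᵥ V.col i = star ((Vᴴ * W) i j) := by
    intro i j
    rw [← star_col_dotProduct_col, star_dotProduct]
  rw [bargmann, proj_eq hζ 0 hV, proj_eq hζ 1 hV, proj_eq hξ 0 hW, proj_eq hξ 1 hW,
    vecMulVec_mul_vecMulVec, vecMulVec_mul_vecMulVec, vecMulVec_mul_vecMulVec, trace_vecMulVec]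
  simp only [smul_dotProduct, dotProduct_smul, star_col_dotProduct_col, e, smul_eq_mul]
  rw [dotProduct_comm, e]
  congr 1
  ring

theorem trace_mul_eq (U : Matrix (Fin 3) (Fin 3) ℂ) :
    (dg ζ * (U * dg ξ * Uᴴ)).trace
      = ∑ i, ∑ j, ev ζ i * ev ξ j * (Complex.normSq (U i j) : ℂ) := by
  rw [trace]
  refine Finset.sum_congr rfl fun i _ => ?_
  rw [diag_apply, dg, diagonal_mul, mul_apply, Finset.mul_sum]
  refine Finset.sum_congr rfl fun j _ => ?_
  rw [dg, mul_diagonal, conjTranspose_apply, ← Complex.mul_conj]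
  change _ = _ * (U i j * star (U i j))
  ring

theorem trace_conj_mul_conj :
    (V * dg ζ * Vᴴ * (W * dg ξ * Wᴴ)).trace
      = ∑ i, ∑ j, ev ζ i * ev ξ j * (Complex.normSq ((Vᴴ * W) i j) : ℂ) := by
  rw [← trace_mul_eq, mul_assoc V, mul_assoc V, trace_mul_comm]
  simp only [conjTranspose_mul, conjTranspose_conjTranspose, mul_assoc]

/-- Two pairs of matrices whose eigenvectors have the same inner products, up to phases, are
conjugate. -/
theorem exists_conj_of_phases {X Y X' Y' : SU3} {V' W' : Matrix (Fin 3) (Fin 3) ℂ}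
    (hV : Vᴴ * V = 1) (hV' : V'ᴴ * V' = 1)
    (hX : (X : Matrix (Fin 3) (Fin 3) ℂ) = V * dg ζ * Vᴴ)
    (hY : (Y : Matrix (Fin 3) (Fin 3) ℂ) = W * dg ξ * Wᴴ)
    (hX' : (X' : Matrix (Fin 3) (Fin 3) ℂ) = V' * dg ζ * V'ᴴ)
    (hY' : (Y' : Matrix (Fin 3) (Fin 3) ℂ) = W' * dg ξ * W'ᴴ)
    {S T : Fin 3 → ℂ} (hS : ∀ i, star (S i) * S i = 1) (hT : ∀ i, star (T i) * T i = 1)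
    (hU : ∀ i j, (V'ᴴ * W') i j = S i * (Vᴴ * W) i j * T j) :
    ∃ g : SU3, X' = g * X * g⁻¹ ∧ Y' = g * Y * g⁻¹ := by
  have hS' : (diagonal S)ᴴ * diagonal S = 1 := by
    rw [diagonal_conjTranspose, diagonal_mul_diagonal, ← diagonal_one]
    congr 1
    funext i
    exact hS i
  have hT' : diagonal T * (diagonal T)ᴴ = 1 := by
    rw [diagonal_conjTranspose, diagonal_mul_diagonal, ← diagonal_one]
    congr 1
    funext i
    rw [mul_comm]
    exact hT i
  have hcomm : ∀ (d : Fin 3 → ℂ) (ζ : ℂ), diagonal d * dg ζ = dg ζ * diagonal d := by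
    intro d ζ
    rw [dg, diagonal_mul_diagonal, diagonal_mul_diagonal]
    congr 1
    funext i
    exact mul_comm _ _
  have hU' : V'ᴴ * W' = diagonal S * (Vᴴ * W) * diagonal T := by
    ext i j
    rw [hU, mul_diagonal, diagonal_mul]
  set G : Matrix (Fin 3) (Fin 3) ℂ := V' * diagonal S * Vᴴ with hG
  have hGV : G * V = V' * diagonal S := by
    rw [hG, mul_assoc, hV, mul_one]
  have hGW : G * W * diagonal T = W' := by
    calc G * W * diagonal T = V' * (diagonal S * (Vᴴ * W) * diagonal T) := by
          rw [hG]; simp only [mul_assoc]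
      _ = (V' * V'ᴴ) * W' := by rw [← hU', mul_assoc]
      _ = W' := by rw [_root_.mul_eq_one_comm.1 hV', one_mul]
  have hGG : Gᴴ * G = 1 := by
    calc Gᴴ * G = V * ((diagonal S)ᴴ * (V'ᴴ * V') * diagonal S) * Vᴴ := by
          rw [hG]
          simp only [conjTranspose_mul, conjTranspose_conjTranspose, mul_assoc]
      _ = 1 := by
          rw [hV', mul_one, hS', mul_one, _root_.mul_eq_one_comm.1 hV]
  have hGX : G * X * Gᴴ = X' := by
    calc G * X * Gᴴ = (G * V) * dg ζ * (G * V)ᴴ := by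
          rw [hX]
          simp only [conjTranspose_mul, mul_assoc]
      _ = V' * (diagonal S * dg ζ * (diagonal S)ᴴ) * V'ᴴ := by
          rw [hGV]
          simp only [conjTranspose_mul, mul_assoc]
      _ = X' := by
          rw [hcomm, mul_assoc (dg ζ), _root_.mul_eq_one_comm.1 hS', mul_one, hX']
  have hGY : G * Y * Gᴴ = Y' := by
    symm
    calc (Y' : Matrix (Fin 3) (Fin 3) ℂ)
        = (G * W) * (diagonal T * dg ξ * (diagonal T)ᴴ) * (G * W)ᴴ := by
          rw [hY', ← hGW]
          simp only [conjTranspose_mul, mul_assoc]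
      _ = (G * W) * dg ξ * (G * W)ᴴ := by
          rw [hcomm, mul_assoc (dg ξ), hT', mul_one]
      _ = G * Y * Gᴴ := by
          rw [hY]
          simp only [conjTranspose_mul, mul_assoc]
  -- rescale the unitary matrix `G` by a cube root of the inverse of its determinant
  have hdet : star G.det * G.det = 1 := by
    rw [← det_conjTranspose, ← det_mul, hGG, det_one]
  obtain ⟨u, hu⟩ := IsAlgClosed.exists_pow_nat_eq (star G.det) (n := 3) (by norm_num)
  have hdet0 : G.det ≠ 0 := by
    rintro h
    rw [h, mul_zero] at hdet
    exact zero_ne_one hdet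
  have huu : star u * u = 1 := by
    have h1 : (star u * u) ^ 3 = 1 := by
      rw [mul_pow, ← star_pow, hu, star_star, mul_comm]
      exact hdet
    have h2 : star u * u = ((Complex.normSq u : ℝ) : ℂ) := by
      rw [mul_comm]
      exact Complex.mul_conj u
    rw [h2] at h1 ⊢
    have h3 : Complex.normSq u ^ 3 = 1 := by exact_mod_cast h1
    rw [(pow_eq_one_iff_of_nonneg (Complex.normSq_nonneg u) (by norm_num)).1 h3,
      Complex.ofReal_one]
  have hmem : u • G ∈ specialUnitaryGroup (Fin 3) ℂ := by
    rw [mem_SU_iff]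
    constructor
    · rw [conjTranspose_smul, smul_mul_smul_comm, _root_.mul_eq_one_comm.1 hGG, mul_comm, huu,
        one_smul]
    · rw [det_smul, Fintype.card_fin, hu, hdet]
  have hconj : ∀ A : SU3, ((⟨u • G, hmem⟩ * A * (⟨u • G, hmem⟩ : SU3)⁻¹ : SU3) :
      Matrix (Fin 3) (Fin 3) ℂ) = G * A * Gᴴ := by
    intro A
    rw [Submonoid.coe_mul, Submonoid.coe_mul, coe_inv_SU]
    change u • G * (A : Matrix (Fin 3) (Fin 3) ℂ) * (u • G)ᴴ = _
    rw [conjTranspose_smul, smul_mul_assoc, smul_mul_smul_comm, mul_comm u, huu, one_smul]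
  exact ⟨⟨u • G, hmem⟩, Subtype.ext (by rw [hconj, hGX]), Subtype.ext (by rw [hconj, hGY])⟩

end Spectral

/-! ### Unitary matrices up to phases -/

section Phases

theorem sum_three_eq {M : Type*} [AddCommMonoid M] (f : Fin 3 → M) {i k m : Fin 3} (hik : i ≠ k)
    (him : i ≠ m) (hkm : k ≠ m) : f i + f k + f m = f 0 + f 1 + f 2 := by
  have h : (Finset.univ : Finset (Fin 3)) = {i, k, m} := by
    revert i k m
    decide
  rw [← Fin.sum_univ_three, h, Finset.sum_insert, Finset.sum_insert, Finset.sum_singleton,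
    add_assoc]
  · simpa using hkm
  · simp [hik, him]

variable {U U' : Matrix (Fin 3) (Fin 3) ℂ}

theorem unitary_row (hU : Uᴴ * U = 1) (i k : Fin 3) :
    U i 0 * star (U k 0) + U i 1 * star (U k 1) + U i 2 * star (U k 2)
      = if i = k then 1 else 0 := by
  have h := _root_.mul_eq_one_comm.1 hU
  have := congrFun (congrFun h i) k
  rwa [mul_apply, Fin.sum_univ_three, one_apply] at this

theorem unitary_col (hU : Uᴴ * U = 1) (j l : Fin 3) :
    star (U 0 j) * U 0 l + star (U 1 j) * U 1 l + star (U 2 j) * U 2 l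
      = if j = l then 1 else 0 := by
  have := congrFun (congrFun hU j) l
  rwa [mul_apply, Fin.sum_univ_three, one_apply] at this

theorem normSq_row (hU : Uᴴ * U = 1) (i : Fin 3) :
    Complex.normSq (U i 0) + Complex.normSq (U i 1) + Complex.normSq (U i 2) = 1 := by
  have := unitary_row hU i i
  simp only [RCLike.star_def, Complex.mul_conj, if_true] at this
  exact_mod_cast this

theorem normSq_col (hU : Uᴴ * U = 1) (j : Fin 3) :
    Complex.normSq (U 0 j) + Complex.normSq (U 1 j) + Complex.normSq (U 2 j) = 1 := by
  have := unitary_col hU j j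
  simp only [RCLike.star_def, ← Complex.normSq_eq_conj_mul_self, if_true] at this
  exact_mod_cast this

/-- Two triangles with equal sides and equal orientation are congruent. -/
theorem mul_star_eq_of_triangle {z w : Fin 3 → ℂ} (hz : z 0 + z 1 + z 2 = 0)
    (hw : w 0 + w 1 + w 2 = 0) (hn : ∀ j, Complex.normSq (z j) = Complex.normSq (w j))
    (hJ : (z 0 * star (z 1)).im = (w 0 * star (w 1)).im) (j l : Fin 3) :
    z j * star (z l) = w j * star (w l) := by
  have hz2 : z 2 = -(z 0) - z 1 := by linear_combination hz
  have hw2 : w 2 = -(w 0) - w 1 := by linear_combination hw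
  have hself : ∀ j, z j * star (z j) = w j * star (w j) := by
    intro j
    simp only [RCLike.star_def, Complex.mul_conj, hn]
  have h01 : z 0 * star (z 1) = w 0 * star (w 1) := by
    refine Complex.ext ?_ hJ
    have h2 := hn 2
    have h1 := hn 1
    have h0 := hn 0
    rw [hz2, hw2] at h2
    simp only [Complex.normSq_apply, Complex.sub_re, Complex.neg_re, Complex.sub_im,
      Complex.neg_im] at h0 h1 h2
    simp only [RCLike.star_def, Complex.mul_re, Complex.conj_re, Complex.conj_im]
    linarith
  have h10 : z 1 * star (z 0) = w 1 * star (w 0) := by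
    have := congrArg star h01
    simpa [mul_comm] using this
  have h00 := hself 0
  have h11 := hself 1
  fin_cases j <;> fin_cases l <;>
    simp only [Fin.zero_eta, Fin.mk_one, Fin.reduceFinMk, hz2, hw2, star_sub, star_neg]
  · exact h00
  · exact h01
  · linear_combination -h00 - h01
  · exact h10
  · exact h11
  · linear_combination -h10 - h11
  · linear_combination -h00 - h10
  · linear_combination -h01 - h11
  · linear_combination h00 + h01 + h10 + h11

/-- Vectors with the same Hermitian products of entries differ by a phase. -/
theorem exists_phase {z w : Fin 3 → ℂ} (h : ∀ j l, z j * star (z l) = w j * star (w l)) :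
    ∃ s : ℂ, star s * s = 1 ∧ ∀ j, w j = s * z j := by
  by_cases hz : ∀ j, z j = 0
  · refine ⟨1, by simp, fun j => ?_⟩
    have := h j j
    rw [hz j, zero_mul, eq_comm, mul_eq_zero, star_eq_zero, or_self] at this
    rw [this, hz j, mul_zero]
  · push Not at hz
    obtain ⟨k, hk⟩ := hz
    have hk' : star (z k) ≠ 0 := star_ne_zero.2 hk
    have hw : w k ≠ 0 := by
      intro h0
      have := h k k
      rw [h0, zero_mul] at this
      exact mul_ne_zero hk hk' this
    have hw' : star (w k) ≠ 0 := star_ne_zero.2 hw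
    refine ⟨w k / z k, ?_, fun j => ?_⟩
    · rw [star_div₀]
      field_simp
      linear_combination -h k k
    · have h1 := h j k
      have h2 := h k k
      field_simp
      refine mul_right_cancel₀ (mul_ne_zero hk' hw') ?_
      linear_combination z k * star (z k) * (-h1) + z j * star (z k) * h2

/-- The oriented area of the orthogonality triangle of the rows `i` and `k`, whose sides are
`U i j * star (U k j)`, up to a factor `2`. -/
def rowArea (U : Matrix (Fin 3) (Fin 3) ℂ) (i k : Fin 3) : ℝ :=
  (U i 0 * star (U k 0) * (U k 1 * star (U i 1))).im

theorem rowArea_swap (i k : Fin 3) : rowArea U k i = -rowArea U i k := by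
  have : U k 0 * star (U i 0) * (U i 1 * star (U k 1))
      = star (U i 0 * star (U k 0) * (U k 1 * star (U i 1))) := by
    simp only [star_mul', star_star]
    ring
  rw [rowArea, this, rowArea, RCLike.star_def, Complex.conj_im]

theorem rowArea_sum (hU : Uᴴ * U = 1) (i : Fin 3) :
    rowArea U i 0 + rowArea U i 1 + rowArea U i 2 = 0 := by
  have h := unitary_col hU 0 1
  rw [if_neg (by decide)] at h
  simp only [rowArea, ← Complex.add_im]
  have : U i 0 * star (U 0 0) * (U 0 1 * star (U i 1)) + U i 0 * star (U 1 0) *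
      (U 1 1 * star (U i 1)) + U i 0 * star (U 2 0) * (U 2 1 * star (U i 1)) = 0 := by
    linear_combination U i 0 * star (U i 1) * h
  rw [this, Complex.zero_im]

/-- All oriented areas are determined by one of them: they form a skew-symmetric matrix with
vanishing row sums. -/
theorem rowArea_eq (hU : Uᴴ * U = 1) (hU' : U'ᴴ * U' = 1)
    (h : rowArea U 0 1 = rowArea U' 0 1) (i k : Fin 3) : rowArea U i k = rowArea U' i k := by
  have a0 := rowArea_sum hU 0
  have a1 := rowArea_sum hU 1
  have b0 := rowArea_sum hU' 0
  have b1 := rowArea_sum hU' 1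
  have s := fun i k => rowArea_swap (U := U) i k
  have s' := fun i k => rowArea_swap (U := U') i k
  have := s 0 0; have := s 1 1; have := s 2 2; have := s 0 1; have := s 0 2; have := s 1 2
  have := s' 0 0; have := s' 1 1; have := s' 2 2; have := s' 0 1; have := s' 0 2; have := s' 1 2
  fin_cases i <;> fin_cases k <;> simp only [Fin.zero_eta, Fin.mk_one, Fin.reduceFinMk] <;>
    linarith

/-- The orthogonality triangles of two rows are congruent, hence equal up to a rotation. -/
theorem exists_row_phase (hU : Uᴴ * U = 1) (hU' : U'ᴴ * U' = 1)
    (hn : ∀ i j, Complex.normSq (U i j) = Complex.normSq (U' i j))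
    (hJ : rowArea U 0 1 = rowArea U' 0 1)
    {i k : Fin 3} (hik : i ≠ k) :
    ∃ s : ℂ, star s * s = 1 ∧ ∀ j, U' i j * star (U' k j) = s * (U i j * star (U k j)) := by
  refine exists_phase (mul_star_eq_of_triangle (z := fun j => U i j * star (U k j))
    (w := fun j => U' i j * star (U' k j)) ?_ ?_ ?_ ?_)
  · have := unitary_row hU i k
    rwa [if_neg hik] at this
  · have := unitary_row hU' i k
    rwa [if_neg hik] at this
  · intro j
    simp only [Complex.normSq_mul, RCLike.star_def, Complex.normSq_conj, hn]
  · have h := rowArea_eq hU hU' hJ i k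
    simp only [rowArea] at h
    simp only [star_mul', star_star]
    convert h using 2 <;> ring

theorem phase_entry {u v u' v' s : ℂ} (hu : u ≠ 0) (hn : Complex.normSq u = Complex.normSq u')
    (h : u' * star v' = s * (u * star v)) : v' = star s * v * (u' / u) := by
  have hu' : star u ≠ 0 := star_ne_zero.2 hu
  have h1 : u' * star u' = u * star u := by
    simp only [RCLike.star_def, Complex.mul_conj, hn]
  have h2 : star u' * v' = star s * (star u * v) := by
    have := congrArg star h
    simpa only [star_mul', star_star] using this
  field_simp
  refine mul_right_cancel₀ hu' ?_
  linear_combination u' * h2 - v' * h1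

theorem star_div_mul_div {u u' : ℂ} (hu : u ≠ 0) (hn : Complex.normSq u = Complex.normSq u') :
    star (u' / u) * (u' / u) = 1 := by
  have hu' : star u ≠ 0 := star_ne_zero.2 hu
  have h1 : u' * star u' = u * star u := by
    simp only [RCLike.star_def, Complex.mul_conj, hn]
  rw [star_div₀]
  field_simp
  linear_combination h1

/-- A unitary matrix with a row without zeros is determined, up to phases, by the moduli of its
entries and one oriented area. -/
theorem exists_phases_of_row (hU : Uᴴ * U = 1) (hU' : U'ᴴ * U' = 1)
    (hn : ∀ i j, Complex.normSq (U i j) = Complex.normSq (U' i j))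
    (hJ : rowArea U 0 1 = rowArea U' 0 1)
    {i : Fin 3} (hi : ∀ j, U i j ≠ 0) :
    ∃ S T : Fin 3 → ℂ, (∀ i, star (S i) * S i = 1) ∧ (∀ j, star (T j) * T j = 1) ∧
      ∀ k j, U' k j = S k * U k j * T j := by
  have h : ∀ k, ∃ s : ℂ, star s * s = 1 ∧ ∀ j, U' k j = s * U k j * (U' i j / U i j) := by
    intro k
    by_cases hik : i = k
    · subst hik
      refine ⟨1, by simp, fun j => ?_⟩
      have := hi j
      field_simp
    · obtain ⟨s, hs, h⟩ := exists_row_phase hU hU' hn hJ hik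
      refine ⟨star s, by rw [star_star, mul_comm]; exact hs, fun j => ?_⟩
      exact phase_entry (hi j) (hn i j) (h j)
  choose S hS hSU using h
  exact ⟨S, fun j => U' i j / U i j, hS, fun j => star_div_mul_div (hi j) (hn i j), hSU⟩

/-- The same for a unitary block matrix with a `2 × 2` block without zeros. -/
theorem exists_phases_of_block (hU : Uᴴ * U = 1) (hU' : U'ᴴ * U' = 1)
    (hn : ∀ i j, Complex.normSq (U i j) = Complex.normSq (U' i j))
    (hJ : rowArea U 0 1 = rowArea U' 0 1)
    (h00 : Complex.normSq (U 0 0) = 1) (h11 : U 1 1 ≠ 0)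
    (h12 : U 1 2 ≠ 0) :
    ∃ S T : Fin 3 → ℂ, (∀ i, star (S i) * S i = 1) ∧ (∀ j, star (T j) * T j = 1) ∧
      ∀ k j, U' k j = S k * U k j * T j := by
  obtain ⟨s, hs, h⟩ := exists_row_phase hU hU' hn hJ (i := 1) (k := 2) (by decide)
  have hz : ∀ M : Matrix (Fin 3) (Fin 3) ℂ, Mᴴ * M = 1 → Complex.normSq (M 0 0) = 1 →
      M 0 1 = 0 ∧ M 0 2 = 0 ∧ M 1 0 = 0 ∧ M 2 0 = 0 := by
    intro M hM h00
    have hr := normSq_row hM 0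
    have hc := normSq_col hM 0
    have n1 := Complex.normSq_nonneg (M 0 1)
    have n2 := Complex.normSq_nonneg (M 0 2)
    have n3 := Complex.normSq_nonneg (M 1 0)
    have n4 := Complex.normSq_nonneg (M 2 0)
    refine ⟨?_, ?_, ?_, ?_⟩ <;> refine Complex.normSq_eq_zero.1 ?_ <;> linarith
  obtain ⟨u01, u02, u10, u20⟩ := hz U hU h00
  obtain ⟨v01, v02, v10, v20⟩ := hz U' hU' (by rw [← hn, h00])
  have hne : U 0 0 ≠ 0 := by
    intro h0
    rw [h0, map_zero] at h00
    exact zero_ne_one h00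
  refine ⟨![1, 1, star s], ![U' 0 0 / U 0 0, U' 1 1 / U 1 1, U' 1 2 / U 1 2], ?_, ?_, ?_⟩
  · intro i
    fin_cases i
    · simp
    · simp
    · change star (star s) * star s = 1
      rw [star_star, mul_comm]
      exact hs
  · intro j
    fin_cases j
    · exact star_div_mul_div hne (hn _ _)
    · exact star_div_mul_div h11 (hn _ _)
    · exact star_div_mul_div h12 (hn _ _)
  · intro k j
    fin_cases k <;> fin_cases j
    · change U' 0 0 = 1 * U 0 0 * (U' 0 0 / U 0 0)
      field_simp
    · change U' 0 1 = 1 * U 0 1 * _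
      rw [u01, v01]; simp
    · change U' 0 2 = 1 * U 0 2 * _
      rw [u02, v02]; simp
    · change U' 1 0 = 1 * U 1 0 * _
      rw [u10, v10]; simp
    · change U' 1 1 = 1 * U 1 1 * (U' 1 1 / U 1 1)
      field_simp
    · change U' 1 2 = 1 * U 1 2 * (U' 1 2 / U 1 2)
      field_simp
    · change U' 2 0 = star s * U 2 0 * _
      rw [u20, v20]; simp
    · exact phase_entry h11 (hn _ _) (h 1)
    · exact phase_entry h12 (hn _ _) (h 2)

theorem normSq_eq_one_of_col (hU : Uᴴ * U = 1) {i k m j : Fin 3} (hik : i ≠ k) (him : i ≠ m)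
    (hkm : k ≠ m) (hi : U i j = 0) (hk : U k j = 0) : Complex.normSq (U m j) = 1 := by
  have h := normSq_col hU j
  have hsum : Complex.normSq (U i j) + Complex.normSq (U k j) + Complex.normSq (U m j) = 1 :=
    (sum_three_eq (fun i => Complex.normSq (U i j)) hik him hkm).trans h
  rwa [hi, hk, map_zero, zero_add, zero_add] at hsum

/-- If every row of a unitary `3 × 3` matrix has a zero, some entry has modulus `1`. -/
theorem exists_normSq_eq_one (hU : Uᴴ * U = 1) (h : ∀ i, ∃ j, U i j = 0) :
    ∃ i j, Complex.normSq (U i j) = 1 := by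
  choose f hf using h
  by_cases h01 : f 0 = f 1
  · exact ⟨2, f 0, normSq_eq_one_of_col hU (i := 0) (k := 1) (by decide) (by decide) (by decide)
      (hf 0) (h01 ▸ hf 1)⟩
  by_cases h02 : f 0 = f 2
  · exact ⟨1, f 0, normSq_eq_one_of_col hU (i := 0) (k := 2) (by decide) (by decide) (by decide)
      (hf 0) (h02 ▸ hf 2)⟩
  by_cases h12 : f 1 = f 2
  · exact ⟨0, f 1, normSq_eq_one_of_col hU (i := 1) (k := 2) (by decide) (by decide) (by decide)
      (hf 1) (h12 ▸ hf 2)⟩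
  -- the zeros lie in different columns, and the product of two rows has a single nonzero term
  have h := unitary_row hU 0 1
  rw [if_neg (by decide)] at h
  have hsum : U 0 (f 0) * star (U 1 (f 0)) + U 0 (f 1) * star (U 1 (f 1))
      + U 0 (f 2) * star (U 1 (f 2)) = 0 :=
    (sum_three_eq (fun j => U 0 j * star (U 1 j)) h01 h02 h12).trans h
  rw [hf 0, hf 1, zero_mul, star_zero, mul_zero, zero_add, zero_add, mul_eq_zero,
    star_eq_zero] at hsum
  rcases hsum with h0 | h0
  · exact ⟨1, f 2, normSq_eq_one_of_col hU (i := 0) (k := 2) (by decide) (by decide) (by decide)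
      h0 (hf 2)⟩
  · exact ⟨0, f 2, normSq_eq_one_of_col hU (i := 1) (k := 2) (by decide) (by decide) (by decide)
      h0 (hf 2)⟩

end Phases

/-! ### Moduli of pairs of matrices -/

section Moduli

/-- `ζ` lies in the open upper half of the unit circle. -/
structure IsAngle (ζ : ℂ) : Prop where
  unit : star ζ * ζ = 1
  im_pos : 0 < ζ.im

variable {ζ ξ ω : ℂ}

theorem IsAngle.sq_add_sq (h : IsAngle ζ) : ζ.re ^ 2 + ζ.im ^ 2 = 1 := by
  have h1 := h.unit
  rw [RCLike.star_def, ← Complex.normSq_eq_conj_mul_self, Complex.normSq_apply] at h1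
  have h2 : ζ.re * ζ.re + ζ.im * ζ.im = 1 := by exact_mod_cast h1
  linarith

theorem IsAngle.re_lt (h : IsAngle ζ) : 0 < 1 - ζ.re := by
  nlinarith [h.sq_add_sq, mul_pos h.im_pos h.im_pos]

theorem IsAngle.im_ne (h : IsAngle ζ) : ζ.im ≠ 0 := h.im_pos.ne'

/-- The factor `λ²` by which the two deviations `rowDev = λ t` and `colDev = -t / λ` differ, up to
sign. It is forced by the vanishing of the imaginary part of the trace of the product. -/
def ratio (ζ ξ : ℂ) : ℝ := ζ.im * (1 - ξ.re) / (ξ.im * (1 - ζ.re))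

/-- The slope of the line on which the symmetric part of the matrix of squared moduli varies. -/
def slopeCoeff (ζ ξ : ℂ) : ℝ := (1 - ζ.re) * (1 - ξ.re) / (ζ.im * ξ.im)

/-- For a pair of matrices in `SU(2)`, the cosine of the angle between their rotation axes. -/
def offset (ζ ξ ω : ℂ) : ℝ := (ζ.re * ξ.re - ω.re) / (ζ.im * ξ.im)

theorem ratio_pos (h : IsAngle ζ) (h' : IsAngle ξ) : 0 < ratio ζ ξ :=
  div_pos (mul_pos h.im_pos h'.re_lt) (mul_pos h'.im_pos h.re_lt)

theorem slopeCoeff_pos (h : IsAngle ζ) (h' : IsAngle ξ) : 0 < slopeCoeff ζ ξ :=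
  div_pos (mul_pos h.re_lt h'.re_lt) (mul_pos h.im_pos h'.im_pos)

/-- The deviation of the two outer entries of the first row of a doubly stochastic matrix from
their mean. The square root makes the coordinate `t` symmetric in rows and columns. -/
def rowDev (ζ ξ : ℂ) (t : ℝ) : ℝ := Real.sqrt (ratio ζ ξ) * t

/-- The deviation of the two outer entries of the first column from their mean. -/
def colDev (ζ ξ : ℂ) (t : ℝ) : ℝ := -(t / Real.sqrt (ratio ζ ξ))

theorem rowDev_mul_colDev (h : IsAngle ζ) (h' : IsAngle ξ) (t : ℝ) :
    rowDev ζ ξ t * colDev ζ ξ t = -t ^ 2 := by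
  have := (Real.sqrt_pos.2 (ratio_pos h h')).ne'
  rw [rowDev, colDev]
  field_simp

theorem rowDev_sq (h : IsAngle ζ) (h' : IsAngle ξ) (t : ℝ) :
    rowDev ζ ξ t ^ 2 = ratio ζ ξ * t ^ 2 := by
  rw [rowDev, mul_pow, Real.sq_sqrt (ratio_pos h h').le]

theorem colDev_sq (h : IsAngle ζ) (h' : IsAngle ξ) (t : ℝ) :
    colDev ζ ξ t ^ 2 = (ratio ζ ξ)⁻¹ * t ^ 2 := by
  rw [colDev, neg_sq, div_pow, Real.sq_sqrt (ratio_pos h h').le]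
  ring

theorem dev_relation (h : IsAngle ζ) (h' : IsAngle ξ) (t : ℝ) :
    rowDev ζ ξ t * (ξ.im * (1 - ζ.re)) + colDev ζ ξ t * (ζ.im * (1 - ξ.re)) = 0 := by
  have h0 := Real.sqrt_pos.2 (ratio_pos h h')
  have h1 := Real.sq_sqrt (ratio_pos h h').le
  have h2 : ζ.im * (1 - ξ.re) = ratio ζ ξ * (ξ.im * (1 - ζ.re)) := by
    rw [ratio, div_mul_cancel₀]
    exact (mul_pos h'.im_pos h.re_lt).ne'
  rw [h2, ← h1, rowDev, colDev]
  field_simp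
  ring

/-- A doubly stochastic matrix has four parameters, and the real and the imaginary part of the
prescribed trace leave two of them, `e` and `t`. -/
theorem entries_of_trace (h : IsAngle ζ) (h' : IsAngle ξ) {D : Fin 3 → Fin 3 → ℝ}
    (hrow : ∀ i, D i 0 + D i 1 + D i 2 = 1) (hcol : ∀ j, D 0 j + D 1 j + D 2 j = 1)
    (htr : ∑ i, ∑ j, ev ζ i * ev ξ j * (D i j : ℂ) = 1 + 2 * (ω.re : ℂ)) {e t : ℝ}
    (he : e = (1 - D 0 0) / 2) (ht : t = (D 0 1 - D 0 2) / (2 * Real.sqrt (ratio ζ ξ))) :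
    D 0 1 = e + rowDev ζ ξ t ∧ D 0 2 = e - rowDev ζ ξ t ∧ D 1 0 = e + colDev ζ ξ t ∧
      D 2 0 = e - colDev ζ ξ t ∧
      D 1 1 = (1 - e + slopeFn (slopeCoeff ζ ξ) (offset ζ ξ ω) e
        - rowDev ζ ξ t - colDev ζ ξ t) / 2 ∧
      D 1 2 = (1 - e - slopeFn (slopeCoeff ζ ξ) (offset ζ ξ ω) e
        + rowDev ζ ξ t - colDev ζ ξ t) / 2 := by
  have hs1 := h.im_pos
  have hs2 := h'.im_pos
  have hc1 := h.re_lt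
  have hc2 := h'.re_lt
  have hlam := Real.sqrt_pos.2 (ratio_pos h h')
  simp only [Fin.sum_univ_three, ev, cons_val_zero, cons_val_one, cons_val] at htr
  have him := congrArg Complex.im htr
  have hre := congrArg Complex.re htr
  simp only [RCLike.star_def, Complex.add_im, Complex.add_re, Complex.mul_im, Complex.mul_re,
    Complex.ofReal_re, Complex.ofReal_im, Complex.conj_re, Complex.conj_im, Complex.one_re,
    Complex.one_im, Complex.re_ofNat, Complex.im_ofNat] at him hre
  ring_nf at him hre
  have hf : rowDev ζ ξ t = (D 0 1 - D 0 2) / 2 := by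
    rw [rowDev, ht]
    field_simp
  have r0 := hrow 0
  have r1 := hrow 1
  have r2 := hrow 2
  have k0 := hcol 0
  have k1 := hcol 1
  have k2 := hcol 2
  have d11 : D 1 1 - D 2 2 = -((D 0 1 - D 0 2) / 2 + (D 1 0 - D 2 0) / 2) := by linarith
  have d12 : D 1 2 - D 2 1 = (D 0 1 - D 0 2) / 2 - (D 1 0 - D 2 0) / 2 := by linarith
  have hg : colDev ζ ξ t = (D 1 0 - D 2 0) / 2 := by
    have h1 := dev_relation h h' t
    rw [hf] at h1
    have h2 : ζ.im * (1 - ξ.re) ≠ 0 := (mul_pos hs1 hc2).ne'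
    refine mul_right_cancel₀ h2 ?_
    have e1 : (D 1 1 - D 2 2) * (ζ.re * ξ.im + ζ.im * ξ.re)
        + (D 1 2 - D 2 1) * (ζ.im * ξ.re - ζ.re * ξ.im) + (D 0 1 - D 0 2) * ξ.im
        + (D 1 0 - D 2 0) * ζ.im = 0 := by linarith
    rw [d11, d12] at e1
    linear_combination h1 - e1 / 2
  have hm : slopeFn (slopeCoeff ζ ξ) (offset ζ ξ ω) e * (ζ.im * ξ.im)
      = ζ.re * ξ.re - ω.re - (1 - ζ.re) * (1 - ξ.re) * e := by
    rw [slopeFn, slopeCoeff, offset]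
    field_simp
  have hm' : slopeFn (slopeCoeff ζ ξ) (offset ζ ξ ω) e = (D 1 1 + D 2 2) - 1 + e := by
    have h2 : ζ.im * ξ.im ≠ 0 := (mul_pos hs1 hs2).ne'
    refine mul_right_cancel₀ h2 ?_
    rw [hm]
    have e1 : D 0 0 + (D 0 1 + D 0 2) * ξ.re + (D 1 0 + D 2 0) * ζ.re
        + (D 1 1 + D 2 2) * (ζ.re * ξ.re - ζ.im * ξ.im)
        + (D 1 2 + D 2 1) * (ζ.re * ξ.re + ζ.im * ξ.im) = 1 + 2 * ω.re := by linarith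
    have e2 : D 0 0 = 1 - 2 * e := by linarith
    have e3 : D 0 1 + D 0 2 = 2 * e := by linarith
    have e4 : D 1 0 + D 2 0 = 2 * e := by linarith
    have e5 : D 1 2 + D 2 1 = 2 - 2 * e - (D 1 1 + D 2 2) := by linarith
    rw [e5, e4, e3, e2] at e1
    linear_combination e1 / 2
  rw [hf, hg, hm']
  refine ⟨?_, ?_, ?_, ?_, ?_, ?_⟩ <;> linarith

/-- Conversely, these entries satisfy the trace condition. -/
theorem trace_of_entries (h : IsAngle ζ) (h' : IsAngle ξ) {D : Fin 3 → Fin 3 → ℝ}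
    (hrow : ∀ i, D i 0 + D i 1 + D i 2 = 1) (hcol : ∀ j, D 0 j + D 1 j + D 2 j = 1) {e t : ℝ}
    (h01 : D 0 1 = e + rowDev ζ ξ t) (h02 : D 0 2 = e - rowDev ζ ξ t)
    (h10 : D 1 0 = e + colDev ζ ξ t)
    (h11 : D 1 1 = (1 - e + slopeFn (slopeCoeff ζ ξ) (offset ζ ξ ω) e
        - rowDev ζ ξ t - colDev ζ ξ t) / 2) :
    ∑ i, ∑ j, ev ζ i * ev ξ j * (D i j : ℂ) = 1 + 2 * (ω.re : ℂ) := by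
  have r0 := hrow 0
  have r1 := hrow 1
  have r2 := hrow 2
  have k0 := hcol 0
  have k1 := hcol 1
  have hm : slopeFn (slopeCoeff ζ ξ) (offset ζ ξ ω) e * (ζ.im * ξ.im)
      = ζ.re * ξ.re - ω.re - (1 - ζ.re) * (1 - ξ.re) * e := by
    have hs1 := h.im_pos
    have hs2 := h'.im_pos
    rw [slopeFn, slopeCoeff, offset]
    field_simp
  have hd := dev_relation h h' t
  set f := rowDev ζ ξ t
  set g := colDev ζ ξ t
  set m := slopeFn (slopeCoeff ζ ξ) (offset ζ ξ ω) e
  have e00 : D 0 0 = 1 - 2 * e := by linarith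
  have e20 : D 2 0 = e - g := by linarith
  have e12 : D 1 2 = (1 - e - m + f - g) / 2 := by linarith
  have e21 : D 2 1 = (1 - e - m - f + g) / 2 := by linarith
  have e22 : D 2 2 = (1 - e + m + f + g) / 2 := by linarith
  simp only [Fin.sum_univ_three, ev, cons_val_zero, cons_val_one, cons_val]
  rw [e00, h01, h02, h10, h11, e12, e20, e21, e22]
  apply Complex.ext
  · simp only [RCLike.star_def, Complex.add_re, Complex.mul_im, Complex.mul_re,
      Complex.ofReal_re, Complex.ofReal_im, Complex.conj_re, Complex.conj_im, Complex.one_re,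
      Complex.one_im, Complex.re_ofNat, Complex.im_ofNat]
    linear_combination -2 * hm
  · simp only [RCLike.star_def, Complex.add_im, Complex.mul_im, Complex.mul_re,
      Complex.ofReal_re, Complex.ofReal_im, Complex.conj_re, Complex.conj_im, Complex.one_re,
      Complex.one_im, Complex.re_ofNat, Complex.im_ofNat]
    linear_combination 2 * hd

/-- Heron's formula for the orthogonality triangle of the first two rows. -/
theorem heron_eq (h : IsAngle ζ) (h' : IsAngle ξ) {e t κ δ : ℝ} {d00 d01 d02 d10 d11 d12 : ℝ}
    {μ ν : ℝ} (hμν : μ + ν = ratio ζ ξ + (ratio ζ ξ)⁻¹)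
    (h00 : d00 = 1 - 2 * e) (h01 : d01 = e + rowDev ζ ξ t) (h02 : d02 = e - rowDev ζ ξ t)
    (h10 : d10 = e + colDev ζ ξ t)
    (h11 : d11 = (1 - e + slopeFn κ δ e - rowDev ζ ξ t - colDev ζ ξ t) / 2)
    (h12 : d12 = (1 - e - slopeFn κ δ e + rowDev ζ ξ t - colDev ζ ξ t) / 2) :
    4 * (d00 * d10) * (d01 * d11) - (d02 * d12 - d00 * d10 - d01 * d11) ^ 2
      = discFn μ ν κ δ e (t ^ 2) := by
  have e1 := rowDev_mul_colDev h h' t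
  have e2 : rowDev ζ ξ t ^ 2 + colDev ζ ξ t ^ 2 = (μ + ν) * t ^ 2 := by
    rw [rowDev_sq h h', colDev_sq h h', hμν]
    ring
  rw [discFn, linFn, axisFn, h00, h01, h02, h10, h11, h12]
  set f := rowDev ζ ξ t
  set g := colDev ζ ξ t
  set m := slopeFn κ δ e
  have hT : t ^ 2 = -(f * g) := by linarith
  have e3 : (μ + ν) * t ^ 2 = f ^ 2 + g ^ 2 := e2.symm
  calc _ = -(f * g) ^ 2 - (1 - 2 * e) * (f ^ 2 + g ^ 2) + 2 * (1 - e) * m * (f * g)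
        + e ^ 2 * (1 - 2 * e - m ^ 2) := by ring
    _ = _ := by
      rw [← e3, e1]
      ring

/-- Heron's formula. -/
theorem heron_of_sum_eq_zero {z0 z1 z2 : ℂ} (h : z0 + z1 + z2 = 0) :
    (2 * (z0 * star z1).im) ^ 2 = 4 * Complex.normSq z0 * Complex.normSq z1
      - (Complex.normSq z2 - Complex.normSq z0 - Complex.normSq z1) ^ 2 := by
  have h2 : z2 = -z0 - z1 := by linear_combination h
  subst h2
  simp only [RCLike.star_def, Complex.normSq_apply, Complex.mul_im, Complex.conj_re,
    Complex.conj_im, Complex.sub_re, Complex.sub_im, Complex.neg_re, Complex.neg_im]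
  ring

/-- The smaller parameter of the region. -/
def loRatio (ζ ξ : ℂ) : ℝ := min (ratio ζ ξ) (ratio ζ ξ)⁻¹

/-- The larger parameter of the region. -/
def hiRatio (ζ ξ : ℂ) : ℝ := max (ratio ζ ξ) (ratio ζ ξ)⁻¹

theorem loRatio_pos (h : IsAngle ζ) (h' : IsAngle ξ) : 0 < loRatio ζ ξ :=
  lt_min (ratio_pos h h') (inv_pos.2 (ratio_pos h h'))

theorem loRatio_le : loRatio ζ ξ ≤ hiRatio ζ ξ := min_le_max

theorem loRatio_mul (h : IsAngle ζ) (h' : IsAngle ξ) : loRatio ζ ξ * hiRatio ζ ξ = 1 := by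
  rw [loRatio, hiRatio, min_mul_max, mul_inv_cancel₀ (ratio_pos h h').ne']

theorem loRatio_add : loRatio ζ ξ + hiRatio ζ ξ = ratio ζ ξ + (ratio ζ ξ)⁻¹ := min_add_max _ _

theorem hiRatio_mul_le (h : IsAngle ζ) (h' : IsAngle ξ) {t b : ℝ} :
    hiRatio ζ ξ * t ^ 2 ≤ b ↔ rowDev ζ ξ t ^ 2 ≤ b ∧ colDev ζ ξ t ^ 2 ≤ b := by
  rw [rowDev_sq h h', colDev_sq h h', hiRatio, max_mul_of_nonneg _ _ (sq_nonneg t), max_le_iff]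

/-- The surface that parametrizes conjugacy classes of pairs `(X, Y)` such that `X`, `Y`, `X Y` have
eigenvalues `1, ζ, ζ̄` and so on. The discriminant is symmetric in `λ²` and `λ⁻²`, which are put in
order. -/
def surface (ζ ξ ω : ℂ) : Set (ℝ × ℝ × ℝ) :=
  {w | Adm (loRatio ζ ξ) (hiRatio ζ ξ) (slopeCoeff ζ ξ) (offset ζ ξ ω) w.1 (w.2.1 ^ 2) ∧
    w.2.2 ^ 2 = discFn (loRatio ζ ξ) (hiRatio ζ ξ) (slopeCoeff ζ ξ) (offset ζ ξ ω) w.1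
      (w.2.1 ^ 2)}

/-- The coordinates `(e, t, s)` of a pair of matrices. They are polynomials in the entries, hence
continuous without a choice of eigenvectors. -/
def coords (ζ ξ : ℂ) (X Y : Matrix (Fin 3) (Fin 3) ℂ) : ℝ × ℝ × ℝ :=
  ((1 - modSq ζ ξ 0 0 X Y) / 2,
    (modSq ζ ξ 0 1 X Y - modSq ζ ξ 0 2 X Y) / (2 * Real.sqrt (ratio ζ ξ)),
    2 * bargmann ζ ξ X Y)

theorem continuous_modSq (ζ ξ : ℂ) (i j : Fin 3) :
    Continuous fun A : Matrix (Fin 3) (Fin 3) ℂ × Matrix (Fin 3) (Fin 3) ℂ =>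
      modSq ζ ξ i j A.1 A.2 := by
  unfold modSq
  refine Complex.continuous_re.comp (Continuous.matrix_trace ?_)
  exact ((continuous_proj ζ i).comp continuous_fst).mul ((continuous_proj ξ j).comp continuous_snd)

theorem continuous_coords (ζ ξ : ℂ) :
    Continuous fun A : Matrix (Fin 3) (Fin 3) ℂ × Matrix (Fin 3) (Fin 3) ℂ =>
      coords ζ ξ A.1 A.2 := by
  have h := continuous_modSq ζ ξ
  have hb : Continuous fun A : Matrix (Fin 3) (Fin 3) ℂ × Matrix (Fin 3) (Fin 3) ℂ =>
      bargmann ζ ξ A.1 A.2 := by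
    unfold bargmann
    refine Complex.continuous_im.comp (Continuous.matrix_trace ?_)
    have c1 := fun i => (continuous_proj ζ i).comp (continuous_fst (X := Matrix (Fin 3) (Fin 3) ℂ)
      (Y := Matrix (Fin 3) (Fin 3) ℂ))
    have c2 := fun i => (continuous_proj ξ i).comp (continuous_snd (X := Matrix (Fin 3) (Fin 3) ℂ)
      (Y := Matrix (Fin 3) (Fin 3) ℂ))
    exact (((c1 0).mul (c2 0)).mul (c1 1)).mul (c2 1)
  unfold coords
  exact (((continuous_const.sub (h 0 0)).div_const _)).prodMk
    ((((h 0 1).sub (h 0 2)).div_const _).prodMk (continuous_const.mul hb))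

theorem coords_conj (ζ ξ : ℂ) (X Y g : SU3) :
    coords ζ ξ ((g * X * g⁻¹ : SU3) : Matrix (Fin 3) (Fin 3) ℂ) ((g * Y * g⁻¹ : SU3) :
      Matrix (Fin 3) (Fin 3) ℂ) = coords ζ ξ X Y := by
  have hg := conjTranspose_mul_self_SU g
  have e : ∀ A : SU3, ((g * A * g⁻¹ : SU3) : Matrix (Fin 3) (Fin 3) ℂ)
      = (g : Matrix (Fin 3) (Fin 3) ℂ) * A * (g : Matrix (Fin 3) (Fin 3) ℂ)ᴴ := fun A => rfl
  simp only [coords, e, modSq_conj _ _ _ _ _ _ _ hg, bargmann_conj _ _ _ _ _ hg]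

end Moduli

/-! ### The coordinates of a pair of matrices -/

section Coordinates

variable {ζ ξ ω : ℂ}

theorem unitary_gram {V W : Matrix (Fin 3) (Fin 3) ℂ} (hV : Vᴴ * V = 1) (hW : Wᴴ * W = 1) :
    (Vᴴ * W)ᴴ * (Vᴴ * W) = 1 := by
  rw [conjTranspose_mul, conjTranspose_conjTranspose, mul_assoc, ← mul_assoc V,
    _root_.mul_eq_one_comm.1 hV, one_mul, hW]

/-- `U` is unitary, and `w = (e, t, s)` are the coordinates of its squared moduli and of its
oriented area. The remaining moduli are determined by these, since rows and columns are unit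
vectors. -/
structure HasCoords (ζ ξ ω : ℂ) (U : Matrix (Fin 3) (Fin 3) ℂ) (w : ℝ × ℝ × ℝ) : Prop where
  unitary : Uᴴ * U = 1
  h00 : Complex.normSq (U 0 0) = 1 - 2 * w.1
  h01 : Complex.normSq (U 0 1) = w.1 + rowDev ζ ξ w.2.1
  h02 : Complex.normSq (U 0 2) = w.1 - rowDev ζ ξ w.2.1
  h10 : Complex.normSq (U 1 0) = w.1 + colDev ζ ξ w.2.1
  h20 : Complex.normSq (U 2 0) = w.1 - colDev ζ ξ w.2.1
  h11 : Complex.normSq (U 1 1) = (1 - w.1 + slopeFn (slopeCoeff ζ ξ) (offset ζ ξ ω) w.1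
        - rowDev ζ ξ w.2.1 - colDev ζ ξ w.2.1) / 2
  h12 : Complex.normSq (U 1 2) = (1 - w.1 - slopeFn (slopeCoeff ζ ξ) (offset ζ ξ ω) w.1
        + rowDev ζ ξ w.2.1 - colDev ζ ξ w.2.1) / 2
  area : w.2.2 = 2 * rowArea U 0 1

/-- Diagonalization of a pair of matrices with prescribed traces. -/
theorem exists_gram (h : IsAngle ζ) (h' : IsAngle ξ) {X Y : SU3}
    (hX : (X : Matrix (Fin 3) (Fin 3) ℂ).trace = 1 + 2 * (ζ.re : ℂ))
    (hY : (Y : Matrix (Fin 3) (Fin 3) ℂ).trace = 1 + 2 * (ξ.re : ℂ))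
    (hXY : ((X * Y : SU3) : Matrix (Fin 3) (Fin 3) ℂ).trace = 1 + 2 * (ω.re : ℂ)) :
    ∃ V W : Matrix (Fin 3) (Fin 3) ℂ, Vᴴ * V = 1 ∧ Wᴴ * W = 1 ∧
      (X : Matrix (Fin 3) (Fin 3) ℂ) = V * dg ζ * Vᴴ ∧
      (Y : Matrix (Fin 3) (Fin 3) ℂ) = W * dg ξ * Wᴴ ∧
      HasCoords ζ ξ ω (Vᴴ * W) (coords ζ ξ X Y) := by
  obtain ⟨V, hV, hXV⟩ := exists_diagonalization h.unit h.im_ne X hX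
  obtain ⟨W, hW, hYW⟩ := exists_diagonalization h'.unit h'.im_ne Y hY
  have hU := unitary_gram hV hW
  have hD : ∀ i j, modSq ζ ξ i j X Y = Complex.normSq ((Vᴴ * W) i j) := by
    intro i j
    rw [hXV, hYW, modSq_eq h.im_ne h'.im_ne hV hW]
  have htr := hXY
  rw [Submonoid.coe_mul, hXV, hYW, trace_conj_mul_conj] at htr
  obtain ⟨e01, e02, e10, e20, e11, e12⟩ := entries_of_trace (e := (coords ζ ξ X Y).1)
    (t := (coords ζ ξ X Y).2.1) h h' (normSq_row hU) (normSq_col hU) htr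
    (by rw [coords, hD]) (by simp only [coords, hD])
  refine ⟨V, W, hV, hW, hXV, hYW, hU, ?_, e01, e02, e10, e20, e11, e12, ?_⟩
  · rw [coords, hD]
    ring
  · rw [coords, hXV, hYW, bargmann_eq h.im_ne h'.im_ne hV hW]
    rfl

theorem HasCoords.heron (h : IsAngle ζ) (h' : IsAngle ξ) {U : Matrix (Fin 3) (Fin 3) ℂ}
    {w : ℝ × ℝ × ℝ} (H : HasCoords ζ ξ ω U w) :
    w.2.2 ^ 2 = discFn (loRatio ζ ξ) (hiRatio ζ ξ) (slopeCoeff ζ ξ) (offset ζ ξ ω) w.1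
      (w.2.1 ^ 2) := by
  rw [← heron_eq h h' loRatio_add H.h00 H.h01 H.h02 H.h10 H.h11 H.h12, H.area]
  have hrow := unitary_row H.unitary 0 1
  rw [if_neg (by decide)] at hrow
  have := heron_of_sum_eq_zero hrow
  simp only [Complex.normSq_mul, RCLike.star_def, Complex.normSq_conj] at this
  rw [← mul_assoc] at *
  rw [← this, rowArea]
  congr 3
  simp only [RCLike.star_def, map_mul, Complex.conj_conj]
  ring

theorem HasCoords.mem_surface (h : IsAngle ζ) (h' : IsAngle ξ) {U : Matrix (Fin 3) (Fin 3) ℂ}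
    {w : ℝ × ℝ × ℝ} (H : HasCoords ζ ξ ω U w) : w ∈ surface ζ ξ ω := by
  have hF := H.heron h h'
  refine ⟨?_, hF⟩
  have n00 := Complex.normSq_nonneg (U 0 0)
  have n01 := Complex.normSq_nonneg (U 0 1)
  have n02 := Complex.normSq_nonneg (U 0 2)
  have n10 := Complex.normSq_nonneg (U 1 0)
  have n20 := Complex.normSq_nonneg (U 2 0)
  have n11 := Complex.normSq_nonneg (U 1 1)
  have n22 := Complex.normSq_nonneg (U 2 2)
  have r2 := normSq_row H.unitary 2
  have k1 := normSq_col H.unitary 1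
  have e00 := H.h00
  have e01 := H.h01
  have e02 := H.h02
  have e10 := H.h10
  have e20 := H.h20
  have e11 := H.h11
  refine Adm.of_entries (loRatio_mul h h') (loRatio_pos h h') loRatio_le (by linarith)
    (by linarith) (sq_nonneg _) ?_ (by linarith) (hF ▸ sq_nonneg _)
  rw [hiRatio_mul_le h h']
  constructor
  · refine sq_le_sq.2 ?_
    rw [abs_of_nonneg (by linarith : 0 ≤ w.1)]
    exact abs_le.2 ⟨by linarith, by linarith⟩
  · refine sq_le_sq.2 ?_
    rw [abs_of_nonneg (by linarith : 0 ≤ w.1)]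
    exact abs_le.2 ⟨by linarith, by linarith⟩

theorem HasCoords.normSq_eq {U U' : Matrix (Fin 3) (Fin 3) ℂ} {w : ℝ × ℝ × ℝ}
    (H : HasCoords ζ ξ ω U w) (H' : HasCoords ζ ξ ω U' w) (i j : Fin 3) :
    Complex.normSq (U i j) = Complex.normSq (U' i j) := by
  have e00 := H.h00.trans H'.h00.symm
  have e01 := H.h01.trans H'.h01.symm
  have e02 := H.h02.trans H'.h02.symm
  have e10 := H.h10.trans H'.h10.symm
  have e20 := H.h20.trans H'.h20.symm
  have e11 := H.h11.trans H'.h11.symm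
  have e12 := H.h12.trans H'.h12.symm
  have k1 := normSq_col H.unitary 1
  have k2 := normSq_col H.unitary 2
  have k1' := normSq_col H'.unitary 1
  have k2' := normSq_col H'.unitary 2
  fin_cases i <;> fin_cases j <;> simp only [Fin.zero_eta, Fin.mk_one, Fin.reduceFinMk] <;>
    linarith

theorem HasCoords.rowArea_eq {U U' : Matrix (Fin 3) (Fin 3) ℂ} {w : ℝ × ℝ × ℝ}
    (H : HasCoords ζ ξ ω U w) (H' : HasCoords ζ ξ ω U' w) : rowArea U 0 1 = rowArea U' 0 1 := by
  have := H.area.symm.trans H'.area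
  linarith

/-- Matrices with a common fixed vector have an entry of modulus `1`. -/
theorem normSq_eq_one_of_fixed (h : IsAngle ζ) (h' : IsAngle ξ)
    {V W : Matrix (Fin 3) (Fin 3) ℂ} (hV : Vᴴ * V = 1) (hW : Wᴴ * W = 1) {v : Fin 3 → ℂ}
    (hv : v ≠ 0) (hXv : (V * dg ζ * Vᴴ) *ᵥ v = v) (hYv : (W * dg ξ * Wᴴ) *ᵥ v = v) :
    Complex.normSq ((Vᴴ * W) 0 0) = 1 := by
  have key : ∀ {ζ : ℂ} {V : Matrix (Fin 3) (Fin 3) ℂ}, IsAngle ζ → Vᴴ * V = 1 →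
      (V * dg ζ * Vᴴ) *ᵥ v = v → (Vᴴ *ᵥ v) 1 = 0 ∧ (Vᴴ *ᵥ v) 2 = 0 := by
    intro ζ V h hV hv
    have h1 : dg ζ *ᵥ (Vᴴ *ᵥ v) = Vᴴ *ᵥ v := by
      conv_rhs => rw [← hv]
      rw [mulVec_mulVec, mulVec_mulVec, mul_assoc V, ← mul_assoc Vᴴ, hV, one_mul]
    have h2 : ∀ i, ev ζ i * (Vᴴ *ᵥ v) i = (Vᴴ *ᵥ v) i := by
      intro i
      have := congrFun h1 i
      rwa [dg, mulVec_diagonal] at this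
    have h3 : ∀ i, i ≠ 0 → (Vᴴ *ᵥ v) i = 0 := by
      intro i hi
      have h4 : (ev ζ i - ev ζ 0) * (Vᴴ *ᵥ v) i = 0 := by
        rw [sub_mul, h2, show ev ζ 0 = 1 from rfl, one_mul, sub_self]
      exact (mul_eq_zero.1 h4).resolve_left (sub_ne_zero.2 (ev_ne h.im_ne hi))
    exact ⟨h3 1 (by decide), h3 2 (by decide)⟩
  obtain ⟨a1, a2⟩ := key h hV hXv
  obtain ⟨b1, b2⟩ := key h' hW hYv
  have hU := unitary_gram hV hW
  have hmul : (Vᴴ * W) *ᵥ (Wᴴ *ᵥ v) = Vᴴ *ᵥ v := by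
    rw [mulVec_mulVec, mul_assoc, _root_.mul_eq_one_comm.1 hW, mul_one]
  have hb0 : (Wᴴ *ᵥ v) 0 ≠ 0 := by
    intro hb0
    have : Wᴴ *ᵥ v = 0 := by
      funext i
      fin_cases i
      exacts [hb0, b1, b2]
    refine hv ?_
    rw [← one_mulVec v, ← _root_.mul_eq_one_comm.1 hW, ← mulVec_mulVec, this, mulVec_zero]
  have hent : ∀ i, i ≠ 0 → (Vᴴ * W) i 0 = 0 := by
    intro i hi
    have h1 := congrFun hmul i
    have h2 : (Vᴴ *ᵥ v) i = 0 := by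
      fin_cases i
      exacts [absurd rfl hi, a1, a2]
    rw [h2, mulVec, dotProduct, Fin.sum_univ_three, b1, b2, mul_zero, mul_zero, add_zero,
      add_zero] at h1
    exact (mul_eq_zero.1 h1).resolve_right hb0
  exact normSq_eq_one_of_col hU (i := 1) (k := 2) (by decide) (by decide) (by decide)
    (hent 1 (by decide)) (hent 2 (by decide))

theorem HasCoords.eq_zero (h : IsAngle ζ) (h' : IsAngle ξ) {U : Matrix (Fin 3) (Fin 3) ℂ}
    {w : ℝ × ℝ × ℝ} (H : HasCoords ζ ξ ω U w) (h00 : Complex.normSq (U 0 0) = 1) :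
    w = (0, 0, 0) := by
  have e0 : w.1 = 0 := by
    have := H.h00
    linarith
  have n01 := Complex.normSq_nonneg (U 0 1)
  have n02 := Complex.normSq_nonneg (U 0 2)
  have t0 : w.2.1 = 0 := by
    have e01 := H.h01
    have e02 := H.h02
    have h1 : rowDev ζ ξ w.2.1 = 0 := by linarith
    rw [rowDev] at h1
    exact (mul_eq_zero.1 h1).resolve_left (Real.sqrt_pos.2 (ratio_pos h h')).ne'
  have s0 : w.2.2 = 0 := by
    have := H.heron h h'
    rw [e0, t0, discFn] at this
    refine pow_eq_zero_iff two_ne_zero |>.1 ?_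
    rw [this]
    ring
  exact Prod.ext e0 (Prod.ext t0 s0)

/-- At the point `(0, 0, 0)` the inner block of `U` has squared moduli `(1 ± δ) / 2`, with `δ` the
offset. For matrices that do not commute, none of these vanishes. -/
theorem HasCoords.offset_lt {V W : Matrix (Fin 3) (Fin 3) ℂ} (hV : Vᴴ * V = 1)
    (H : HasCoords ζ ξ ω (Vᴴ * W) (0, 0, 0))
    (hcomm : ¬ Commute (V * dg ζ * Vᴴ) (W * dg ξ * Wᴴ)) : |offset ζ ξ ω| < 1 := by
  set U := Vᴴ * W with hUdef
  have e11 := H.h11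
  have e12 := H.h12
  have hr : rowDev ζ ξ 0 = 0 := by simp [rowDev]
  have hc : colDev ζ ξ 0 = 0 := by simp [colDev]
  have e01 : Complex.normSq (U 0 1) = 0 := by rw [H.h01]; simp [hr]
  have e02 : Complex.normSq (U 0 2) = 0 := by rw [H.h02]; simp [hr]
  have e10 : Complex.normSq (U 1 0) = 0 := by rw [H.h10]; simp [hc]
  have e20 : Complex.normSq (U 2 0) = 0 := by rw [H.h20]; simp [hc]
  have k1 := normSq_col H.unitary 1
  have k2 := normSq_col H.unitary 2
  simp only [hr, hc, slopeFn, mul_zero, sub_zero, add_zero] at e11 e12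
  have n11 := Complex.normSq_nonneg (U 1 1)
  have n12 := Complex.normSq_nonneg (U 1 2)
  rw [Complex.normSq_eq_zero] at e01 e02 e10 e20
  -- if one of the entries of the block vanishes, both matrices are diagonal in one basis
  have hdiag : ∀ d : Fin 3 → ℂ, U * dg ξ * Uᴴ = diagonal d → False := by
    intro d hd
    apply hcomm
    have hVV := _root_.mul_eq_one_comm.1 hV
    have hWU : W = V * U := by rw [hUdef, ← mul_assoc, hVV, one_mul]
    have hY : W * dg ξ * Wᴴ = V * diagonal d * Vᴴ := by
      rw [← hd, hWU, conjTranspose_mul]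
      simp only [mul_assoc]
    have e : ∀ A B : Matrix (Fin 3) (Fin 3) ℂ, V * A * Vᴴ * (V * B * Vᴴ) = V * (A * B) * Vᴴ := by
      intro A B
      rw [mul_assoc _ Vᴴ, ← mul_assoc Vᴴ, ← mul_assoc Vᴴ, hV, one_mul]
      simp only [mul_assoc]
    rw [hY, Commute, SemiconjBy, e, e, dg, diagonal_mul_diagonal, diagonal_mul_diagonal]
    congr 3
    funext i
    exact mul_comm _ _
  have hentry : ∀ i k, (U * dg ξ * Uᴴ) i k = U i 0 * star (U k 0) + U i 1 * ξ * star (U k 1)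
      + U i 2 * star ξ * star (U k 2) := by
    intro i k
    rw [mul_apply, Fin.sum_univ_three]
    simp only [dg, mul_diagonal, conjTranspose_apply, ev, cons_val_zero, cons_val_one, cons_val,
      mul_one]
  have hoff : ∀ i k : Fin 3, i ≠ k → (U 1 1 = 0 ∧ U 2 2 = 0 ∨ U 1 2 = 0 ∧ U 2 1 = 0) →
      (U * dg ξ * Uᴴ) i k = 0 := by
    intro i k hik hz
    rw [hentry]
    rcases hz with ⟨z1, z2⟩ | ⟨z1, z2⟩ <;> fin_cases i <;> fin_cases k <;>
      first | exact absurd rfl hik | simp [z1, z2, e01, e02, e10, e20]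
  have hno : ¬ (U 1 1 = 0 ∧ U 2 2 = 0 ∨ U 1 2 = 0 ∧ U 2 1 = 0) := by
    intro hz
    refine hdiag (fun i => (U * dg ξ * Uᴴ) i i) ?_
    ext i k
    by_cases hik : i = k
    · rw [hik, diagonal_apply_eq]
    · rw [diagonal_apply_ne _ hik, hoff i k hik hz]
  rw [e01, map_zero] at k1
  rw [e02, map_zero] at k2
  have r2 := normSq_row H.unitary 2
  rw [e20, map_zero] at r2
  have hne11 : Complex.normSq (U 1 1) ≠ 0 := by
    intro h0
    refine hno (Or.inl ⟨Complex.normSq_eq_zero.1 h0, Complex.normSq_eq_zero.1 ?_⟩)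
    linarith
  have hne12 : Complex.normSq (U 1 2) ≠ 0 := by
    intro h0
    refine hno (Or.inr ⟨Complex.normSq_eq_zero.1 h0, Complex.normSq_eq_zero.1 ?_⟩)
    linarith
  have p11 := lt_of_le_of_ne n11 hne11.symm
  have p12 := lt_of_le_of_ne n12 hne12.symm
  exact abs_lt.2 ⟨by linarith, by linarith⟩

/-- A triangle with prescribed sides and prescribed signed area, provided Heron's formula holds. -/
theorem exists_triangle {n0 n1 n2 s : ℝ} (h0 : 0 ≤ n0) (h1' : 0 ≤ n1)
    (hs : s ^ 2 = 4 * n0 * n1 - (n2 - n0 - n1) ^ 2) :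
    ∃ z : Fin 3 → ℂ, z 0 + z 1 + z 2 = 0 ∧ Complex.normSq (z 0) = n0 ∧
      Complex.normSq (z 1) = n1 ∧ Complex.normSq (z 2) = n2 ∧ s = 2 * (z 0 * star (z 1)).im := by
  by_cases hn : n0 = 0
  · -- the triangle is degenerate
    subst hn
    have h1 : s ^ 2 + (n2 - n1) ^ 2 = 0 := by
      rw [hs]
      ring
    have hs0 : s = 0 := by nlinarith [sq_nonneg s, sq_nonneg (n2 - n1)]
    have hn2 : n2 = n1 := by nlinarith [sq_nonneg s, sq_nonneg (n2 - n1)]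
    refine ⟨![0, (Real.sqrt n1 : ℝ), -(Real.sqrt n1 : ℝ)], ?_, ?_, ?_, ?_, ?_⟩
    · simp
    · simp
    · simp [Real.mul_self_sqrt h1']
    · simp [Real.mul_self_sqrt h1', hn2]
    · simp [hs0]
  · have hpos : 0 < Real.sqrt n0 := Real.sqrt_pos.2 (lt_of_le_of_ne h0 (Ne.symm hn))
    have hsq := Real.mul_self_sqrt h0
    set ρ := Real.sqrt n0
    set A : ℝ := (n2 - n0 - n1) / 2 with hA
    have hn1 : (A / ρ) * (A / ρ) + (-(s / 2) / ρ) * (-(s / 2) / ρ) = n1 := by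
      have hsq2 : ρ ^ 2 = n0 := by rw [sq, hsq]
      field_simp
      rw [hsq2, hs, hA]
      ring
    refine ⟨![(ρ : ℂ), ⟨A / ρ, -(s / 2) / ρ⟩, -(ρ : ℂ) - ⟨A / ρ, -(s / 2) / ρ⟩], ?_, ?_, ?_, ?_, ?_⟩
    · simp only [cons_val_zero, cons_val_one, cons_val]
      ring
    · simp only [cons_val_zero, Complex.normSq_ofReal, hsq]
    · simp only [cons_val_one, cons_val_zero, Complex.normSq_mk, hn1]
    · simp only [cons_val, Complex.normSq_apply, Complex.sub_re, Complex.sub_im, Complex.neg_re,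
        Complex.neg_im, Complex.ofReal_re, Complex.ofReal_im]
      have : ρ * (A / ρ) = A := by field_simp
      rw [hA] at this
      nlinarith
    · simp only [cons_val_zero, cons_val_one, RCLike.star_def, Complex.mul_im, Complex.conj_re,
        Complex.conj_im, Complex.ofReal_re, Complex.ofReal_im]
      field_simp
      ring

/-- Two complex numbers with prescribed moduli and prescribed Hermitian product. -/
theorem exists_normSq_mul_star {a b : ℝ} (ha : 0 ≤ a) (hb : 0 ≤ b) {z : ℂ}
    (hz : Complex.normSq z = a * b) :
    ∃ u v : ℂ, Complex.normSq u = a ∧ Complex.normSq v = b ∧ u * star v = z := by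
  have key : ∀ a : ℝ, 0 ≤ a → Complex.normSq ((Real.sqrt a : ℝ) : ℂ) = a := by
    intro a ha
    rw [Complex.normSq_ofReal, Real.mul_self_sqrt ha]
  by_cases h0 : a = 0
  · refine ⟨0, (Real.sqrt b : ℝ), by simp [h0], key b hb, ?_⟩
    rw [h0, zero_mul, Complex.normSq_eq_zero] at hz
    rw [hz, zero_mul]
  · have hr : ((Real.sqrt a : ℝ) : ℂ) ≠ 0 := by
      exact_mod_cast (Real.sqrt_pos.2 (lt_of_le_of_ne ha (Ne.symm h0))).ne'
    refine ⟨(Real.sqrt a : ℝ), star z / (Real.sqrt a : ℝ), key a ha, ?_, ?_⟩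
    · rw [Complex.normSq_div, key a ha, RCLike.star_def, Complex.normSq_conj, hz,
        mul_div_cancel_left₀ _ h0]
    · rw [star_div₀, star_star, RCLike.star_def, Complex.conj_ofReal, mul_div_cancel₀ _ hr]

theorem exists_unitary_rows {u v : Fin 3 → ℂ}
    (huu : u 0 * star (u 0) + u 1 * star (u 1) + u 2 * star (u 2) = 1)
    (hvv : v 0 * star (v 0) + v 1 * star (v 1) + v 2 * star (v 2) = 1)
    (huv : u 0 * star (v 0) + u 1 * star (v 1) + u 2 * star (v 2) = 0) :
    ∃ U : Matrix (Fin 3) (Fin 3) ℂ, Uᴴ * U = 1 ∧ U 0 = u ∧ U 1 = v := by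
  have hvu : v 0 * star (u 0) + v 1 * star (u 1) + v 2 * star (u 2) = 0 := by
    have := congrArg star huv
    simp only [star_add, star_mul', star_star, star_zero] at this
    linear_combination this
  set w : Fin 3 → ℂ := ![star (u 1 * v 2 - u 2 * v 1), star (u 2 * v 0 - u 0 * v 2),
    star (u 0 * v 1 - u 1 * v 0)] with hw
  refine ⟨Matrix.of ![u, v, w], ?_, rfl, rfl⟩
  refine _root_.mul_eq_one_comm.1 ?_
  ext i k
  rw [mul_apply, Fin.sum_univ_three]
  simp only [conjTranspose_apply]
  fin_cases i <;> fin_cases k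
  · exact huu
  · exact huv
  · change u 0 * star (w 0) + u 1 * star (w 1) + u 2 * star (w 2) = 0
    simp only [hw, cons_val_zero, cons_val_one, cons_val, star_star]
    ring
  · exact hvu
  · exact hvv
  · change v 0 * star (w 0) + v 1 * star (w 1) + v 2 * star (w 2) = 0
    simp only [hw, cons_val_zero, cons_val_one, cons_val, star_star]
    ring
  · change w 0 * star (u 0) + w 1 * star (u 1) + w 2 * star (u 2) = 0
    simp only [hw, cons_val_zero, cons_val_one, cons_val, star_sub, star_mul']
    ring
  · change w 0 * star (v 0) + w 1 * star (v 1) + w 2 * star (v 2) = 0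
    simp only [hw, cons_val_zero, cons_val_one, cons_val, star_sub, star_mul']
    ring
  · change w 0 * star (w 0) + w 1 * star (w 1) + w 2 * star (w 2) = 1
    simp only [hw, cons_val_zero, cons_val_one, cons_val, star_sub, star_mul', star_star]
    -- Lagrange's identity
    linear_combination (v 0 * star (v 0) + v 1 * star (v 1) + v 2 * star (v 2)) * huu + hvv
      - (v 0 * star (u 0) + v 1 * star (u 1) + v 2 * star (u 2)) * huv

/-- Every point of the surface is attained: a triangle with the prescribed sides and area gives the
first two rows of a unitary matrix. -/
theorem exists_pair (h : IsAngle ζ) (h' : IsAngle ξ) (hδ : |offset ζ ξ ω| < 1) {w : ℝ × ℝ × ℝ}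
    (hw : w ∈ surface ζ ξ ω) :
    ∃ (X Y : SU3) (U : Matrix (Fin 3) (Fin 3) ℂ), Uᴴ * U = 1 ∧
      (X : Matrix (Fin 3) (Fin 3) ℂ) = dg ζ ∧
      (Y : Matrix (Fin 3) (Fin 3) ℂ) = U * dg ξ * Uᴴ ∧
      ((X * Y : SU3) : Matrix (Fin 3) (Fin 3) ℂ).trace = 1 + 2 * (ω.re : ℂ) ∧
      coords ζ ξ X Y = w := by
  obtain ⟨e, t, s⟩ := w
  obtain ⟨hadm, hs⟩ := hw
  simp only at hadm hs
  obtain ⟨hTe, hm1, hm2, hp1, hp2⟩ := hadm.entries (loRatio_mul h h') (loRatio_pos h h')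
    loRatio_le hδ
  have he0 := hadm.1
  have he1 := hadm.2.1
  rw [hiRatio_mul_le h h'] at hTe
  obtain ⟨hf, hg⟩ := hTe
  have hff := abs_le_of_sq_le_sq' hf he0
  have hgg := abs_le_of_sq_le_sq' hg he0
  have hfg := rowDev_mul_colDev h h' t
  have hsum : (loRatio ζ ξ + hiRatio ζ ξ) * t ^ 2 = rowDev ζ ξ t ^ 2 + colDev ζ ξ t ^ 2 := by
    rw [rowDev_sq h h', colDev_sq h h', loRatio_add]
    ring
  have hheron := heron_eq (κ := slopeCoeff ζ ξ) (δ := offset ζ ξ ω) (e := e) (t := t) h h'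
    (loRatio_add (ζ := ζ) (ξ := ξ)) rfl rfl rfl rfl rfl rfl
  rw [← hs] at hheron
  set f := rowDev ζ ξ t with hfdef
  set g := colDev ζ ξ t with hgdef
  set m := slopeFn (slopeCoeff ζ ξ) (offset ζ ξ ω) e with hmdef
  have hq1 := abs_le_of_sq_le_sq' (a := f + g) (b := 1 - e + m) (by nlinarith) hm1
  have hq2 := abs_le_of_sq_le_sq' (a := f - g) (b := 1 - e - m) (by nlinarith) hm2
  set a : Fin 3 → ℝ := ![1 - 2 * e, e + f, e - f] with ha
  set b : Fin 3 → ℝ := ![e + g, (1 - e + m - f - g) / 2, (1 - e - m + f - g) / 2] with hb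
  have hapos : ∀ j, 0 ≤ a j := by
    intro j
    fin_cases j <;> simp only [ha, Fin.zero_eta, Fin.mk_one, Fin.reduceFinMk, cons_val_zero,
      cons_val_one, cons_val] <;> linarith
  have hbpos : ∀ j, 0 ≤ b j := by
    intro j
    fin_cases j <;> simp only [hb, Fin.zero_eta, Fin.mk_one, Fin.reduceFinMk, cons_val_zero,
      cons_val_one, cons_val] <;> linarith
  obtain ⟨z, hz, hz0, hz1, hz2, hsz⟩ := exists_triangle (n0 := a 0 * b 0) (n1 := a 1 * b 1)
    (n2 := a 2 * b 2) (s := s) (mul_nonneg (hapos 0) (hbpos 0)) (mul_nonneg (hapos 1) (hbpos 1))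
    hheron.symm
  have hzn : ∀ j, Complex.normSq (z j) = a j * b j := by
    intro j
    fin_cases j
    exacts [hz0, hz1, hz2]
  choose u v hu hv huv using fun j => exists_normSq_mul_star (hapos j) (hbpos j) (hzn j)
  obtain ⟨U, hU, hU0, hU1⟩ := exists_unitary_rows (u := u) (v := v) (by
      simp only [RCLike.star_def, Complex.mul_conj, hu]
      norm_cast
      simp only [ha, cons_val_zero, cons_val_one, cons_val]
      ring) (by
      simp only [RCLike.star_def, Complex.mul_conj, hv]
      norm_cast
      simp only [hb, cons_val_zero, cons_val_one, cons_val]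
      ring) (by rw [huv, huv, huv, hz])
  have hD0 : ∀ j, Complex.normSq (U 0 j) = a j := by
    intro j
    rw [hU0, hu]
  have hD1 : ∀ j, Complex.normSq (U 1 j) = b j := by
    intro j
    rw [hU1, hv]
  have hdet : star U.det * U.det = 1 := by
    rw [← det_conjTranspose, ← det_mul, hU, det_one]
  have hUU := _root_.mul_eq_one_comm.1 hU
  have hXmem : dg ζ ∈ specialUnitaryGroup (Fin 3) ℂ :=
    mem_SU_iff.2 ⟨dg_mul_conjTranspose h.unit, det_dg h.unit⟩
  have hYmem : U * dg ξ * Uᴴ ∈ specialUnitaryGroup (Fin 3) ℂ := by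
    rw [mem_SU_iff]
    constructor
    · simp only [conjTranspose_mul, conjTranspose_conjTranspose]
      rw [mul_assoc _ Uᴴ, ← mul_assoc Uᴴ, hU, one_mul, mul_assoc U, ← mul_assoc (dg ξ),
        dg_mul_conjTranspose h'.unit, one_mul, hUU]
    · rw [det_mul, det_mul, det_dg h'.unit, det_conjTranspose, mul_one, mul_comm]
      exact hdet
  have h1 : (1 : Matrix (Fin 3) (Fin 3) ℂ)ᴴ * 1 = 1 := by rw [conjTranspose_one, mul_one]
  have hX1 : dg ζ = 1 * dg ζ * 1ᴴ := by rw [conjTranspose_one, mul_one, one_mul]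
  have hU1 : (1 : Matrix (Fin 3) (Fin 3) ℂ)ᴴ * U = U := by rw [conjTranspose_one, one_mul]
  refine ⟨⟨dg ζ, hXmem⟩, ⟨U * dg ξ * Uᴴ, hYmem⟩, U, hU, rfl, rfl, ?_, ?_⟩
  · rw [Submonoid.coe_mul, trace_mul_eq]
    exact trace_of_entries (e := e) (t := t) h h' (normSq_row hU) (normSq_col hU) (hD0 1) (hD0 2)
      (hD1 0) (hD1 1)
  · have hmod : ∀ j, modSq ζ ξ 0 j (dg ζ) (U * dg ξ * Uᴴ) = a j := by
      intro j
      rw [hX1, modSq_eq h.im_ne h'.im_ne h1 hU, hU1, hD0]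
    have hbar : bargmann ζ ξ (dg ζ) (U * dg ξ * Uᴴ) = (z 0 * star (z 1)).im := by
      rw [hX1, bargmann_eq h.im_ne h'.im_ne h1 hU, hU1, ← huv, ← huv, hU0]
      simp only [star_mul', star_star]
      rw [‹U 1 = v›]
      congr 1
      ring
    simp only [coords, hmod, hbar]
    refine Prod.ext ?_ (Prod.ext ?_ hsz.symm)
    · simp only [ha, cons_val_zero]
      ring
    · have := (Real.sqrt_pos.2 (ratio_pos h h')).ne'
      simp only [ha, cons_val_one, cons_val]
      rw [hfdef, rowDev]
      field_simp
      ring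

end Coordinates

/-! ### The components of the representation variety that contain reducible classes -/

section Level

variable {p q r : ℕ} {a c : ℤ} {ζ ξ ω : ℂ}

/-- An element of `SU(2)` other than `±1` has eigenvalues `ζ`, `ζ̄` with `ζ` in the open upper half
of the unit circle. -/
theorem exists_isAngle {B : SU2} (h1 : (B : Matrix (Fin 2) (Fin 2) ℂ) ≠ 1)
    (h2 : (B : Matrix (Fin 2) (Fin 2) ℂ) ≠ -1) :
    ∃ ζ : ℂ, IsAngle ζ ∧ (B : Matrix (Fin 2) (Fin 2) ℂ).trace = 2 * (ζ.re : ℂ) := by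
  set M := (B : Matrix (Fin 2) (Fin 2) ℂ) with hM
  have hdet : M.det = 1 := (mem_SU_iff.1 B.2).2
  have hadj : M.adjugate = Mᴴ := by
    have e1 := mul_adjugate M
    rw [hdet, one_smul] at e1
    calc M.adjugate = (Mᴴ * M) * M.adjugate := by rw [conjTranspose_mul_self_SU, one_mul]
      _ = _ := by rw [mul_assoc, e1, mul_one]
  have h11 : M 1 1 = star (M 0 0) := by
    have := congrFun (congrFun hadj 0) 0
    rw [adjugate_fin_two] at this
    exact this
  have h01 : M 0 1 = -star (M 1 0) := by
    have := congrFun (congrFun hadj 0) 1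
    rw [adjugate_fin_two] at this
    rw [← conjTranspose_apply, ← this]
    simp
  have hn : Complex.normSq (M 0 0) + Complex.normSq (M 1 0) = 1 := by
    rw [det_fin_two, h11, h01] at hdet
    simp only [RCLike.star_def, Complex.mul_conj, neg_mul,
      ← Complex.normSq_eq_conj_mul_self, sub_neg_eq_add] at hdet
    exact_mod_cast hdet
  rw [Complex.normSq_apply] at hn
  have hlt : (M 0 0).re ^ 2 < 1 := by
    by_contra hge
    push Not at hge
    have n10 := Complex.normSq_nonneg (M 1 0)
    have h10 : M 1 0 = 0 := Complex.normSq_eq_zero.1 (by nlinarith [mul_self_nonneg (M 0 0).im])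
    have him : (M 0 0).im = 0 := by
      have : (M 0 0).im * (M 0 0).im = 0 := by nlinarith [mul_self_nonneg (M 0 0).im]
      exact mul_self_eq_zero.1 this
    have hre : (M 0 0).re ^ 2 = 1 ^ 2 := by
      rw [h10, map_zero, him] at hn
      linarith
    rw [h10, star_zero, neg_zero] at h01
    rcases sq_eq_sq_iff_eq_or_eq_neg.1 hre with hre | hre
    · have h00 : M 0 0 = 1 := Complex.ext hre him
      refine h1 ?_
      ext i j
      fin_cases i <;> fin_cases j <;> simp [h00, h01, h10, h11]
    · have h00 : M 0 0 = -1 := Complex.ext hre (by simpa using him)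
      refine h2 ?_
      ext i j
      fin_cases i <;> fin_cases j <;> simp [h00, h01, h10, h11]
  have hpos : 0 < 1 - (M 0 0).re ^ 2 := by linarith
  refine ⟨⟨(M 0 0).re, Real.sqrt (1 - (M 0 0).re ^ 2)⟩, ⟨?_, Real.sqrt_pos.2 hpos⟩, ?_⟩
  · rw [RCLike.star_def, ← Complex.normSq_eq_conj_mul_self, Complex.normSq_mk,
      Real.mul_self_sqrt hpos.le, ← sq, add_sub_cancel, Complex.ofReal_one]
  · rw [trace_fin_two, h11]
    have := Complex.add_conj (M 0 0)
    push_cast at this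
    exact this

theorem conj_pow_eq {V D : Matrix (Fin 3) (Fin 3) ℂ} (hV : Vᴴ * V = 1) (n : ℕ) :
    (V * D * Vᴴ) ^ n = V * D ^ n * Vᴴ := by
  induction n with
  | zero => rw [pow_zero, pow_zero, mul_one, _root_.mul_eq_one_comm.1 hV]
  | succ n ih =>
    rw [pow_succ, ih, pow_succ, mul_assoc _ Vᴴ, ← mul_assoc Vᴴ, ← mul_assoc Vᴴ, hV, one_mul]
    simp only [mul_assoc]

theorem pow_eq_one_iff_of_trace (h : IsAngle ζ) {X : SU3}
    (hX : (X : Matrix (Fin 3) (Fin 3) ℂ).trace = 1 + 2 * (ζ.re : ℂ)) {n : ℕ} :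
    X ^ n = 1 ↔ ζ ^ n = 1 := by
  obtain ⟨V, hV, hXV⟩ := exists_diagonalization h.unit h.im_ne X hX
  rw [← Subtype.coe_inj, SubmonoidClass.coe_pow, hXV, conj_pow_eq hV, Submonoid.coe_one]
  constructor
  · intro h1
    have h2 : dg ζ ^ n = 1 := by
      calc dg ζ ^ n = (Vᴴ * V) * dg ζ ^ n * (Vᴴ * V) := by rw [hV, one_mul, mul_one]
        _ = Vᴴ * (V * dg ζ ^ n * Vᴴ) * V := by simp only [mul_assoc]
        _ = 1 := by rw [h1, mul_one, hV]
    have h3 := congrFun (congrFun h2 1) 1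
    rw [dg, diagonal_pow, diagonal_apply_eq] at h3
    simpa [ev] using h3
  · intro h1
    rw [dg_pow h1, mul_one, _root_.mul_eq_one_comm.1 hV]

/-- `α` kills the regular fibre, and the images of `x`, `y`, `z` have eigenvalues `1, ζ, ζ̄`, and so
on, none of them a repeated one. This is expressed by the traces, so that it depends only on the
level set of `α`. -/
structure HasAngles (α : Reps p q r a c) (ζ ξ ω : ℂ) : Prop where
  x : IsAngle ζ
  y : IsAngle ξ
  z : IsAngle ω
  tr_x : (α (gx p q r a c) : Matrix (Fin 3) (Fin 3) ℂ).trace = 1 + 2 * (ζ.re : ℂ)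
  tr_y : (α (gy p q r a c) : Matrix (Fin 3) (Fin 3) ℂ).trace = 1 + 2 * (ξ.re : ℂ)
  tr_z : (α (gz p q r a c) : Matrix (Fin 3) (Fin 3) ℂ).trace = 1 + 2 * (ω.re : ℂ)
  one : α (gh p q r a c) = 1

/-- Nontrivial reducible representations that kill the regular fibre have regular images of the
generators. -/
theorem exists_hasAngles (hpq : p.Coprime q) (hqr : q.Coprime r) (hpr : p.Coprime r)
    (hac : a * r * (p + q) + c * p * q = 1) {α : Reps p q r a c} (hα : Red α) (hne : α ≠ 1)
    (hh : α (gh p q r a c) = 1) : ∃ ζ ξ ω, HasAngles α ζ ξ ω := by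
  obtain ⟨β, hβ⟩ := hα.exists_conjToSU2 hpq hqr hpr hac
  have hβ1 := hβ.ne_one hne
  have key : ∀ g : Pi1 p q r a c, (g = gx p q r a c ∨ g = gy p q r a c ∨ g = gz p q r a c) →
      ∃ ζ : ℂ, IsAngle ζ ∧
        (α g : Matrix (Fin 3) (Fin 3) ℂ).trace = 1 + 2 * (ζ.re : ℂ) := by
    intro g hg
    obtain ⟨h1, h2⟩ := rep_gen_ne hpq hqr hpr hac hβ1 hg
    obtain ⟨ζ, hζ, htr⟩ := exists_isAngle h1 h2
    exact ⟨ζ, hζ, by rw [hβ.trace_eq, htr, add_comm]⟩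
  obtain ⟨ζ, hζ, hx⟩ := key _ (Or.inl rfl)
  obtain ⟨ξ, hξ, hy⟩ := key _ (Or.inr (Or.inl rfl))
  obtain ⟨ω, hω, hz⟩ := key _ (Or.inr (Or.inr rfl))
  exact ⟨ζ, ξ, ω, hζ, hξ, hω, hx, hy, hz, hh⟩

theorem HasAngles.of_mem_level {α α' : Reps p q r a c} (H : HasAngles α ζ ξ ω)
    (h : cls α' ∈ level (cls α)) : HasAngles α' ζ ξ ω := by
  refine ⟨H.x, H.y, H.z, (h Gen.x).trans H.tr_x, (h Gen.y).trans H.tr_y, (h Gen.z).trans H.tr_z, ?_⟩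
  exact eq_one_of_trCls ((h Gen.h).trans (trCls_of_eq_one H.one))

theorem HasAngles.mem_level {α α' : Reps p q r a c} (H : HasAngles α ζ ξ ω)
    (H' : HasAngles α' ζ ξ ω) : cls α' ∈ level (cls α) := by
  intro s
  cases s
  · exact H'.tr_x.trans H.tr_x.symm
  · exact H'.tr_y.trans H.tr_y.symm
  · exact H'.tr_z.trans H.tr_z.symm
  · exact (trCls_of_eq_one H'.one).trans (trCls_of_eq_one H.one).symm

theorem HasAngles.tr_xy {α : Reps p q r a c} (H : HasAngles α ζ ξ ω) :
    ((α (gx p q r a c) * α (gy p q r a c) : SU3) : Matrix (Fin 3) (Fin 3) ℂ).trace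
      = 1 + 2 * (ω.re : ℂ) := by
  have h1 : α (gx p q r a c) * α (gy p q r a c) = (α (gz p q r a c))⁻¹ := by
    rw [gz_eq, map_inv, inv_inv, map_mul]
  rw [h1, coe_inv_SU, trace_conjTranspose, H.tr_z]
  simp

/-- The coordinates of the images of `x` and `y`, which determine a representation that kills the
regular fibre. -/
def repCoords (ζ ξ : ℂ) (α : Reps p q r a c) : ℝ × ℝ × ℝ :=
  coords ζ ξ (α (gx p q r a c)) (α (gy p q r a c))

theorem HasAngles.exists_gram {α : Reps p q r a c} (H : HasAngles α ζ ξ ω) :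
    ∃ V W : Matrix (Fin 3) (Fin 3) ℂ, Vᴴ * V = 1 ∧ Wᴴ * W = 1 ∧
      (α (gx p q r a c) : Matrix (Fin 3) (Fin 3) ℂ) = V * dg ζ * Vᴴ ∧
      (α (gy p q r a c) : Matrix (Fin 3) (Fin 3) ℂ) = W * dg ξ * Wᴴ ∧
      HasCoords ζ ξ ω (Vᴴ * W) (repCoords ζ ξ α) :=
  BrieskornSU3.exists_gram H.x H.y H.tr_x H.tr_y H.tr_xy

theorem HasAngles.normSq_eq_one (hpq : p.Coprime q) (hqr : q.Coprime r) (hpr : p.Coprime r)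
    (hac : a * r * (p + q) + c * p * q = 1) {α : Reps p q r a c} (H : HasAngles α ζ ξ ω)
    (hα : Red α) {V W : Matrix (Fin 3) (Fin 3) ℂ} (hV : Vᴴ * V = 1) (hW : Wᴴ * W = 1)
    (hX : (α (gx p q r a c) : Matrix (Fin 3) (Fin 3) ℂ) = V * dg ζ * Vᴴ)
    (hY : (α (gy p q r a c) : Matrix (Fin 3) (Fin 3) ℂ) = W * dg ξ * Wᴴ) :
    Complex.normSq ((Vᴴ * W) 0 0) = 1 := by
  obtain ⟨v, hv, hfix⟩ := hα.exists_fixed hpq hqr hpr hac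
  refine normSq_eq_one_of_fixed H.x H.y hV hW (v := v) ?_ (hX ▸ hfix _) (hY ▸ hfix _)
  rintro rfl
  simp at hv

/-- The reducible classes have coordinates `(0, 0, 0)`. -/
theorem HasAngles.repCoords_eq_zero (hpq : p.Coprime q) (hqr : q.Coprime r) (hpr : p.Coprime r)
    (hac : a * r * (p + q) + c * p * q = 1) {α : Reps p q r a c} (H : HasAngles α ζ ξ ω)
    (hα : Red α) : repCoords ζ ξ α = (0, 0, 0) := by
  obtain ⟨V, W, hV, hW, hX, hY, hc⟩ := H.exists_gram
  exact hc.eq_zero H.x H.y (H.normSq_eq_one hpq hqr hpr hac hα hV hW hX hY)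

theorem HasAngles.offset_lt (hpq : p.Coprime q) (hqr : q.Coprime r) (hpr : p.Coprime r)
    (hac : a * r * (p + q) + c * p * q = 1) {α : Reps p q r a c} (H : HasAngles α ζ ξ ω)
    (hα : Red α) (hne : α ≠ 1) : |offset ζ ξ ω| < 1 := by
  obtain ⟨V, W, hV, hW, hX, hY, hc⟩ := H.exists_gram
  rw [H.repCoords_eq_zero hpq hqr hpr hac hα] at hc
  refine hc.offset_lt hV fun hcomm => hne (eq_one_of_commute hpq hqr hpr hac α ?_)
  rw [← hX, ← hY] at hcomm
  exact Subtype.ext hcomm.eq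

/-- A common eigenvector makes a representation reducible. -/
theorem red_of_eigenvector {α : Reps p q r a c} {v : Fin 3 → ℂ} (hv : v ≠ 0)
    (hx : ∃ t : ℂ, (α (gx p q r a c) : Matrix (Fin 3) (Fin 3) ℂ) *ᵥ v = t • v)
    (hy : ∃ t : ℂ, (α (gy p q r a c) : Matrix (Fin 3) (Fin 3) ℂ) *ᵥ v = t • v)
    (hh : ∃ t : ℂ, (α (gh p q r a c) : Matrix (Fin 3) (Fin 3) ℂ) *ᵥ v = t • v) : Red α := by
  intro hirr
  have hall : ∀ γ, ∃ t : ℂ, (α γ : Matrix (Fin 3) (Fin 3) ℂ) *ᵥ v = t • v := by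
    intro γ
    refine pi1_induction (P := fun γ => ∃ t : ℂ, (α γ : Matrix (Fin 3) (Fin 3) ℂ) *ᵥ v = t • v)
      hx hy hh ⟨1, by simp⟩ ?_ ?_ γ
    · rintro g k ⟨s, hs⟩ ⟨t, ht⟩
      exact ⟨t * s, by rw [map_mul, Submonoid.coe_mul, ← mulVec_mulVec, ht, mulVec_smul, hs,
        smul_smul]⟩
    · rintro g ⟨s, hs⟩
      refine ⟨s⁻¹, ?_⟩
      have h1 : (α g⁻¹ : Matrix (Fin 3) (Fin 3) ℂ) *ᵥ
          ((α g : Matrix (Fin 3) (Fin 3) ℂ) *ᵥ v) = v := by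
        rw [mulVec_mulVec, ← Submonoid.coe_mul, ← map_mul, inv_mul_cancel, map_one,
          Submonoid.coe_one, one_mulVec]
      rw [hs, mulVec_smul] at h1
      have hs0 : s ≠ 0 := by
        rintro rfl
        rw [zero_smul] at h1
        exact hv h1.symm
      rw [eq_inv_smul_iff₀ hs0, h1]
  rcases hirr (ℂ ∙ v) (fun γ w hw => by
    obtain ⟨s, rfl⟩ := Submodule.mem_span_singleton.1 hw
    obtain ⟨t, ht⟩ := hall γ
    rw [mulVec_smul, ht]
    exact Submodule.smul_mem _ _ (Submodule.smul_mem _ _ (Submodule.mem_span_singleton_self v)))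
    with h | h
  · exact hv (Submodule.span_singleton_eq_bot.1 h)
  · have h1 := finrank_span_singleton (K := ℂ) hv
    rw [h, finrank_top, Module.finrank_fin_fun] at h1
    omega

/-- If each row of `U` has a zero, some eigenvectors of the images of `x` and `y` agree. -/
theorem HasAngles.exists_row {α : Reps p q r a c} (H : HasAngles α ζ ξ ω)
    (hα : Irred α) {V W : Matrix (Fin 3) (Fin 3) ℂ} (hV : Vᴴ * V = 1) (hW : Wᴴ * W = 1)
    (hX : (α (gx p q r a c) : Matrix (Fin 3) (Fin 3) ℂ) = V * dg ζ * Vᴴ)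
    (hY : (α (gy p q r a c) : Matrix (Fin 3) (Fin 3) ℂ) = W * dg ξ * Wᴴ) :
    ∃ i, ∀ j, (Vᴴ * W) i j ≠ 0 := by
  by_contra hno
  push Not at hno
  have hU := unitary_gram hV hW
  obtain ⟨i, j, hij⟩ := exists_normSq_eq_one hU hno
  have hzero : ∀ k, k ≠ j → (Vᴴ * W) i k = 0 := by
    intro k hk
    obtain ⟨m, hkm, hmj⟩ :=
      (by decide : ∀ k j : Fin 3, k ≠ j → ∃ m : Fin 3, k ≠ m ∧ m ≠ j) k j hk
    have h1 := sum_three_eq (fun j => Complex.normSq ((Vᴴ * W) i j)) hk.symm hmj.symm hkm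
    rw [normSq_row hU, hij] at h1
    have n1 := Complex.normSq_nonneg ((Vᴴ * W) i k)
    have n2 := Complex.normSq_nonneg ((Vᴴ * W) i m)
    exact Complex.normSq_eq_zero.1 (by linarith)
  set e : Fin 3 → ℂ := Pi.single i 1 with he
  set v := V *ᵥ e with hvdef
  have hVv : Vᴴ *ᵥ v = e := by rw [hvdef, mulVec_mulVec, hV, one_mulVec]
  have hdg : ∀ (ζ : ℂ) (k : Fin 3) (t : ℂ), dg ζ *ᵥ Pi.single k t = ev ζ k • Pi.single k t := by
    intro ζ k t
    funext l
    rw [dg, mulVec_diagonal, Pi.smul_apply, smul_eq_mul]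
    by_cases hl : l = k
    · rw [hl]
    · rw [Pi.single_eq_of_ne hl, mul_zero, mul_zero]
  have hWv : Wᴴ *ᵥ v = Pi.single j (star ((Vᴴ * W) i j)) := by
    funext k
    have h1 : Wᴴ *ᵥ v = (Vᴴ * W)ᴴ *ᵥ e := by
      rw [hvdef, mulVec_mulVec, conjTranspose_mul, conjTranspose_conjTranspose]
    rw [h1, he, mulVec_single_one, col_apply, conjTranspose_apply]
    by_cases hk : k = j
    · rw [hk, Pi.single_eq_same]
    · rw [hzero k hk, star_zero, Pi.single_eq_of_ne hk]
  refine red_of_eigenvector (v := v) ?_ ⟨ev ζ i, ?_⟩ ⟨ev ξ j, ?_⟩ ⟨1, ?_⟩ hα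
  · intro h0
    rw [h0, mulVec_zero] at hVv
    have := congrFun hVv i
    rw [he, Pi.single_eq_same] at this
    exact zero_ne_one this
  · rw [hX, ← mulVec_mulVec, hVv, he, ← mulVec_mulVec, hdg, mulVec_smul]
  · rw [hY, ← mulVec_mulVec, hWv, ← mulVec_mulVec, hdg, mulVec_smul, ← hWv, mulVec_mulVec,
      _root_.mul_eq_one_comm.1 hW, one_mulVec]
  · rw [H.one, Submonoid.coe_one, one_mulVec, one_smul]

/-- The coordinates determine the conjugacy class. They fix the matrix `U` of inner products of
eigenvectors up to phases, since `U` has a row without zeros or is a block matrix. -/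
theorem HasAngles.cls_eq_of_repCoords (hpq : p.Coprime q) (hqr : q.Coprime r)
    (hpr : p.Coprime r) (hac : a * r * (p + q) + c * p * q = 1) (hδ : |offset ζ ξ ω| < 1)
    {α α' : Reps p q r a c} (H : HasAngles α ζ ξ ω) (H' : HasAngles α' ζ ξ ω)
    (h : repCoords ζ ξ α = repCoords ζ ξ α') : cls α = cls α' := by
  obtain ⟨V, W, hV, hW, hX, hY, hc⟩ := H.exists_gram
  obtain ⟨V', W', hV', hW', hX', hY', hc'⟩ := H'.exists_gram
  rw [← h] at hc'
  have hn := hc.normSq_eq hc'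
  have hJ := hc.rowArea_eq hc'
  have hphases : ∃ S T : Fin 3 → ℂ, (∀ i, star (S i) * S i = 1) ∧ (∀ j, star (T j) * T j = 1) ∧
      ∀ k j, (V'ᴴ * W') k j = S k * (Vᴴ * W) k j * T j := by
    by_cases hα : Irred α
    · obtain ⟨i, hi⟩ := H.exists_row hα hV hW hX hY
      exact exists_phases_of_row hc.unitary hc'.unitary hn hJ hi
    · have h0 := H.repCoords_eq_zero hpq hqr hpr hac hα
      obtain ⟨d1, d2⟩ := abs_lt.1 hδ
      have e11 := hc.h11
      have e12 := hc.h12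
      have hr : rowDev ζ ξ 0 = 0 := by simp [rowDev]
      have hcd : colDev ζ ξ 0 = 0 := by simp [colDev]
      simp only [h0, hr, hcd, slopeFn, mul_zero, sub_zero, add_zero] at e11 e12
      refine exists_phases_of_block hc.unitary hc'.unitary hn hJ
        (H.normSq_eq_one hpq hqr hpr hac hα hV hW hX hY) ?_ ?_
      · intro hz
        rw [hz, map_zero] at e11
        linarith
      · intro hz
        rw [hz, map_zero] at e12
        linarith
  obtain ⟨S, T, hS, hT, hST⟩ := hphases
  obtain ⟨g, hg1, hg2⟩ := exists_conj_of_phases hV hV' hX hY hX' hY' hS hT hST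
  refine cls_eq_iff.2 ⟨g, fun γ => ?_⟩
  have : α' = conjRep g α := by
    refine pi1_hom_ext ?_ ?_ ?_
    · rw [hg1, conjRep_apply]
    · rw [hg2, conjRep_apply]
    · rw [H'.one, conjRep_apply, H.one, mul_one, mul_inv_cancel]
  rw [this, conjRep_apply]

/-- Every point of the surface is the class of a representation. The relations hold because the
eigenvalues are those of `α`. -/
theorem HasAngles.exists_rep {α : Reps p q r a c} (H : HasAngles α ζ ξ ω)
    (hδ : |offset ζ ξ ω| < 1) {w : ℝ × ℝ × ℝ} (hw : w ∈ surface ζ ξ ω) :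
    ∃ α' : Reps p q r a c, HasAngles α' ζ ξ ω ∧ repCoords ζ ξ α' = w := by
  have hpow : ∀ (g : Pi1 p q r a c) (n : ℕ) (k : ℤ) (ζ : ℂ), IsAngle ζ →
      g ^ n = gh p q r a c ^ k →
      (α g : Matrix (Fin 3) (Fin 3) ℂ).trace = 1 + 2 * (ζ.re : ℂ) → ζ ^ n = 1 := by
    intro g n k ζ hζ hg htr
    rw [← pow_eq_one_iff_of_trace hζ htr, ← map_pow, hg, map_zpow, H.one, _root_.one_zpow]
  obtain ⟨X, Y, U, hU, hX, hY, htr, hco⟩ := exists_pair H.x H.y hδ hw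
  have trX : (X : Matrix (Fin 3) (Fin 3) ℂ).trace = 1 + 2 * (ζ.re : ℂ) := by rw [hX, trace_dg]
  have trY : (Y : Matrix (Fin 3) (Fin 3) ℂ).trace = 1 + 2 * (ξ.re : ℂ) := by
    rw [hY, trace_mul_comm, ← mul_assoc, hU, one_mul, trace_dg]
  have hX1 := (pow_eq_one_iff_of_trace H.x trX).2 (hpow _ _ _ _ H.x gx_pow H.tr_x)
  have hY1 := (pow_eq_one_iff_of_trace H.y trY).2 (hpow _ _ _ _ H.y gy_pow H.tr_y)
  have hZ1 := (pow_eq_one_iff_of_trace H.z htr).2 (hpow _ _ _ _ H.z gz_pow H.tr_z)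
  obtain ⟨φ, hx, hy, hz, hh⟩ := exists_pi1_hom (a := a) (c := c) hX1 hY1
    (Z := (X * Y)⁻¹) (r := r) (by rw [inv_pow, hZ1, inv_one]) (mul_inv_cancel _)
  refine ⟨φ, ⟨H.x, H.y, H.z, by rw [hx, trX], by rw [hy, trY], ?_, hh⟩, ?_⟩
  · rw [hz, coe_inv_SU, trace_conjTranspose, htr]
    simp
  · rw [repCoords, hx, hy, hco]

/-- The coordinates as a function on the representation variety. -/
def clsCoords (ζ ξ : ℂ) : RepVariety p q r a c → ℝ × ℝ × ℝ :=
  Quotient.lift (repCoords ζ ξ) (by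
    rintro α β ⟨g, hg⟩
    rw [repCoords, repCoords, hg, hg, coords_conj])

theorem continuous_repCoords (ζ ξ : ℂ) :
    Continuous (repCoords ζ ξ : Reps p q r a c → ℝ × ℝ × ℝ) := by
  have h : Continuous fun α : Reps p q r a c =>
      ((α (gx p q r a c) : Matrix (Fin 3) (Fin 3) ℂ),
        (α (gy p q r a c) : Matrix (Fin 3) (Fin 3) ℂ)) :=
    (continuous_rep_coe _).prodMk (continuous_rep_coe _)
  have h2 := Continuous.comp (continuous_coords ζ ξ) h
  exact h2

theorem continuous_clsCoords (ζ ξ : ℂ) :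
    Continuous (clsCoords ζ ξ : RepVariety p q r a c → ℝ × ℝ × ℝ) :=
  Continuous.quotient_lift (continuous_repCoords ζ ξ) _

/-- The classes with the traces of a nontrivial reducible representation that kills the regular
fibre form a sphere. -/
theorem level_homeo (hp : 0 < p) (hq : 0 < q) (hr : 0 < r) (hpq : p.Coprime q)
    (hqr : q.Coprime r) (hpr : p.Coprime r) (hac : a * r * (p + q) + c * p * q = 1)
    {α : Reps p q r a c} (hα : Red α) (hne : α ≠ 1) (hh : α (gh p q r a c) = 1) :
    Nonempty (level (cls α) ≃ₜ Metric.sphere (0 : EuclideanSpace ℝ (Fin 3)) 1) := by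
  obtain ⟨ζ, ξ, ω, H⟩ := exists_hasAngles hpq hqr hpr hac hα hne hh
  have hδ := H.offset_lt hpq hqr hpr hac hα hne
  obtain ⟨Ψ, hΨc, hΨb⟩ := exists_surface_sphere (loRatio_mul H.x H.y) (loRatio_pos H.x H.y)
    loRatio_le (slopeCoeff_pos H.x H.y) hδ
  have hmem : ∀ η : level (cls α), clsCoords ζ ξ η.1 ∈ surface ζ ξ ω := by
    rintro ⟨η, hη⟩
    obtain ⟨α', rfl⟩ := exists_cls_eq η
    obtain ⟨V, W, hV, hW, hX, hY, hc⟩ := (H.of_mem_level hη).exists_gram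
    exact hc.mem_surface H.x H.y
  let Φ : level (cls α) → surface ζ ξ ω := fun η => ⟨clsCoords ζ ξ η.1, hmem η⟩
  have hΦc : Continuous Φ := Continuous.subtype_mk
    ((continuous_clsCoords ζ ξ).comp continuous_subtype_val) _
  have hΦb : Function.Bijective Φ := by
    constructor
    · rintro ⟨η, hη⟩ ⟨η', hη'⟩ heq
      obtain ⟨α₁, rfl⟩ := exists_cls_eq η
      obtain ⟨α₂, rfl⟩ := exists_cls_eq η'
      exact Subtype.ext ((H.of_mem_level hη).cls_eq_of_repCoords hpq hqr hpr hac hδ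
        (H.of_mem_level hη') (congrArg Subtype.val heq))
    · rintro ⟨w, hw⟩
      obtain ⟨α', H', hw'⟩ := H.exists_rep hδ hw
      exact ⟨⟨cls α', H.mem_level H'⟩, Subtype.ext hw'⟩
  have : CompactSpace (level (cls α)) :=
    isCompact_iff_compactSpace.1 (isClopen_level hp hq hr hpq hqr hpr hac _).isClosed.isCompact
  exact ⟨(hΨc.comp hΦc).homeoOfEquivCompactToT2 (f := Equiv.ofBijective _ (hΨb.comp hΦb))⟩

theorem mem_level_self (ξ : RepVariety p q r a c) : ξ ∈ level ξ := fun _ => rfl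

theorem isPathConnected_sphere_two :
    IsPathConnected (Metric.sphere (0 : EuclideanSpace ℝ (Fin 3)) 1) := by
  refine isPathConnected_sphere ?_ _ zero_le_one
  rw [rank_eq_card_basis (EuclideanSpace.basisFun (Fin 3) ℝ).toBasis, Fintype.card_fin]
  norm_num

theorem level_eq_pathComponent (hp : 0 < p) (hq : 0 < q) (hr : 0 < r) (hpq : p.Coprime q)
    (hqr : q.Coprime r) (hpr : p.Coprime r) (hac : a * r * (p + q) + c * p * q = 1)
    {α : Reps p q r a c} (hα : Red α) (hne : α ≠ 1) (hh : α (gh p q r a c) = 1) :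
    pathComponent (cls α) = level (cls α) := by
  obtain ⟨e⟩ := level_homeo hp hq hr hpq hqr hpr hac hα hne hh
  refine Set.Subset.antisymm (pathComponent_subset_level hp hq hr hpq hqr hpr hac _) ?_
  have h2 : PathConnectedSpace (level (cls α)) := by
    have := isPathConnected_iff_pathConnectedSpace.1 isPathConnected_sphere_two
    exact e.symm.surjective.pathConnectedSpace e.symm.continuous
  exact (isPathConnected_iff_pathConnectedSpace.2 h2).subset_pathComponent (mem_level_self _)

/-- Each of these spheres contains a single reducible class, the one with coordinates
`(0, 0, 0)`. -/
theorem cls_eq_of_red (hpq : p.Coprime q)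
    (hqr : q.Coprime r) (hpr : p.Coprime r) (hac : a * r * (p + q) + c * p * q = 1)
    {α α' : Reps p q r a c} (hα : Red α) (hne : α ≠ 1) (hh : α (gh p q r a c) = 1)
    (h : cls α' ∈ level (cls α)) (hα' : Red α') : cls α' = cls α := by
  obtain ⟨ζ, ξ, ω, H⟩ := exists_hasAngles hpq hqr hpr hac hα hne hh
  have H' := H.of_mem_level h
  exact H'.cls_eq_of_repCoords hpq hqr hpr hac (H.offset_lt hpq hqr hpr hac hα hne) H
    ((H'.repCoords_eq_zero hpq hqr hpr hac hα').trans
      (H.repCoords_eq_zero hpq hqr hpr hac hα).symm)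

end Level

end

noncomputable section

open groupCohomology Module

/-! ### First group cohomology -/

section Cohomology

variable {k G V : Type} [Field k] [Group G] [AddCommGroup V] [Module k V]

/-- The space of `1`-cocycles of a representation. -/
def oneCocycles (ρ : Representation k G V) : Submodule k (G → V) where
  carrier := {f | ∀ g h, f (g * h) = ρ g (f h) + f g}
  zero_mem' := by simp
  add_mem' := by
    intro f f' hf hf' g h
    simp only [Pi.add_apply, hf g h, hf' g h, map_add]
    abel
  smul_mem' := by
    intro t f hf g h
    simp only [Pi.smul_apply, hf g h, map_smul, smul_add]

/-- The coboundary of a vector. -/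
def oneCoboundary (ρ : Representation k G V) : V →ₗ[k] oneCocycles ρ where
  toFun m := ⟨fun g => ρ g m - m, fun g h => by
    simp only [map_mul, Module.End.mul_apply, map_sub]
    abel⟩
  map_add' m n := by
    apply Subtype.ext
    funext g
    change ρ g (m + n) - (m + n) = (ρ g m - m) + (ρ g n - n)
    rw [map_add]
    abel
  map_smul' t m := by
    apply Subtype.ext
    funext g
    change ρ g (t • m) - t • m = t • (ρ g m - m)
    rw [map_smul, smul_sub]

theorem oneCoboundary_apply (ρ : Representation k G V) (m : V) (g : G) :
    (oneCoboundary ρ m : G → V) g = ρ g m - m := rfl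

theorem ker_oneCoboundary (ρ : Representation k G V) :
    LinearMap.ker (oneCoboundary ρ) = ρ.invariants := by
  ext m
  rw [LinearMap.mem_ker, Representation.mem_invariants]
  constructor
  · intro h g
    have := congrFun (congrArg Subtype.val h) g
    exact sub_eq_zero.1 this
  · intro h
    apply Subtype.ext
    funext g
    exact sub_eq_zero.2 (h g)

/-- The class of a cocycle. -/
def classMap (ρ : Representation k G V) : oneCocycles ρ →ₗ[k] H1 (Rep.of ρ) where
  toFun f := (H1π (Rep.of ρ)).hom ⟨f.1, (mem_cocycles₁_iff (A := Rep.of ρ) f.1).2 f.2⟩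
  map_add' f f' := by
    rw [← map_add]
    rfl
  map_smul' t f := by
    rw [RingHom.id_apply, ← map_smul]
    rfl

theorem classMap_surjective (ρ : Representation k G V) :
    Function.Surjective (classMap ρ) := by
  intro x
  obtain ⟨f, hf⟩ := (ModuleCat.epi_iff_surjective (H1π (Rep.of ρ))).1 inferInstance x
  exact ⟨⟨f.1, (mem_cocycles₁_iff (A := Rep.of ρ) f.1).1 f.2⟩, hf⟩

theorem ker_classMap (ρ : Representation k G V) :
    LinearMap.ker (classMap ρ) = LinearMap.range (oneCoboundary ρ) := by
  ext f
  rw [LinearMap.mem_ker]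
  refine (H1π_eq_zero_iff (A := Rep.of ρ)
    ⟨f.1, (mem_cocycles₁_iff (A := Rep.of ρ) f.1).2 f.2⟩).trans ?_
  constructor
  · rintro ⟨m, hm⟩
    exact ⟨m, Subtype.ext hm⟩
  · rintro ⟨m, hm⟩
    exact ⟨m, congrArg Subtype.val hm⟩

/-- `dim H¹ + dim V = dim Z¹ + dim H⁰`. -/
theorem finrank_H1 (ρ : Representation k G V) [FiniteDimensional k V]
    [FiniteDimensional k (oneCocycles ρ)] :
    finrank k (H1 (Rep.of ρ)) + finrank k V
      = finrank k (oneCocycles ρ) + finrank k ρ.invariants := by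
  have h1 := (classMap ρ).finrank_range_add_finrank_ker
  have h2 := (oneCoboundary ρ).finrank_range_add_finrank_ker
  rw [LinearMap.range_eq_top.2 (classMap_surjective ρ), finrank_top, ker_classMap] at h1
  rw [ker_oneCoboundary] at h2
  omega

theorem nontrivial_H1_iff (ρ : Representation k G V) :
    Nontrivial (H1 (Rep.of ρ)) ↔ ¬ Function.Surjective (oneCoboundary ρ) := by
  rw [← LinearMap.range_eq_top, ← ker_classMap, LinearMap.ker_eq_top,
    ← not_subsingleton_iff_nontrivial,
    not_iff_not]
  constructor
  · intro h
    exact LinearMap.ext fun f => Subsingleton.elim _ _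
  · intro h
    refine ⟨fun x y => ?_⟩
    obtain ⟨f, rfl⟩ := classMap_surjective ρ x
    obtain ⟨f', rfl⟩ := classMap_surjective ρ y
    rw [h]
    rfl

variable {ρ : Representation k G V}

theorem cocycle_mul (f : oneCocycles ρ) (g h : G) : f.1 (g * h) = ρ g (f.1 h) + f.1 g := f.2 g h

theorem cocycle_one (f : oneCocycles ρ) : f.1 1 = 0 := by
  have := cocycle_mul f 1 1
  rw [mul_one, map_one, Module.End.one_apply] at this
  exact left_eq_add.1 this

theorem cocycle_inv (f : oneCocycles ρ) {g : G} (hg : f.1 g = 0) : f.1 g⁻¹ = 0 := by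
  have := cocycle_mul f g⁻¹ g
  rwa [inv_mul_cancel, cocycle_one, hg, map_zero, zero_add, eq_comm] at this

theorem cocycle_zpow (f : oneCocycles ρ) {g : G} (hg : f.1 g = 0) (n : ℤ) : f.1 (g ^ n) = 0 := by
  have hnat : ∀ n : ℕ, f.1 (g ^ n) = 0 := by
    intro n
    induction n with
    | zero => rw [pow_zero, cocycle_one]
    | succ n ih => rw [pow_succ, cocycle_mul, hg, ih, map_zero, add_zero]
  cases n with
  | ofNat n => simpa using hnat n
  | negSucc n =>
    rw [zpow_negSucc]
    exact cocycle_inv f (hnat _)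

/-- A cocycle that vanishes on a power of `g` is a coboundary on `⟨g⟩`, by averaging. -/
theorem exists_coboundary_of_pow [CharZero k] (f : oneCocycles ρ) {g : G} {n : ℕ} (hn : 0 < n)
    (hg : f.1 (g ^ n) = 0) : ∃ m, f.1 g = ρ g m - m := by
  have hn' : (n : k) ≠ 0 := by exact_mod_cast hn.ne'
  set S : V := ∑ i ∈ Finset.range n, f.1 (g ^ i) with hS
  have h1 : ρ g S + n • f.1 g = S := by
    calc ρ g S + n • f.1 g = ∑ i ∈ Finset.range n, (ρ g (f.1 (g ^ i)) + f.1 g) := by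
          rw [Finset.sum_add_distrib, Finset.sum_const, Finset.card_range, hS, map_sum]
      _ = ∑ i ∈ Finset.range n, f.1 (g ^ (i + 1)) := by
          refine Finset.sum_congr rfl fun i _ => ?_
          rw [pow_succ', cocycle_mul]
      _ = S := by
          have h2 := Finset.sum_range_succ (fun i => f.1 (g ^ i)) n
          rw [Finset.sum_range_succ', pow_zero, cocycle_one, hg] at h2
          simpa using h2
  refine ⟨-((n : k)⁻¹ • S), ?_⟩
  rw [map_neg, map_smul, sub_neg_eq_add, neg_add_eq_sub, ← smul_sub]
  have h3 : S - ρ g S = (n : k) • f.1 g := by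
    rw [Nat.cast_smul_eq_nsmul, sub_eq_iff_eq_add, add_comm]
    exact h1.symm
  rw [h3, inv_smul_smul₀ hn']

end Cohomology

/-! ### Cohomology of the fundamental group -/

section Fox

variable {p q r : ℕ} {a c : ℤ} {k V : Type} [Field k] [AddCommGroup V] [Module k V]

/-- The linear map `(w₁, w₂, w₃) ↦ (x - 1) w₁ + x (y - 1) w₂ + x y (z - 1) w₃`, the Fox derivative
of the relation `x y z = 1` on cocycles that are coboundaries on the cyclic groups generated by `x`,
`y`, `z`. -/
def foxMap (ρ : Representation k (Pi1 p q r a c) V) : V × V × V →ₗ[k] V :=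
  (ρ (gx p q r a c) - 1) ∘ₗ LinearMap.fst k V (V × V) +
    (ρ (gx p q r a c) ∘ₗ (ρ (gy p q r a c) - 1)) ∘ₗ
      (LinearMap.fst k V V ∘ₗ LinearMap.snd k V (V × V)) +
    (ρ (gx p q r a c) ∘ₗ ρ (gy p q r a c) ∘ₗ (ρ (gz p q r a c) - 1)) ∘ₗ
      (LinearMap.snd k V V ∘ₗ LinearMap.snd k V (V × V))

theorem foxMap_apply (ρ : Representation k (Pi1 p q r a c) V) (w : V × V × V) :
    foxMap ρ w = (ρ (gx p q r a c) w.1 - w.1)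
      + ρ (gx p q r a c) (ρ (gy p q r a c) w.2.1 - w.2.1)
      + ρ (gx p q r a c) (ρ (gy p q r a c) (ρ (gz p q r a c) w.2.2 - w.2.2)) := rfl

/-- The map `(x - 1) × (y - 1) × (z - 1)`, which sends coboundary data on the three cyclic groups to
the values on the generators. -/
def genMap (ρ : Representation k (Pi1 p q r a c) V) : V × V × V →ₗ[k] V × V × V :=
  (ρ (gx p q r a c) - 1).prodMap ((ρ (gy p q r a c) - 1).prodMap (ρ (gz p q r a c) - 1))

theorem genMap_apply (ρ : Representation k (Pi1 p q r a c) V) (w : V × V × V) :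
    genMap ρ w = (ρ (gx p q r a c) w.1 - w.1, ρ (gy p q r a c) w.2.1 - w.2.1,
      ρ (gz p q r a c) w.2.2 - w.2.2) := rfl

/-- The values of a cocycle on the generators `x`, `y`, `z`. -/
def evalMap (ρ : Representation k (Pi1 p q r a c) V) : oneCocycles ρ →ₗ[k] V × V × V where
  toFun f := (f.1 (gx p q r a c), f.1 (gy p q r a c), f.1 (gz p q r a c))
  map_add' _ _ := rfl
  map_smul' _ _ := rfl

theorem cocycle_eq_zero {ρ : Representation k (Pi1 p q r a c) V} {f : oneCocycles ρ}
    (hx : f.1 (gx p q r a c) = 0) (hy : f.1 (gy p q r a c) = 0) (hh : f.1 (gh p q r a c) = 0) :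
    f = 0 := by
  apply Subtype.ext
  funext g
  refine pi1_induction (P := fun g => f.1 g = 0) hx hy hh (cocycle_one f) ?_ ?_ g
  · intro g k h1 h2
    rw [cocycle_mul, h1, h2, map_zero, add_zero]
  · intro g h
    exact cocycle_inv f h

instance finiteDimensional_oneCocycles [FiniteDimensional k V]
    (ρ : Representation k (Pi1 p q r a c) V) : FiniteDimensional k (oneCocycles ρ) := by
  let L : oneCocycles ρ →ₗ[k] V × V × V :=
    { toFun := fun f => (f.1 (gx p q r a c), f.1 (gy p q r a c), f.1 (gh p q r a c))
      map_add' := fun _ _ => rfl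
      map_smul' := fun _ _ => rfl }
  refine FiniteDimensional.of_injective L ?_
  rw [← LinearMap.ker_eq_bot, LinearMap.ker_eq_bot']
  intro f hf
  exact cocycle_eq_zero (congrArg Prod.fst hf) (congrArg (fun w => w.2.1) hf)
    (congrArg (fun w => w.2.2) hf)

/-- Cocycles with prescribed values on the generators. Affine transformations of `V` with linear
parts `x`, `y`, `z`, each with a fixed point, satisfy the relations as soon as their product is the
identity. -/
theorem map_ker_le_range (ρ : Representation k (Pi1 p q r a c) V)
    (hh : ρ (gh p q r a c) = 1) :
    (LinearMap.ker (foxMap ρ)).map (genMap ρ) ≤ LinearMap.range (evalMap ρ) := by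
  rintro _ ⟨⟨w₁, w₂, w₃⟩, hw, rfl⟩
  have hw0 : foxMap ρ (w₁, w₂, w₃) = 0 := hw
  rw [foxMap_apply] at hw0
  simp only at hw0
  let lin : Pi1 p q r a c →* Equiv.Perm V :=
    { toFun := fun g => ⟨ρ g, ρ g⁻¹,
        fun v => by rw [← Module.End.mul_apply, ← map_mul, inv_mul_cancel, map_one]; rfl,
        fun v => by rw [← Module.End.mul_apply, ← map_mul, mul_inv_cancel, map_one]; rfl⟩
      map_one' := Equiv.ext fun v => by
        change ρ 1 v = v
        rw [map_one]; rfl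
      map_mul' := fun g h => Equiv.ext fun v => by
        change ρ (g * h) v = ρ g (ρ h v)
        rw [map_mul]; rfl }
  have hlin : ∀ g v, lin g v = ρ g v := fun g v => rfl
  -- the affine map with linear part `g` and fixed point `-w`
  let tr : V → Pi1 p q r a c → Equiv.Perm V := fun w g =>
    (Equiv.addRight w)⁻¹ * lin g * Equiv.addRight w
  have htr : ∀ w g v, tr w g v = ρ g v + (ρ g w - w) := by
    intro w g v
    have : tr w g v = ρ g (v + w) - w := by
      change (Equiv.addRight w)⁻¹ (ρ g (v + w)) = _
      rw [Equiv.Perm.inv_def, Equiv.addRight_symm]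
      exact (sub_eq_add_neg _ _).symm
    rw [this, map_add]
    abel
  have hpow : ∀ w g (n : ℕ) (m : ℤ), g ^ n = gh p q r a c ^ m → tr w g ^ n = 1 := by
    intro w g n m hg
    have hh1 : lin (gh p q r a c) = 1 := Equiv.ext fun v => by
      rw [hlin, hh]; rfl
    have : tr w g ^ n = (Equiv.addRight w)⁻¹ * lin g ^ n * Equiv.addRight w := by
      have := conj_pow (i := n) (a := (Equiv.addRight w)⁻¹) (b := lin g)
      rwa [inv_inv] at this
    rw [this, ← map_pow, hg, map_zpow, hh1, one_zpow, mul_one, inv_mul_cancel]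
  have hxyz : tr w₁ (gx p q r a c) * tr w₂ (gy p q r a c) * tr w₃ (gz p q r a c) = 1 := by
    refine Equiv.ext fun v => ?_
    rw [Equiv.Perm.mul_apply, Equiv.Perm.mul_apply, htr, htr, htr, map_add, map_add, map_add]
    have h1 : ρ (gx p q r a c) (ρ (gy p q r a c) (ρ (gz p q r a c) v)) = v := by
      rw [← Module.End.mul_apply, ← Module.End.mul_apply, ← map_mul, ← map_mul,
        gx_mul_gy_mul_gz, map_one]
      rfl
    rw [h1, Equiv.Perm.one_apply]
    calc _ = v + ((ρ (gx p q r a c) w₁ - w₁)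
          + ρ (gx p q r a c) (ρ (gy p q r a c) w₂ - w₂)
          + ρ (gx p q r a c) (ρ (gy p q r a c) (ρ (gz p q r a c) w₃ - w₃))) := by abel
      _ = v := by rw [hw0, add_zero]
  obtain ⟨φ, hφx, hφy, hφz, hφh⟩ := exists_pi1_hom (a := a) (c := c)
    (hpow w₁ _ p _ gx_pow) (hpow w₂ _ q _ gy_pow) (hpow w₃ _ r _ gz_pow) hxyz
  have haff : ∀ g v, φ g v = ρ g v + φ g 0 := by
    intro g
    refine pi1_induction (P := fun g => ∀ v, φ g v = ρ g v + φ g 0) ?_ ?_ ?_ ?_ ?_ ?_ g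
    · intro v
      rw [hφx, htr, htr, map_zero, zero_add]
    · intro v
      rw [hφy, htr, htr, map_zero, zero_add]
    · intro v
      rw [hφh, hh]
      simp
    · intro v
      simp
    · intro g h hg hh v
      rw [map_mul, Equiv.Perm.mul_apply, Equiv.Perm.mul_apply, hh v, hg, hg (φ h 0), map_add,
        map_mul, Module.End.mul_apply]
      abel
    · intro g hg v
      have h1 := hg (φ g⁻¹ v)
      have h2 := hg (φ g⁻¹ 0)
      rw [← Equiv.Perm.mul_apply, ← map_mul, mul_inv_cancel, map_one, Equiv.Perm.one_apply] at h1 h2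
      have h3 : ∀ u, ρ g⁻¹ (ρ g u) = u := fun u => by
        rw [← Module.End.mul_apply, ← map_mul, inv_mul_cancel, map_one]; rfl
      have h4 : v = ρ g (φ g⁻¹ v - φ g⁻¹ 0) := by
        rw [map_sub]
        calc v = (ρ g (φ g⁻¹ v) + φ g 0) - (ρ g (φ g⁻¹ 0) + φ g 0) := by
              rw [← h1, ← h2, sub_zero]
          _ = _ := by abel
      conv_rhs => rw [h4]
      rw [h3, sub_add_cancel]
  refine ⟨⟨fun g => φ g 0, fun g h => ?_⟩, ?_⟩
  · change φ (g * h) 0 = ρ g (φ h 0) + φ g 0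
    rw [map_mul, Equiv.Perm.mul_apply, haff g (φ h 0)]
  · change (φ (gx p q r a c) 0, φ (gy p q r a c) 0, φ (gz p q r a c) 0) = _
    rw [hφx, hφy, hφz, htr, htr, htr, genMap_apply]
    simp

theorem foxMap_eq_zero {ρ : Representation k (Pi1 p q r a c) V} (f : oneCocycles ρ)
    {w : V × V × V} (hw : evalMap ρ f = genMap ρ w) : foxMap ρ w = 0 := by
  have h1 : f.1 (gx p q r a c) = ρ (gx p q r a c) w.1 - w.1 := congrArg Prod.fst hw
  have h2 : f.1 (gy p q r a c) = ρ (gy p q r a c) w.2.1 - w.2.1 := congrArg (fun w => w.2.1) hw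
  have h3 : f.1 (gz p q r a c) = ρ (gz p q r a c) w.2.2 - w.2.2 := congrArg (fun w => w.2.2) hw
  rw [foxMap_apply, ← h1, ← h2, ← h3]
  have h4 := cocycle_mul f (gx p q r a c * gy p q r a c) (gz p q r a c)
  rw [gx_mul_gy_mul_gz, cocycle_one, cocycle_mul, map_mul, Module.End.mul_apply] at h4
  rw [h4]
  abel

/-- Without invariants, the cocycles are exactly those constructed above. -/
theorem range_evalMap [CharZero k] (hp : 0 < p) (hq : 0 < q) (hr : 0 < r)
    {ρ : Representation k (Pi1 p q r a c) V}
    (hh : ρ (gh p q r a c) = 1) (hinv : ρ.invariants = ⊥) :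
    LinearMap.range (evalMap ρ) = (LinearMap.ker (foxMap ρ)).map (genMap ρ) ∧
      Function.Injective (evalMap ρ) := by
  have hfh : ∀ f : oneCocycles ρ, f.1 (gh p q r a c) = 0 := by
    intro f
    have h1 : f.1 (gh p q r a c) ∈ ρ.invariants := by
      rw [Representation.mem_invariants]
      intro g
      have h2 := cocycle_mul f g (gh p q r a c)
      rw [← (commute_gh g).eq, cocycle_mul, hh, Module.End.one_apply, add_comm] at h2
      exact (add_right_cancel h2).symm
    rwa [hinv, Submodule.mem_bot] at h1
  constructor
  · refine le_antisymm ?_ (map_ker_le_range ρ hh)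
    rintro _ ⟨f, rfl⟩
    have hz := fun n => cocycle_zpow f (hfh f) n
    obtain ⟨w₁, h1⟩ := exists_coboundary_of_pow f hp (by rw [gx_pow, hz])
    obtain ⟨w₂, h2⟩ := exists_coboundary_of_pow f hq (by rw [gy_pow, hz])
    obtain ⟨w₃, h3⟩ := exists_coboundary_of_pow f hr (by rw [gz_pow, hz])
    have hw : evalMap ρ f = genMap ρ (w₁, w₂, w₃) :=
      Prod.ext h1 (Prod.ext h2 h3)
    exact ⟨(w₁, w₂, w₃), foxMap_eq_zero f hw, hw.symm⟩
  · rw [← LinearMap.ker_eq_bot, LinearMap.ker_eq_bot']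
    intro f hf
    exact cocycle_eq_zero (congrArg Prod.fst hf) (congrArg (fun w => w.2.1) hf) (hfh f)

theorem ker_genMap_le (ρ : Representation k (Pi1 p q r a c) V) :
    LinearMap.ker (genMap ρ) ≤ LinearMap.ker (foxMap ρ) := by
  intro w hw
  have h0 : genMap ρ w = 0 := hw
  rw [genMap_apply] at h0
  have h1 : ρ (gx p q r a c) w.1 - w.1 = 0 := congrArg Prod.fst h0
  have h2 : ρ (gy p q r a c) w.2.1 - w.2.1 = 0 := congrArg (fun w => w.2.1) h0
  have h3 : ρ (gz p q r a c) w.2.2 - w.2.2 = 0 := congrArg (fun w => w.2.2) h0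
  rw [LinearMap.mem_ker, foxMap_apply, h1, h2, h3]
  simp

theorem finrank_submodule_prod {V W : Type} [AddCommGroup V] [Module k V] [AddCommGroup W]
    [Module k W] [FiniteDimensional k V] [FiniteDimensional k W] (s : Submodule k V)
    (t : Submodule k W) : finrank k (s.prod t) = finrank k s + finrank k t := by
  have h : LinearMap.range (s.subtype.prodMap t.subtype) = s.prod t := by
    ext ⟨v, w⟩
    simp [Submodule.mem_prod]
  rw [← h, LinearMap.finrank_range_of_inj, finrank_prod]
  exact Function.Injective.prodMap s.injective_subtype t.injective_subtype

theorem finrank_ker_genMap [FiniteDimensional k V] (ρ : Representation k (Pi1 p q r a c) V) :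
    finrank k (LinearMap.ker (genMap ρ)) = finrank k (LinearMap.ker (ρ (gx p q r a c) - 1))
      + finrank k (LinearMap.ker (ρ (gy p q r a c) - 1))
      + finrank k (LinearMap.ker (ρ (gz p q r a c) - 1)) := by
  rw [genMap, LinearMap.ker_prodMap, LinearMap.ker_prodMap, finrank_submodule_prod,
    finrank_submodule_prod, add_assoc]

/-- The dimension of the space of cocycles constructed above. -/
theorem finrank_map_ker [FiniteDimensional k V] (ρ : Representation k (Pi1 p q r a c) V) :
    finrank k ((LinearMap.ker (foxMap ρ)).map (genMap ρ))
      + finrank k (LinearMap.range (foxMap ρ))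
      + (finrank k (LinearMap.ker (ρ (gx p q r a c) - 1))
        + finrank k (LinearMap.ker (ρ (gy p q r a c) - 1))
        + finrank k (LinearMap.ker (ρ (gz p q r a c) - 1))) = 3 * finrank k V := by
  rw [← finrank_ker_genMap]
  have h1 := (foxMap ρ).finrank_range_add_finrank_ker
  have h2 := ((genMap ρ).domRestrict (LinearMap.ker (foxMap ρ))).finrank_range_add_finrank_ker
  rw [LinearMap.range_domRestrict, LinearMap.ker_domRestrict,
    (Submodule.comapSubtypeEquivOfLe (ker_genMap_le ρ)).finrank_eq] at h2
  rw [finrank_prod, finrank_prod] at h1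
  omega

end Fox

end

noncomputable section

open Matrix Module

/-! ### Cohomology with coefficients in `ℂ²` -/

section CoeffC2

variable {p q r : ℕ} {a c : ℤ}

theorem ker_stdRep (β : Pi1 p q r a c →* SU2) {g : Pi1 p q r a c}
    (h1 : (β g : Matrix (Fin 2) (Fin 2) ℂ) ≠ 1) (h2 : (β g : Matrix (Fin 2) (Fin 2) ℂ) ≠ -1) :
    LinearMap.ker (stdRep β g - 1) = ⊥ := by
  obtain ⟨ζ, hζ, htr⟩ := exists_isAngle h1 h2
  rw [LinearMap.ker_eq_bot']
  intro v hv
  by_contra hv0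
  have hMv : ((β g : Matrix (Fin 2) (Fin 2) ℂ) - 1) *ᵥ v = 0 := by
    rw [sub_mulVec, one_mulVec]
    exact hv
  have hdet := exists_mulVec_eq_zero_iff.1 ⟨v, hv0, hMv⟩
  have hdet1 : (β g : Matrix (Fin 2) (Fin 2) ℂ).det = 1 := (mem_SU_iff.1 (β g).2).2
  rw [det_fin_two] at hdet hdet1
  rw [trace_fin_two] at htr
  simp only [Matrix.sub_apply, one_apply_eq, one_apply_ne (show (0 : Fin 2) ≠ 1 by decide),
    one_apply_ne (show (1 : Fin 2) ≠ 0 by decide), sub_zero] at hdet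
  have h3 : (1 : ℂ) - (ζ.re : ℂ) = 0 := by linear_combination (hdet - hdet1 + htr) / 2
  have h4 : 1 - ζ.re = 0 := by exact_mod_cast h3
  exact hζ.re_lt.ne' h4

/-- A central element that acts by `-1` kills the cohomology. If `h` acts trivially, the cocycle
count gives `dim H¹ ≥ 3 · 2 - 2 - 2`. -/
theorem nontrivial_H1C2_iff (hpq : p.Coprime q) (hqr : q.Coprime r) (hpr : p.Coprime r)
    (hac : a * r * (p + q) + c * p * q = 1) {β : Pi1 p q r a c →* SU2} (hβ : β ≠ 1) :
    Nontrivial (H1C2 β) ↔ β (gh p q r a c) = 1 := by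
  constructor
  · intro hn
    refine (rep_gh_eq hpq hqr hpr hac hβ).resolve_right fun hneg => ?_
    refine (nontrivial_H1_iff _).1 hn fun f => ⟨-((2 : ℂ)⁻¹ • f.1 (gh p q r a c)), ?_⟩
    apply Subtype.ext
    funext g
    have hact : ∀ v, stdRep β (gh p q r a c) v = -v := by
      intro v
      change (β (gh p q r a c) : Matrix (Fin 2) (Fin 2) ℂ) *ᵥ v = -v
      rw [hneg, neg_mulVec, one_mulVec]
    have h1 := cocycle_mul f g (gh p q r a c)
    rw [← (commute_gh g).eq, cocycle_mul, hact] at h1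
    rw [oneCoboundary_apply, map_neg, map_smul, sub_neg_eq_add, neg_add_eq_sub, ← smul_sub]
    have h2 : f.1 (gh p q r a c) - stdRep β g (f.1 (gh p q r a c)) = (2 : ℂ) • f.1 g := by
      rw [two_smul, sub_eq_iff_eq_add]
      calc f.1 (gh p q r a c) = f.1 g + (-f.1 g + f.1 (gh p q r a c)) := by abel
        _ = _ := by rw [h1]; abel
    rw [h2, inv_smul_smul₀ two_ne_zero]
  · intro hh
    have hρ : stdRep β (gh p q r a c) = 1 := by
      refine LinearMap.ext fun v => ?_
      change (β (gh p q r a c) : Matrix (Fin 2) (Fin 2) ℂ) *ᵥ v = v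
      rw [hh, Submonoid.coe_one, one_mulVec]
    have hker : ∀ g, (g = gx p q r a c ∨ g = gy p q r a c ∨ g = gz p q r a c) →
        finrank ℂ (LinearMap.ker (stdRep β g - 1)) = 0 := by
      intro g hg
      obtain ⟨h1, h2⟩ := rep_gen_ne hpq hqr hpr hac hβ hg
      rw [ker_stdRep β h1 h2, finrank_bot]
    have h1 := finrank_map_ker (stdRep β)
    rw [hker _ (Or.inl rfl), hker _ (Or.inr (Or.inl rfl)), hker _ (Or.inr (Or.inr rfl)),
      finrank_fin_fun] at h1
    have h2 := Submodule.finrank_le (LinearMap.range (foxMap (stdRep β)))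
    have h3 := Submodule.finrank_mono (map_ker_le_range (stdRep β) hρ)
    have h4 := LinearMap.finrank_range_le (evalMap (stdRep β))
    have h5 := finrank_H1 (stdRep β)
    rw [finrank_fin_fun] at h2 h5
    have h6 : finrank ℂ (H1C2 β) + 2
      = finrank ℂ (oneCocycles (stdRep β)) + finrank ℂ (stdRep β).invariants := h5
    exact nontrivial_of_finrank_pos (R := ℂ) (by omega)

end CoeffC2

/-! ### Representations with an invariant form -/

section Form

variable {p q r : ℕ} {a c : ℤ} {k V : Type} [Field k] [AddCommGroup V] [Module k V]
  {ρ : Representation k (Pi1 p q r a c) V} {B : V →ₗ[k] V →ₗ[k] k}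

/-- Invariants are orthogonal to the range of `foxMap`. -/
theorem form_foxMap (hB : ∀ g v w, B (ρ g v) (ρ g w) = B v w) {ψ : V} (hψ : ψ ∈ ρ.invariants)
    (w : V × V × V) : B ψ (foxMap ρ w) = 0 := by
  have h1 : ∀ g w, B ψ (ρ g w) = B ψ w := by
    intro g w
    conv_lhs => rw [← (Representation.mem_invariants _ _).1 hψ g]
    exact hB g ψ w
  rw [foxMap_apply]
  simp only [map_add, map_sub, h1, sub_self, add_zero]

/-- The orthogonal complement of the range of `foxMap` consists of invariants. -/
theorem mem_invariants_of_form (hB : ∀ g v w, B (ρ g v) (ρ g w) = B v w)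
    (hB0 : ∀ v, B v v = 0 → v = 0) (hh : ρ (gh p q r a c) = 1) {ψ : V}
    (hψ : ∀ w, B ψ (foxMap ρ w) = 0) : ψ ∈ ρ.invariants := by
  have hinv : ∀ g, ρ g ψ = ψ → ρ g⁻¹ ψ = ψ := by
    intro g hg
    conv_lhs => rw [← hg]
    rw [← Module.End.mul_apply, ← map_mul, inv_mul_cancel, map_one]
    rfl
  have key : ∀ g, (∀ w, B ψ (ρ g w - w) = 0) → ρ g ψ = ψ := by
    intro g hg
    have h1 : ρ g⁻¹ ψ = ψ := by
      refine sub_eq_zero.1 (hB0 _ ?_)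
      have h2 : ∀ w, B (ρ g⁻¹ ψ - ψ) w = 0 := by
        intro w
        have h3 := hB g (ρ g⁻¹ ψ) w
        rw [← Module.End.mul_apply, ← map_mul, mul_inv_cancel, map_one, Module.End.one_apply] at h3
        rw [map_sub, LinearMap.sub_apply, ← h3, ← map_sub, hg]
      exact h2 _
    have := hinv _ h1
    rwa [inv_inv] at this
  have hx : ρ (gx p q r a c) ψ = ψ := by
    refine key _ fun w => ?_
    have := hψ (w, 0, 0)
    rw [foxMap_apply] at this
    simpa using this
  have hy : ρ (gy p q r a c) ψ = ψ := by
    refine key _ fun w => ?_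
    have h1 := hψ (0, w, 0)
    rw [foxMap_apply] at h1
    have h2 := hB (gx p q r a c) ψ (ρ (gy p q r a c) w - w)
    rw [hx] at h2
    rw [← h2]
    simpa using h1
  rw [Representation.mem_invariants]
  intro g
  refine pi1_induction (P := fun g => ρ g ψ = ψ) hx hy ?_ ?_ ?_ hinv g
  · rw [hh]; rfl
  · rw [map_one]; rfl
  · intro g k h1 h2
    rw [map_mul, Module.End.mul_apply, h2, h1]

theorem range_foxMap_eq_top [FiniteDimensional k V] (hB : ∀ g v w, B (ρ g v) (ρ g w) = B v w)
    (hB0 : ∀ v, B v v = 0 → v = 0) (hh : ρ (gh p q r a c) = 1) (hinv : ρ.invariants = ⊥) :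
    LinearMap.range (foxMap ρ) = ⊤ := by
  by_contra htop
  obtain ⟨φ, hφ0, hφ⟩ := Submodule.exists_le_ker_of_lt_top _ (lt_top_iff_ne_top.2 htop)
  have hinj : Function.Injective B := by
    rw [← LinearMap.ker_eq_bot, LinearMap.ker_eq_bot']
    intro v hv
    exact hB0 v (by rw [hv]; rfl)
  have hsurj : Function.Surjective B :=
    (LinearMap.injective_iff_surjective_of_finrank_eq_finrank
      (Subspace.dual_finrank_eq (K := k) (V := V)).symm).1 hinj
  obtain ⟨ψ, rfl⟩ := hsurj φ
  have h1 : ψ ∈ ρ.invariants := mem_invariants_of_form hB hB0 hh fun w => hφ ⟨w, rfl⟩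
  rw [hinv, Submodule.mem_bot] at h1
  exact hφ0 (by rw [h1, map_zero])

theorem finrank_range_foxMap_lt [FiniteDimensional k V]
    (hB : ∀ g v w, B (ρ g v) (ρ g w) = B v w)
    (hB0 : ∀ v, B v v = 0 → v = 0) (hinv : ρ.invariants ≠ ⊥) :
    finrank k (LinearMap.range (foxMap ρ)) < finrank k V := by
  obtain ⟨ψ, hψ, hψ0⟩ := Submodule.exists_mem_ne_zero_of_ne_bot hinv
  refine Submodule.finrank_lt fun htop => hψ0 (hB0 _ ?_)
  obtain ⟨w, hw⟩ : ψ ∈ LinearMap.range (foxMap ρ) := htop ▸ Submodule.mem_top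
  have := form_foxMap hB hψ w
  rwa [hw] at this

end Form

/-! ### Cohomology with coefficients in `su(3)` -/

section CoeffSu3

variable {p q r : ℕ} {a c : ℤ}

/-- The invariant inner product on `su(3)`. -/
def su3Form : su3 →ₗ[ℝ] su3 →ₗ[ℝ] ℝ :=
  LinearMap.mk₂ ℝ (fun X Y : su3 => (((X : Matrix (Fin 3) (Fin 3) ℂ)ᴴ *
      (Y : Matrix (Fin 3) (Fin 3) ℂ)).trace).re)
    (by intro X X' Y; simp [add_mul])
    (by intro t X Y; simp)
    (by intro X Y Y'; simp [mul_add])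
    (by intro t X Y; simp)

theorem su3Form_adRep (α : Reps p q r a c) (γ : Pi1 p q r a c) (X Y : su3) :
    su3Form (adRep α γ X) (adRep α γ Y) = su3Form X Y := by
  set g := (α γ : Matrix (Fin 3) (Fin 3) ℂ) with hg
  have hgg : gᴴ * g = 1 := conjTranspose_mul_self_SU _
  change (((g * (X : Matrix (Fin 3) (Fin 3) ℂ) * gᴴ)ᴴ *
      (g * (Y : Matrix (Fin 3) (Fin 3) ℂ) * gᴴ)).trace).re = (((X : Matrix (Fin 3) (Fin 3) ℂ)ᴴ *
      (Y : Matrix (Fin 3) (Fin 3) ℂ)).trace).re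
  have e : (g * (X : Matrix (Fin 3) (Fin 3) ℂ) * gᴴ)ᴴ * (g * (Y : Matrix (Fin 3) (Fin 3) ℂ) * gᴴ)
      = g * ((X : Matrix (Fin 3) (Fin 3) ℂ)ᴴ *
        ((gᴴ * g) * (Y : Matrix (Fin 3) (Fin 3) ℂ))) * gᴴ := by
    simp only [conjTranspose_mul, conjTranspose_conjTranspose, mul_assoc]
  rw [e, hgg, one_mul, trace_mul_comm, ← mul_assoc, hgg, one_mul]

open scoped ComplexOrder in
theorem su3Form_definite (X : su3) (h : su3Form X X = 0) : X = 0 := by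
  have h1 : (((X : Matrix (Fin 3) (Fin 3) ℂ)ᴴ * (X : Matrix (Fin 3) (Fin 3) ℂ)).trace).re = 0 := h
  have h2 : (((X : Matrix (Fin 3) (Fin 3) ℂ)ᴴ * (X : Matrix (Fin 3) (Fin 3) ℂ)).trace).im = 0 := by
    rw [← Complex.conj_eq_iff_im, ← RCLike.star_def, ← trace_conjTranspose, conjTranspose_mul,
      conjTranspose_conjTranspose]
  exact Subtype.ext (trace_conjTranspose_mul_self_eq_zero_iff.1 (Complex.ext h1 h2))

theorem su3_entry (X : su3) (i j : Fin 3) :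
    star ((X : Matrix (Fin 3) (Fin 3) ℂ) j i) = -(X : Matrix (Fin 3) (Fin 3) ℂ) i j := by
  have := congrFun (congrFun X.2.1 i) j
  rwa [conjTranspose_apply, Matrix.neg_apply] at this

theorem conjTranspose_diagonal_eq_neg {d : Fin 3 → ℂ} (hd : ∀ i, star (d i) = -d i) :
    (diagonal d)ᴴ = -diagonal d := by
  have h : star d = -d := funext hd
  rw [diagonal_conjTranspose, h, diagonal_neg]
  rfl

theorem finrank_su3 : finrank ℝ su3 = 8 := by
  let e : su3 ≃ₗ[ℝ] ℝ × ℝ × ℂ × ℂ × ℂ :=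
    { toFun := fun X => (((X : Matrix (Fin 3) (Fin 3) ℂ) 0 0).im,
        ((X : Matrix (Fin 3) (Fin 3) ℂ) 1 1).im, (X : Matrix (Fin 3) (Fin 3) ℂ) 0 1,
        (X : Matrix (Fin 3) (Fin 3) ℂ) 0 2, (X : Matrix (Fin 3) (Fin 3) ℂ) 1 2)
      map_add' := fun X Y => by simp
      map_smul' := fun t X => by simp
      invFun := fun w => ⟨!![(w.1 : ℂ) * Complex.I, w.2.2.1, w.2.2.2.1;
          -star w.2.2.1, (w.2.1 : ℂ) * Complex.I, w.2.2.2.2;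
          -star w.2.2.2.1, -star w.2.2.2.2, -((w.1 : ℂ) + w.2.1) * Complex.I], by
        constructor
        · ext i j
          fin_cases i <;> fin_cases j <;> simp [conjTranspose_apply]
        · simp [trace_fin_three]
          ring⟩
      left_inv := fun X => by
        apply Subtype.ext
        have hre : ∀ i, ((X : Matrix (Fin 3) (Fin 3) ℂ) i i).re = 0 := by
          intro i
          have := congrArg Complex.re (su3_entry X i i)
          simp only [RCLike.star_def, Complex.conj_re, Complex.neg_re] at this
          linarith
        have hdiag : ∀ i, ((((X : Matrix (Fin 3) (Fin 3) ℂ) i i).im : ℝ) : ℂ) * Complex.I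
            = (X : Matrix (Fin 3) (Fin 3) ℂ) i i := by
          intro i
          apply Complex.ext <;> simp [hre]
        have htr := X.2.2
        rw [trace_fin_three] at htr
        ext i j
        have hs := su3_entry X
        fin_cases i <;> fin_cases j
        · exact hdiag 0
        · rfl
        · rfl
        · exact neg_eq_iff_eq_neg.2 (hs 1 0)
        · exact hdiag 1
        · rfl
        · exact neg_eq_iff_eq_neg.2 (hs 2 0)
        · exact neg_eq_iff_eq_neg.2 (hs 2 1)
        · change -(_ + _) * Complex.I = (X : Matrix (Fin 3) (Fin 3) ℂ) 2 2
          rw [neg_mul, add_mul, hdiag 0, hdiag 1]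
          linear_combination -htr
      right_inv := fun w => by
        simp }
  rw [e.finrank_eq]
  simp [Complex.finrank_real_complex]

instance : FiniteDimensional ℝ su3 :=
  FiniteDimensional.of_finrank_pos (by rw [finrank_su3]; norm_num)

/-- The centralizer of a regular element is two-dimensional. -/
theorem finrank_ker_adRep {ζ : ℂ} (hζ : IsAngle ζ) (α : Reps p q r a c) (γ : Pi1 p q r a c)
    (htr : (α γ : Matrix (Fin 3) (Fin 3) ℂ).trace = 1 + 2 * (ζ.re : ℂ)) :
    finrank ℝ (LinearMap.ker (adRep α γ - 1)) = 2 := by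
  obtain ⟨V, hV, hαV⟩ := exists_diagonalization hζ.unit hζ.im_ne (α γ) htr
  have hVV := _root_.mul_eq_one_comm.1 hV
  have hdg := dg_mul_conjTranspose hζ.unit
  have hdg' := _root_.mul_eq_one_comm.1 hdg
  have hmem : ∀ X : su3, X ∈ LinearMap.ker (adRep α γ - 1) ↔
      (α γ : Matrix (Fin 3) (Fin 3) ℂ) * X * (α γ : Matrix (Fin 3) (Fin 3) ℂ)ᴴ = X := by
    intro X
    rw [LinearMap.mem_ker, LinearMap.sub_apply, sub_eq_zero, Subtype.ext_iff]
    rfl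
  let D : ℝ × ℝ → Matrix (Fin 3) (Fin 3) ℂ := fun w =>
    diagonal ![(w.1 : ℂ) * Complex.I, (w.2 : ℂ) * Complex.I, -((w.1 : ℂ) + w.2) * Complex.I]
  have hDadd : ∀ v w, D (v + w) = D v + D w := by
    intro v w
    simp only [D, diagonal_add]
    congr 1
    funext i
    fin_cases i <;> simp <;> ring
  have hDsmul : ∀ (t : ℝ) w, D (t • w) = t • D w := by
    intro t w
    simp only [D, ← diagonal_smul]
    congr 1
    funext i
    fin_cases i <;> simp <;> ring
  let T : ℝ × ℝ →ₗ[ℝ] su3 :=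
    { toFun := fun w => ⟨V * D w * Vᴴ, by
        constructor
        · have : (D w)ᴴ = -D w := by
            refine conjTranspose_diagonal_eq_neg fun i => ?_
            fin_cases i <;> simp
          rw [conjTranspose_mul, conjTranspose_mul, conjTranspose_conjTranspose, this, neg_mul,
            mul_neg, mul_assoc]
        · rw [trace_mul_comm, ← mul_assoc, hV, one_mul]
          simp only [D, trace_diagonal, Fin.sum_univ_three]
          simp
          ring⟩
      map_add' := fun v w => by
        apply Subtype.ext
        change V * D (v + w) * Vᴴ = V * D v * Vᴴ + V * D w * Vᴴ
        rw [hDadd, mul_add, add_mul]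
      map_smul' := fun t w => by
        apply Subtype.ext
        change V * D (t • w) * Vᴴ = t • (V * D w * Vᴴ)
        rw [hDsmul, mul_smul_comm, smul_mul_assoc] }
  have hTval : ∀ w, ((T w : su3) : Matrix (Fin 3) (Fin 3) ℂ) = V * D w * Vᴴ := fun w => rfl
  have hback : ∀ A : Matrix (Fin 3) (Fin 3) ℂ, Vᴴ * (V * A * Vᴴ) * V = A := by
    intro A
    calc Vᴴ * (V * A * Vᴴ) * V = (Vᴴ * V) * A * (Vᴴ * V) := by simp only [mul_assoc]
      _ = A := by rw [hV, one_mul, mul_one]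
  have hforth : ∀ A : Matrix (Fin 3) (Fin 3) ℂ, V * (Vᴴ * A * V) * Vᴴ = A := by
    intro A
    calc V * (Vᴴ * A * V) * Vᴴ = (V * Vᴴ) * A * (V * Vᴴ) := by simp only [mul_assoc]
      _ = A := by rw [hVV, one_mul, mul_one]
  have hconj : ∀ A : Matrix (Fin 3) (Fin 3) ℂ,
      (α γ : Matrix (Fin 3) (Fin 3) ℂ) * (V * A * Vᴴ) * (α γ : Matrix (Fin 3) (Fin 3) ℂ)ᴴ
        = V * (dg ζ * A * (dg ζ)ᴴ) * Vᴴ := by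
    intro A
    rw [hαV]
    calc V * dg ζ * Vᴴ * (V * A * Vᴴ) * (V * dg ζ * Vᴴ)ᴴ
        = V * (dg ζ * ((Vᴴ * V) * A * (Vᴴ * V)) * (dg ζ)ᴴ) * Vᴴ := by
          simp only [conjTranspose_mul, conjTranspose_conjTranspose, mul_assoc]
      _ = _ := by rw [hV, one_mul, mul_one]
  have hrange : LinearMap.range T = LinearMap.ker (adRep α γ - 1) := by
    ext X
    rw [hmem]
    constructor
    · rintro ⟨w, rfl⟩
      rw [hTval, hconj]
      congr 2
      have : dg ζ * D w = D w * dg ζ := by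
        simp only [dg, D, diagonal_mul_diagonal]
        congr 1
        funext i
        exact mul_comm _ _
      rw [this, mul_assoc, hdg, mul_one]
    · intro hX
      set A := Vᴴ * (X : Matrix (Fin 3) (Fin 3) ℂ) * V with hA
      have hXA : (X : Matrix (Fin 3) (Fin 3) ℂ) = V * A * Vᴴ := (hforth _).symm
      have hAdg : dg ζ * A = A * dg ζ := by
        have h1 : dg ζ * A * (dg ζ)ᴴ = A := by
          rw [← hback (dg ζ * A * (dg ζ)ᴴ), ← hconj, ← hXA, hX]
        calc dg ζ * A = dg ζ * A * ((dg ζ)ᴴ * dg ζ) := by rw [hdg', mul_one]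
          _ = (dg ζ * A * (dg ζ)ᴴ) * dg ζ := by simp only [mul_assoc]
          _ = _ := by rw [h1]
      have hoff : ∀ i j, i ≠ j → A i j = 0 := by
        intro i j hij
        have h1 := congrFun (congrFun hAdg i) j
        rw [dg, diagonal_mul, mul_diagonal] at h1
        have h2 : (ev ζ i - ev ζ j) * A i j = 0 := by linear_combination h1
        exact (mul_eq_zero.1 h2).resolve_left (sub_ne_zero.2 (ev_ne hζ.im_ne hij))
      have hskew : Aᴴ = -A := by
        rw [hA, conjTranspose_mul, conjTranspose_mul, conjTranspose_conjTranspose, X.2.1, neg_mul,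
          mul_neg, mul_assoc]
      have htrA : A.trace = 0 := by
        rw [hA, trace_mul_comm, ← mul_assoc, hVV, one_mul, X.2.2]
      have hdiag : ∀ i, (((A i i).im : ℝ) : ℂ) * Complex.I = A i i := by
        intro i
        have h1 := congrArg Complex.re (congrFun (congrFun hskew i) i)
        simp only [conjTranspose_apply, RCLike.star_def, Complex.conj_re, Matrix.neg_apply,
          Complex.neg_re] at h1
        have h2 : (A i i).re = 0 := by linarith
        apply Complex.ext <;> simp [h2]
      rw [trace_fin_three] at htrA
      refine ⟨((A 0 0).im, (A 1 1).im), Subtype.ext ?_⟩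
      rw [hTval, hXA]
      congr 2
      ext i j
      by_cases hij : i = j
      · subst hij
        simp only [D, diagonal_apply_eq]
        fin_cases i
        · exact hdiag 0
        · exact hdiag 1
        · change -(_ + _) * Complex.I = A 2 2
          rw [neg_mul, add_mul, hdiag 0, hdiag 1]
          linear_combination -htrA
      · simp only [D, diagonal_apply_ne _ hij]
        exact (hoff i j hij).symm
  have hinj : Function.Injective T := by
    rw [← LinearMap.ker_eq_bot, LinearMap.ker_eq_bot']
    rintro w hw
    have h1 : V * D w * Vᴴ = 0 := congrArg Subtype.val hw
    have h2 : D w = 0 := by rw [← hback (D w), h1, mul_zero, zero_mul]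
    have h3 := congrFun (congrFun h2 0) 0
    have h4 := congrFun (congrFun h2 1) 1
    simp only [D, diagonal_apply_eq, cons_val_zero, cons_val_one, Matrix.zero_apply, mul_eq_zero,
      Complex.I_ne_zero, or_false, Complex.ofReal_eq_zero] at h3 h4
    exact Prod.ext h3 h4
  rw [← hrange, LinearMap.finrank_range_of_inj hinj, finrank_prod, finrank_self]

theorem mem_invariants_adRep {α : Reps p q r a c} {X : su3} :
    X ∈ (adRep α).invariants ↔ ∀ γ,
      (X : Matrix (Fin 3) (Fin 3) ℂ) * (α γ : Matrix (Fin 3) (Fin 3) ℂ)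
      = (α γ : Matrix (Fin 3) (Fin 3) ℂ) * (X : Matrix (Fin 3) (Fin 3) ℂ) := by
  rw [Representation.mem_invariants]
  refine forall_congr' fun γ => ?_
  have h1 := conjTranspose_mul_self_SU (α γ)
  have h2 := mul_conjTranspose_self_SU (α γ)
  rw [Subtype.ext_iff]
  change (α γ : Matrix (Fin 3) (Fin 3) ℂ) * X * (α γ : Matrix (Fin 3) (Fin 3) ℂ)ᴴ = X ↔ _
  constructor
  · intro h
    conv_lhs => rw [← h]
    rw [mul_assoc, h1, mul_one]
  · intro h
    rw [← h, mul_assoc, h2, mul_one]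

theorem Irred.invariants_eq_bot {α : Reps p q r a c} (hα : Irred α) :
    (adRep α).invariants = ⊥ := by
  refine (Submodule.eq_bot_iff _).2 fun X hX => ?_
  obtain ⟨t, ht⟩ := hα.exists_scalar (mem_invariants_adRep.1 hX)
  have h1 := X.2.2
  rw [ht, trace_smul, trace_one, Fintype.card_fin, smul_eq_mul, mul_eq_zero] at h1
  have h2 : t = 0 := h1.resolve_right (by norm_num)
  rw [h2, zero_smul] at ht
  exact Subtype.ext ht

/-- The matrix `diag(i, i, -2i)` centralizes `SU(2) × {1}`. -/
theorem ConjToSU2.invariants_ne_bot {α : Reps p q r a c} {β : Pi1 p q r a c →* SU2}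
    (h : ConjToSU2 α β) : (adRep α).invariants ≠ ⊥ := by
  obtain ⟨g, hg⟩ := h
  set G := (g : Matrix (Fin 3) (Fin 3) ℂ) with hG
  have h1 : Gᴴ * G = 1 := conjTranspose_mul_self_SU g
  have h2 : G * Gᴴ = 1 := mul_conjTranspose_self_SU g
  set D : Matrix (Fin 3) (Fin 3) ℂ := diagonal ![Complex.I, Complex.I, -2 * Complex.I] with hD
  have hDskew : Dᴴ = -D := by
    refine conjTranspose_diagonal_eq_neg fun i => ?_
    fin_cases i <;> simp
  have hDtr : D.trace = 0 := by
    rw [hD, trace_diagonal, Fin.sum_univ_three]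
    simp
    ring
  have hmem : Gᴴ * D * G ∈ su3 := by
    constructor
    · rw [conjTranspose_mul, conjTranspose_mul, conjTranspose_conjTranspose, hDskew, neg_mul,
        mul_neg, mul_assoc]
    · rw [trace_mul_comm, ← mul_assoc, h2, one_mul, hDtr]
  have hcomm : ∀ A : Matrix (Fin 2) (Fin 2) ℂ, D * block A = block A * D := by
    intro A
    ext i j
    rw [hD, diagonal_mul, mul_diagonal]
    fin_cases i <;> fin_cases j <;> simp [block, mul_comm]
  intro hbot
  have hX : (⟨Gᴴ * D * G, hmem⟩ : su3) ∈ (adRep α).invariants := by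
    rw [mem_invariants_adRep]
    intro γ
    have h3 : (α γ : Matrix (Fin 3) (Fin 3) ℂ)
        = Gᴴ * block (β γ : Matrix (Fin 2) (Fin 2) ℂ) * G := by
      rw [← hg]
      change _ = Gᴴ * (G * (α γ : Matrix (Fin 3) (Fin 3) ℂ) * Gᴴ) * G
      calc (α γ : Matrix (Fin 3) (Fin 3) ℂ)
          = (Gᴴ * G) * (α γ : Matrix (Fin 3) (Fin 3) ℂ) * (Gᴴ * G) := by
            rw [h1, one_mul, mul_one]
        _ = _ := by simp only [mul_assoc]
    have e : ∀ A B : Matrix (Fin 3) (Fin 3) ℂ, Gᴴ * A * G * (Gᴴ * B * G) = Gᴴ * (A * B) * G := by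
      intro A B
      calc Gᴴ * A * G * (Gᴴ * B * G) = Gᴴ * A * (G * Gᴴ) * B * G := by simp only [mul_assoc]
        _ = _ := by rw [h2, mul_one]; simp only [mul_assoc]
    rw [h3, e, e, hcomm]
  rw [hbot, Submodule.mem_bot] at hX
  have h3 : Gᴴ * D * G = 0 := congrArg Subtype.val hX
  have h4 : D = 0 := by
    calc D = (G * Gᴴ) * D * (G * Gᴴ) := by rw [h2, one_mul, mul_one]
      _ = G * (Gᴴ * D * G) * Gᴴ := by simp only [mul_assoc]
      _ = 0 := by rw [h3, mul_zero, zero_mul]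
  have h5 := congrFun (congrFun h4 0) 0
  rw [hD, diagonal_apply_eq] at h5
  exact Complex.I_ne_zero h5

variable {ζ ξ ω : ℂ}

theorem HasAngles.adRep_gh {α : Reps p q r a c} (H : HasAngles α ζ ξ ω) :
    adRep α (gh p q r a c) = 1 := by
  refine LinearMap.ext fun X => Subtype.ext ?_
  change (α (gh p q r a c) : Matrix (Fin 3) (Fin 3) ℂ) * X *
    (α (gh p q r a c) : Matrix (Fin 3) (Fin 3) ℂ)ᴴ = X
  rw [H.one, Submonoid.coe_one, conjTranspose_one, one_mul, mul_one]

theorem HasAngles.finrank_map_ker {α : Reps p q r a c} (H : HasAngles α ζ ξ ω) :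
    finrank ℝ ((LinearMap.ker (foxMap (adRep α))).map (genMap (adRep α)))
      + finrank ℝ (LinearMap.range (foxMap (adRep α))) = 18 := by
  have h1 := BrieskornSU3.finrank_map_ker (adRep α)
  rw [finrank_ker_adRep H.x α _ H.tr_x, finrank_ker_adRep H.y α _ H.tr_y,
    finrank_ker_adRep H.z α _ H.tr_z, finrank_su3] at h1
  omega

/-- The Zariski tangent space at an irreducible class has dimension `18 - 8 - 8 = 2`. -/
theorem HasAngles.finrank_H1su3_of_irred (hp : 0 < p) (hq : 0 < q) (hr : 0 < r)
    {α : Reps p q r a c} (H : HasAngles α ζ ξ ω) (hα : Irred α) :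
    finrank ℝ (H1su3 α) = 2 := by
  have hinv := hα.invariants_eq_bot
  obtain ⟨h1, h2⟩ := range_evalMap hp hq hr H.adRep_gh hinv
  have h3 := LinearMap.finrank_range_of_inj h2
  rw [h1] at h3
  have h4 := H.finrank_map_ker
  rw [range_foxMap_eq_top (su3Form_adRep α) su3Form_definite H.adRep_gh hinv, finrank_top,
    finrank_su3, h3] at h4
  have h5 := finrank_H1 (adRep α)
  rw [hinv, finrank_bot, finrank_su3] at h5
  have h6 : finrank ℝ (H1su3 α) + 8 = finrank ℝ (oneCocycles (adRep α)) + 0 := h5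
  omega

/-- The Zariski tangent space at a reducible class has dimension at least three. -/
theorem HasAngles.three_le_finrank_H1su3 {α : Reps p q r a c} (H : HasAngles α ζ ξ ω)
    {β : Pi1 p q r a c →* SU2} (hβ : ConjToSU2 α β) :
    3 ≤ finrank ℝ (H1su3 α) := by
  have hinv := hβ.invariants_ne_bot
  have h1 := finrank_range_foxMap_lt (su3Form_adRep α) su3Form_definite hinv
  have h2 := H.finrank_map_ker
  have h3 := Submodule.finrank_mono (map_ker_le_range (adRep α) H.adRep_gh)
  have h4 := LinearMap.finrank_range_le (evalMap (adRep α))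
  have h5 := finrank_H1 (adRep α)
  have h6 : 0 < finrank ℝ (adRep α).invariants :=
    Nat.pos_of_ne_zero fun h => hinv (Submodule.finrank_eq_zero.1 h)
  rw [finrank_su3] at h1 h5
  have h7 : finrank ℝ (H1su3 α) + 8
    = finrank ℝ (oneCocycles (adRep α)) + finrank ℝ (adRep α).invariants := h5
  omega

end CoeffSu3

/-! ### Pointed spheres -/

section Pointed

variable {p q r : ℕ} {a c : ℤ}

theorem not_isOpen_singleton_sphere (v : Metric.sphere (0 : EuclideanSpace ℝ (Fin 3)) 1) :
    ¬ IsOpen ({v} : Set (Metric.sphere (0 : EuclideanSpace ℝ (Fin 3)) 1)) := by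
  intro h
  have : PathConnectedSpace (Metric.sphere (0 : EuclideanSpace ℝ (Fin 3)) 1) :=
    isPathConnected_iff_pathConnectedSpace.1 isPathConnected_sphere_two
  have h1 := IsClopen.eq_univ ⟨isClosed_singleton, h⟩ (Set.singleton_nonempty v)
  have h2 : -v ∈ ({v} : Set (Metric.sphere (0 : EuclideanSpace ℝ (Fin 3)) 1)) :=
    h1 ▸ Set.mem_univ _
  exact ne_neg_of_mem_unit_sphere ℝ v (Set.mem_singleton_iff.1 h2).symm

/-- If a point of a sphere is the only reducible class on it, it is a limit of irreducible ones. -/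
theorem mem_closure_of_sphere {C : Set (RepVariety p q r a c)}
    (e : C ≃ₜ Metric.sphere (0 : EuclideanSpace ℝ (Fin 3)) 1) {β : Reps p q r a c}
    (hβ : cls β ∈ C) (h : ∀ α : Reps p q r a c, cls α ∈ C → cls α ≠ cls β → Irred α) :
    β ∈ closure {α' : Reps p q r a c | Irred α'} := by
  by_contra hno
  have hO : IsOpen (closure {α' : Reps p q r a c | Irred α'})ᶜ := isClosed_closure.isOpen_compl
  have h1 : (Subtype.val ⁻¹' (cls '' (closure {α' : Reps p q r a c | Irred α'})ᶜ) : Set C)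
      = {⟨cls β, hβ⟩} := by
    ext ⟨ξ, hξ⟩
    rw [Set.mem_singleton_iff, Subtype.mk.injEq]
    constructor
    · rintro ⟨α', hα', rfl⟩
      by_contra hne
      exact hα' (subset_closure (h α' hξ hne))
    · rintro rfl
      exact ⟨β, hno, rfl⟩
  have h2 : IsOpen ({⟨cls β, hβ⟩} : Set C) :=
    h1 ▸ (isOpenMap_cls _ hO).preimage continuous_subtype_val
  have h3 := e.isOpenMap _ h2
  rw [Set.image_singleton] at h3
  exact not_isOpen_singleton_sphere _ h3

/-- Limits of irreducible representations in `SU(2) × {1}` kill the regular fibre: its image is a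
limit of scalar matrices and has an eigenvalue `1`. -/
theorem ConjToSU2.gh_eq_one {α : Reps p q r a c} {β : Pi1 p q r a c →* SU2}
    (h : ConjToSU2 α β) (hα : α ∈ closure {α' : Reps p q r a c | Irred α'}) :
    α (gh p q r a c) = 1 := by
  have hclosed : IsClosed {α' : Reps p q r a c |
      (α' (gh p q r a c) : Matrix (Fin 3) (Fin 3) ℂ)
        = (α' (gh p q r a c) : Matrix (Fin 3) (Fin 3) ℂ) 0 0 •
          (1 : Matrix (Fin 3) (Fin 3) ℂ)} := by
    have h1 := continuous_rep_coe (gh p q r a c)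
    exact isClosed_eq h1 ((h1.matrix_elem 0 0).smul continuous_const)
  have hsub : {α' : Reps p q r a c | Irred α'} ⊆ {α' : Reps p q r a c |
      (α' (gh p q r a c) : Matrix (Fin 3) (Fin 3) ℂ)
        = (α' (gh p q r a c) : Matrix (Fin 3) (Fin 3) ℂ) 0 0 •
          (1 : Matrix (Fin 3) (Fin 3) ℂ)} := by
    intro α' hα'
    obtain ⟨t, ht⟩ := Irred.gh_scalar hα'
    rw [Set.mem_ofPred_eq, ht]
    simp
  have hs := closure_minimal hsub hclosed hα
  rw [Set.mem_ofPred_eq] at hs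
  set t := (α (gh p q r a c) : Matrix (Fin 3) (Fin 3) ℂ) 0 0
  obtain ⟨g, hg⟩ := h
  have h1 : block (β (gh p q r a c) : Matrix (Fin 2) (Fin 2) ℂ)
      = t • (1 : Matrix (Fin 3) (Fin 3) ℂ) := by
    rw [← hg, Submonoid.coe_mul, Submonoid.coe_mul, hs, mul_smul_comm, mul_one, smul_mul_assoc,
      ← Submonoid.coe_mul, mul_inv_cancel, Submonoid.coe_one]
  have h2 : t = 1 := by
    have := congrFun (congrFun h1 2) 2
    simpa [block] using this.symm
  apply Subtype.ext
  rw [hs, h2, one_smul, Submonoid.coe_one]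

theorem red_one : Red (1 : Reps p q r a c) := by
  have h (g) : ∃ s : ℂ, (((1 : Reps p q r a c) g : SU3) : Matrix (Fin 3) (Fin 3) ℂ) *ᵥ
      (Pi.single 0 1 : Fin 3 → ℂ) = s • (Pi.single 0 1 : Fin 3 → ℂ) :=
    ⟨1, by rw [MonoidHom.one_apply, Submonoid.coe_one, Matrix.one_mulVec, one_smul]⟩
  exact red_of_eigenvector (v := Pi.single 0 1) (by simp) (h _) (h _) (h _)

/-- The trivial representation is isolated, since it is the only one with its traces. -/
theorem one_notMem_closure (hp : 0 < p) (hq : 0 < q) (hr : 0 < r) (hpq : p.Coprime q)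
    (hqr : q.Coprime r) (hpr : p.Coprime r) (hac : a * r * (p + q) + c * p * q = 1) :
    (1 : Reps p q r a c) ∉ closure {α' : Reps p q r a c | Irred α'} := by
  intro h
  have hopen : IsOpen (cls ⁻¹' level (cls (1 : Reps p q r a c))) :=
    (isClopen_level hp hq hr hpq hqr hpr hac _).isOpen.preimage continuous_cls
  obtain ⟨α, hα, hirr⟩ := mem_closure_iff.1 h _ hopen (mem_level_self _)
  have h1 : ∀ s, α (gen p q r a c s) = 1 := fun s =>
    eq_one_of_trCls ((hα s).trans (trCls_of_eq_one (by simp)))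
  have h2 : α = 1 := pi1_hom_ext (by rw [h1]; rfl) (by rw [h1]; rfl) (by rw [h1]; rfl)
  exact red_one (h2 ▸ hirr)

/-- The inclusion of the component of a reducible class, as an open embedding of the sphere. -/
theorem exists_sphere_embedding (hp : 0 < p) (hq : 0 < q) (hr : 0 < r) (hpq : p.Coprime q)
    (hqr : q.Coprime r) (hpr : p.Coprime r) (hac : a * r * (p + q) + c * p * q = 1)
    {α : Reps p q r a c} (hα : Red α) (hne : α ≠ 1) (hh : α (gh p q r a c) = 1) :
    ∃ j : Metric.sphere (0 : EuclideanSpace ℝ (Fin 3)) 1 → RepVariety p q r a c,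
      Topology.IsOpenEmbedding j ∧ Set.range j = pathComponent (cls α) := by
  obtain ⟨e⟩ := level_homeo hp hq hr hpq hqr hpr hac hα hne hh
  refine ⟨Subtype.val ∘ e.symm, ?_, ?_⟩
  · exact (isClopen_level hp hq hr hpq hqr hpr hac _).isOpen.isOpenEmbedding_subtypeVal.comp
      e.symm.isOpenEmbedding
  · rw [Set.range_comp, e.symm.surjective.range_eq, Set.image_univ, Subtype.range_coe,
      level_eq_pathComponent hp hq hr hpq hqr hpr hac hα hne hh]

/-- The reducible class on a sphere is not a smooth point: its Zariski tangent space has dimension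
at least three. -/
theorem not_smoothAt (hp : 0 < p) (hq : 0 < q) (hr : 0 < r) (hpq : p.Coprime q)
    (hqr : q.Coprime r) (hpr : p.Coprime r) (hac : a * r * (p + q) + c * p * q = 1)
    {α : Reps p q r a c} (hα : Red α) (hne : α ≠ 1) (hh : α (gh p q r a c) = 1) :
    ¬ SmoothAt α := by
  rintro ⟨U, hU, hαU, ⟨φ⟩⟩
  obtain ⟨j, hj, hjr⟩ := exists_sphere_embedding hp hq hr hpq hqr hpr hac hα hne hh
  obtain ⟨ζ, ξ, ω, H⟩ := exists_hasAngles hpq hqr hpr hac hα hne hh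
  obtain ⟨β, hβ⟩ := hα.exists_conjToSU2 hpq hqr hpr hac
  have h3 := H.three_le_finrank_H1su3 hβ
  have hUC : U ⊆ pathComponent (cls α) := by
    have : PathConnectedSpace U := φ.symm.surjective.pathConnectedSpace φ.symm.continuous
    exact (isPathConnected_iff_pathConnectedSpace.2 this).subset_pathComponent hαU
  have hemb : Topology.IsOpenEmbedding fun w => ((φ.symm w : U) : RepVariety p q r a c) :=
    hU.isOpenEmbedding_subtypeVal.comp φ.symm.isOpenEmbedding
  have hex : ∀ w, ∃ s, j s = ((φ.symm w : U) : RepVariety p q r a c) := by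
    intro w
    have : ((φ.symm w : U) : RepVariety p q r a c) ∈ Set.range j := hjr ▸ hUC (φ.symm w).2
    exact this
  choose f hf using hex
  have hcomp : j ∘ f = fun w => ((φ.symm w : U) : RepVariety p q r a c) := funext hf
  exact not_isOpenEmbedding_sphere h3 (hj.of_comp f (hcomp ▸ hemb))

/-- The irreducible classes on a sphere are smooth points. -/
theorem smoothAt_of_irred (hp : 0 < p) (hq : 0 < q) (hr : 0 < r) (hpq : p.Coprime q)
    (hqr : q.Coprime r) (hpr : p.Coprime r) (hac : a * r * (p + q) + c * p * q = 1)
    {α : Reps p q r a c} (hα : Red α) (hne : α ≠ 1) (hh : α (gh p q r a c) = 1)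
    {α' : Reps p q r a c} (hα' : cls α' ∈ pathComponent (cls α)) (hirr : Irred α') :
    SmoothAt α' := by
  obtain ⟨j, hj, hjr⟩ := exists_sphere_embedding hp hq hr hpq hqr hpr hac hα hne hh
  obtain ⟨ζ, ξ, ω, H⟩ := exists_hasAngles hpq hqr hpr hac hα hne hh
  have H' := H.of_mem_level
    (level_eq_pathComponent hp hq hr hpq hqr hpr hac hα hne hh ▸ hα')
  obtain ⟨v', hv'⟩ : cls α' ∈ Set.range j := hjr ▸ hα'
  have : Fact (finrank ℝ (EuclideanSpace ℝ (Fin 3)) = 2 + 1) := ⟨by simp⟩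
  -- the complement of the antipode is a chart
  set st := stereographic' 2 (-v') with hst
  have hsrc : st.symm.source = Set.univ := stereographic'_target _
  have hk : Topology.IsOpenEmbedding st.symm := st.symm.isOpenEmbedding hsrc
  have hjk := hj.comp hk
  unfold SmoothAt
  rw [H'.finrank_H1su3_of_irred hp hq hr hirr]
  refine ⟨Set.range (j ∘ st.symm), hjk.isOpen_range, ?_, ⟨hjk.isEmbedding.toHomeomorph.symm⟩⟩
  have hv : v' ∈ st.source := by
    rw [hst, stereographic'_source]
    intro h
    exact ne_neg_of_mem_unit_sphere ℝ v' (Set.mem_singleton_iff.1 h)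
  exact ⟨st v', by rw [Function.comp_apply, st.left_inv hv, hv']⟩

theorem isPointedSphere (hp : 0 < p) (hq : 0 < q) (hr : 0 < r) (hpq : p.Coprime q)
    (hqr : q.Coprime r) (hpr : p.Coprime r) (hac : a * r * (p + q) + c * p * q = 1)
    {α : Reps p q r a c} (hα : Red α) (hne : α ≠ 1) (hh : α (gh p q r a c) = 1) :
    IsPointedSphere (pathComponent (cls α)) where
  isPathComponent := ⟨_, rfl⟩
  homeo := level_eq_pathComponent hp hq hr hpq hqr hpr hac hα hne hh ▸
    level_homeo hp hq hr hpq hqr hpr hac hα hne hh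
  exists_point := by
    refine ⟨α, mem_pathComponent_self _, hα, not_smoothAt hp hq hr hpq hqr hpr hac hα hne hh,
      fun α' h' hne' => ?_⟩
    have hirr : Irred α' := by
      by_contra hred
      refine hne' (cls_eq_of_red hpq hqr hpr hac hα hne hh ?_ hred)
      exact level_eq_pathComponent hp hq hr hpq hqr hpr hac hα hne hh ▸ h'
    exact ⟨hirr, smoothAt_of_irred hp hq hr hpq hqr hpr hac hα hne hh h' hirr⟩

/-- Every pointed sphere is the component of a class in `reducibleClasses`: its reducible class is a
limit of irreducible ones, hence kills the regular fibre, and it is not trivial. -/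
theorem IsPointedSphere.exists_reducible (hp : 0 < p) (hq : 0 < q) (hr : 0 < r)
    (hpq : p.Coprime q) (hqr : q.Coprime r) (hpr : p.Coprime r)
    (hac : a * r * (p + q) + c * p * q = 1) {C : Set (RepVariety p q r a c)}
    (hC : IsPointedSphere C) :
    ∃ ξ ∈ reducibleClasses p q r a c, pathComponent ξ = C := by
  obtain ⟨η, hη⟩ := hC.isPathComponent
  obtain ⟨e⟩ := hC.homeo
  obtain ⟨β, hβC, hβ, -, hirr⟩ := hC.exists_point
  have hcl := mem_closure_of_sphere e hβC fun α h h' => (hirr α h h').1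
  obtain ⟨b, hb⟩ := hβ.exists_conjToSU2 hpq hqr hpr hac
  refine ⟨cls β, ⟨β, rfl, hβ, ?_, hb.gh_eq_one hcl⟩, ?_⟩
  · rintro rfl
    exact one_notMem_closure hp hq hr hpq hqr hpr hac hcl
  · rw [hη] at hβC ⊢
    exact pathComponent_congr hβC

end Pointed

end

end BrieskornSU3

theorem proposition2p5 (p q r : ℕ) (a c : ℤ) (hp : 0 < p) (hq : 0 < q) (hr : 0 < r)
    (hpq : p.Coprime q) (hqr : q.Coprime r) (hpr : p.Coprime r)
    (hac : a * r * (p + q) + c * p * q = 1) :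
    (∀ α : BrieskornSU3.Reps p q r a c, BrieskornSU3.Red α → α ≠ 1 →
      (∃ β : BrieskornSU3.Pi1 p q r a c →* BrieskornSU3.SU2, BrieskornSU3.ConjToSU2 α β) ∧
      ∀ β : BrieskornSU3.Pi1 p q r a c →* BrieskornSU3.SU2, BrieskornSU3.ConjToSU2 α β →
        List.TFAE [
          α (BrieskornSU3.gen p q r a c BrieskornSU3.Gen.h) = 1,
          Nontrivial (BrieskornSU3.H1C2 β),
          α ∈ closure {α' : BrieskornSU3.Reps p q r a c | BrieskornSU3.Irred α'}]) ∧
    Set.BijOn (fun ξ : BrieskornSU3.RepVariety p q r a c => pathComponent ξ)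
      (BrieskornSU3.reducibleClasses p q r a c)
      {C | BrieskornSU3.IsPointedSphere C} ∧
    (∀ C : Set (BrieskornSU3.RepVariety p q r a c), BrieskornSU3.IsPointedSphere C →
      ∀ α α' : BrieskornSU3.Reps p q r a c, BrieskornSU3.cls α ∈ C → BrieskornSU3.cls α' ∈ C →
        Matrix.trace (α (BrieskornSU3.gen p q r a c BrieskornSU3.Gen.z) :
            Matrix (Fin 3) (Fin 3) ℂ) =
          Matrix.trace (α' (BrieskornSU3.gen p q r a c BrieskornSU3.Gen.z) :
            Matrix (Fin 3) (Fin 3) ℂ)) := by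
  refine ⟨fun α hα hne => ⟨hα.exists_conjToSU2 hpq hqr hpr hac, fun β hβ => ?_⟩,
    ⟨?_, ?_, ?_⟩, ?_⟩
  · tfae_have 1 ↔ 2 := by
      rw [BrieskornSU3.nontrivial_H1C2_iff hpq hqr hpr hac (hβ.ne_one hne)]
      exact hβ.eq_one_iff _
    tfae_have 3 → 1 := hβ.gh_eq_one
    tfae_have 1 → 3 := by
      intro hh
      have hS := BrieskornSU3.isPointedSphere hp hq hr hpq hqr hpr hac hα hne hh
      obtain ⟨e⟩ := hS.homeo
      refine BrieskornSU3.mem_closure_of_sphere e (mem_pathComponent_self _) fun α' h h' => ?_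
      by_contra hred
      refine h' (BrieskornSU3.cls_eq_of_red hpq hqr hpr hac hα hne hh ?_ hred)
      exact BrieskornSU3.pathComponent_subset_level hp hq hr hpq hqr hpr hac _ h
    tfae_finish
  · rintro ξ ⟨α, rfl, hα, hne, hh⟩
    exact BrieskornSU3.isPointedSphere hp hq hr hpq hqr hpr hac hα hne hh
  · rintro ξ ⟨α, rfl, hα, hne, hh⟩ ξ' ⟨α', rfl, hα', -, -⟩ heq
    have h1 : BrieskornSU3.cls α' ∈ pathComponent (BrieskornSU3.cls α) := by
      have h2 : pathComponent (BrieskornSU3.cls α) = pathComponent (BrieskornSU3.cls α') := heq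
      rw [h2]
      exact mem_pathComponent_self _
    exact (BrieskornSU3.cls_eq_of_red hpq hqr hpr hac hα hne hh
      (BrieskornSU3.pathComponent_subset_level hp hq hr hpq hqr hpr hac _ h1) hα').symm
  · intro C hC
    exact BrieskornSU3.IsPointedSphere.exists_reducible hp hq hr hpq hqr hpr hac hC
  · intro C hC α α' hα hα'
    obtain ⟨η, rfl⟩ := hC.isPathComponent
    have h := BrieskornSU3.pathComponent_subset_level hp hq hr hpq hqr hpr hac η
    exact (h hα BrieskornSU3.Gen.z).trans (h hα' BrieskornSU3.Gen.z).symm
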